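/- Let $n\ge 2$ and let $O_n$ be the Cuntz algebra, the universal $C^*$-algebra generated by isometries $S_1,\dots,S_n$ with $\sum_i S_iS_i^*=1$. For a word $\mu=\mu_1\cdots\mu_k$ put $|\mu|=k$, $S_\mu=S_{\mu_1}\cdots S_{\mu_k}$, and let $O_{nc}=\mathrm{span}\{S_\mu S_\nu^*\}$. Let $\gamma$ be the gauge action of the circle, $\gamma_z(S_i)=zS_i$, let $F=O_n^\gamma$ be its fixed-point algebra, $\Phi(a)=\frac1{2\pi}\int_0^{2\pi}\gamma_{e^{i\theta}}(a)\,d\theta$ the expectation of $O_n$ onto $F$, and $\tau$ the (unique) normalised trace on $F$. Let $\mathcal H=L^2(O_n)$ be the completion of $O_n$ for $\langle a,b\rangle=\tau(\Phi(a^*b))$, on which $O_n$ acts by left multiplication, and let $\mathcal D$ be the self-adjoint closure on $\mathcal H$ of $S_\mu S_\nu^*\mapsto(|\mu|-|\nu|)S_\mu S_\nu^*$. Let $\Delta=S^*S$ be the modular operator, where $S$ is the closure of $a\mapsto a^*$ on $O_{nc}$. Let $\mathcal N\subset\mathcal B(\mathcal H)$ be the von Neumann algebra generated by the operators $\Theta_{x,y}\colon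 z\mapsto x\,\Phi(y^*z)$, $x,y\in O_{nc}$, with the trace $$\tilde\tau(T)=\langle 1,T1\rangle+\sum_{|\mu|\ge1}\Big(\langle S_\mu,TS_\mu\rangle+n^{-|\mu|}\langle S_\mu^*,TS_\mu^*\rangle\Big),\qquad T\in\mathcal N_+ .$$ Let $\tau_\Delta=\tilde\tau(\Delta\,\cdot)$, that is $\tau_\Delta(T)=\lim_{\varepsilon\downarrow0}\tilde\tau(\Delta_\varepsilon^{1/2}T\Delta_\varepsilon^{1/2})$ for $T\in\mathcal N_+$, where $\Delta_\varepsilon=\Delta(1+\varepsilon\Delta)^{-1}$, and let $\mathcal M=\mathcal N^{\sigma}$ be the fixed-point algebra of the modular automorphism group $\sigma$ of the weight $\tau_\Delta$ (the weakly continuous one-parameter group of automorphisms of $\mathcal N$ that leaves $\tau_\Delta$ invariant and satisfies the KMS condition for it). For $T\in\mathcal M$ and $t>0$ let $\mu_t(T)=\inf\{\|TE\|: E\in\mathcal M\text{ a projection},\ \tau_\Delta(1-E)\le t\}$ and $F_T(t)=\frac1{\log(1+t)}\int_0^t\mu_s(T)\,ds$, and let $\mathcal L^{(1,\infty)}(\mathcal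 M,\tau_\Delta)=\{T\in\mathcal M:\sup_{t>0}F_T(t)<\infty\}$. For a state $\omega$ on $L^\infty(\mathbf R_+^*)$ with $\omega(g)=\lim_{t\to\infty}g(t)$ whenever this limit exists, put $\tau_{\Delta,\omega}(T)=\omega(F_T)$ for $0\le T\in\mathcal L^{(1,\infty)}(\mathcal M,\tau_\Delta)$, extended to all $T\in\mathcal L^{(1,\infty)}(\mathcal M,\tau_\Delta)$ through the decomposition of $T$ into the positive and negative parts of its real and imaginary parts. Every Dixmier trace is of this form. Then $(1+\mathcal D^2)^{-1/2}\in\mathcal L^{(1,\infty)}(\mathcal M,\tau_\Delta)$, and for every $f\in F$ one has $f(1+\mathcal D^2)^{-1/2}\in\mathcal L^{(1,\infty)}(\mathcal M,\tau_\Delta)$ and, for every such $\omega$ (in particular for every Dixmier trace), $$\tau_{\Delta,\omega}\big(f(1+\mathcal D^2)^{-1/2}\big)=2\,\tau(f).$$ -/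

import Mathlib

open scoped ENNReal ComplexOrder InnerProductSpace
open MeasureTheory

noncomputable section

/-! ### The Cuntz algebra -/

namespace Cuntz

/-- `n` isometries whose range projections sum to one. -/
def IsCuntzFamily {n : ℕ} {B : Type*} [Ring B] [StarRing B] (T : Fin n → B) : Prop :=
  (∀ i, star (T i) * T i = 1) ∧ ∑ i, T i * star (T i) = 1

/-- The separable infinite-dimensional Hilbert space `ℓ²(ℕ)`. -/
abbrev Ell2 : Type := lp (fun _ : ℕ => ℂ) 2

/-- The bounded operators on `ℓ²(ℕ)`. -/
abbrev BOp : Type := Ell2 →L[ℂ] Ell2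

/-- All Cuntz families of `n` isometries on `ℓ²(ℕ)`. -/
def Family (n : ℕ) : Type := {T : Fin n → BOp // IsCuntzFamily T}

/-- Bounded families of operators on `ℓ²(ℕ)`, indexed by all Cuntz families. -/
abbrev Ambient (n : ℕ) : Type := lp (fun _ : Family n => BOp) ∞

instance instNontrivialEll2 : Nontrivial Ell2 :=
  ⟨lp.single 2 0 1, 0, by
    intro h
    have := congrArg (fun x : Ell2 => x 0) h
    simp at this⟩

instance instCStarAlgebraAmbient (n : ℕ) : CStarAlgebra (Ambient n) where

theorem norm_family_le {n : ℕ} (T : Family n) (i : Fin n) : ‖T.1 i‖ ≤ 1 := by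
  have h := CStarRing.norm_star_mul_self (x := T.1 i)
  rw [T.2.1 i, norm_one] at h
  nlinarith [norm_nonneg (T.1 i)]

/-- The universal `i`-th isometry: its component at the family `T` is `T i`. -/
def ambientGen (n : ℕ) (i : Fin n) : Ambient n :=
  ⟨fun T => T.1 i, memℓp_infty ⟨1, by rintro _ ⟨T, rfl⟩; exact norm_family_le T i⟩⟩

/-- The C*-algebra generated by the universal isometries. -/
def subalgebra (n : ℕ) : StarSubalgebra ℂ (Ambient n) :=
  (StarAlgebra.adjoin ℂ (Set.range (ambientGen n))).topologicalClosure

instance instIsClosedSubalgebra (n : ℕ) : IsClosed (subalgebra n : Set (Ambient n)) :=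
  StarSubalgebra.isClosed_topologicalClosure _

/-- The Cuntz algebra `O_n`: the universal C*-algebra generated by `n` isometries `S_i` with
`∑ S_i S_i* = 1`. It is separable, so its universal norm is attained as the supremum over
all Cuntz families on `ℓ²(ℕ)`, which is how it is realised here. -/
def Alg (n : ℕ) : Type := subalgebra n

instance instCStarAlgebra (n : ℕ) : CStarAlgebra (Alg n) :=
  inferInstanceAs (CStarAlgebra (subalgebra n))

/-- The order of a C*-algebra: `0 ≤ a` iff `a = b* b` for some `b`. -/
instance instPartialOrder (n : ℕ) : PartialOrder (Alg n) := CStarAlgebra.spectralOrder _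

instance instStarOrderedRing (n : ℕ) : StarOrderedRing (Alg n) :=
  CStarAlgebra.spectralOrderedRing _

theorem ambientGen_mem (n : ℕ) (i : Fin n) : ambientGen n i ∈ subalgebra n :=
  StarSubalgebra.le_topologicalClosure _ (StarAlgebra.subset_adjoin ℂ _ ⟨i, rfl⟩)

/-- The generating isometries `S_i` of `O_n`. -/
def S {n : ℕ} (i : Fin n) : Alg n := ⟨ambientGen n i, ambientGen_mem n i⟩

/-- The `*`-homomorphism `O_n → B(ℓ²(ℕ))` with `S_i ↦ T_i`, for a Cuntz family `T`. -/
def eval {n : ℕ} (T : Family n) : Alg n →⋆ₐ[ℂ] BOp where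
  toFun a := a.1 T
  map_one' := rfl
  map_mul' _ _ := rfl
  map_zero' := rfl
  map_add' _ _ := rfl
  commutes' _ := rfl
  map_star' _ := rfl

theorem ext_eval {n : ℕ} {a b : Alg n} (h : ∀ T : Family n, eval T a = eval T b) : a = b :=
  Subtype.ext (Subtype.ext (funext h))

theorem isCuntzFamily_S (n : ℕ) : IsCuntzFamily (S : Fin n → Alg n) := by
  refine ⟨fun i => ext_eval fun T => T.2.1 i, ext_eval fun T => ?_⟩
  rw [map_sum, map_one, ← T.2.2]
  rfl

/-- `S_μ = S_{μ_1} ⋯ S_{μ_k}` for a word `μ`. -/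
def word {n : ℕ} (μ : List (Fin n)) : Alg n := (μ.map S).prod

/-- `O_{nc} = span {S_μ S_ν*}`. -/
def core (n : ℕ) : Submodule ℂ (Alg n) :=
  Submodule.span ℂ
    (Set.range fun p : List (Fin n) × List (Fin n) => word p.1 * star (word p.2))

/-! ### The gauge action, its fixed-point algebra and the expectation -/

/-- The Cuntz family `(z T_1, …, z T_n)`. -/
def rotate {n : ℕ} (z : Circle) (T : Family n) : Family n :=
  ⟨fun i => (z : ℂ) • T.1 i, by
    have hz : star (z : ℂ) * (z : ℂ) = 1 := by
      rw [Complex.star_def, ← Complex.normSq_eq_conj_mul_self]; simp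
    refine ⟨fun i => ?_, ?_⟩
    · rw [star_smul, smul_mul_smul_comm, hz, one_smul, T.2.1 i]
    · rw [← T.2.2]
      refine Finset.sum_congr rfl fun i _ => ?_
      rw [star_smul, smul_mul_smul_comm, mul_comm, hz, one_smul]⟩

/-- The automorphism of the ambient algebra with `S_i ↦ z S_i`. -/
def ambientGauge {n : ℕ} (z : Circle) : Ambient n →⋆ₐ[ℂ] Ambient n where
  toFun x := ⟨fun T => x (rotate z T), memℓp_infty ⟨‖x‖, by
    rintro _ ⟨T, rfl⟩; exact lp.norm_apply_le_norm ENNReal.top_ne_zero x _⟩⟩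
  map_one' := rfl
  map_mul' _ _ := rfl
  map_zero' := rfl
  map_add' _ _ := rfl
  commutes' _ := rfl
  map_star' _ := rfl

theorem ambientGauge_gen {n : ℕ} (z : Circle) (i : Fin n) :
    ambientGauge z (ambientGen n i) = (z : ℂ) • ambientGen n i := rfl

theorem norm_ambientGauge_le {n : ℕ} (z : Circle) (x : Ambient n) :
    ‖ambientGauge z x‖ ≤ ‖x‖ :=
  lp.norm_le_of_forall_le (norm_nonneg x)
    fun _ => lp.norm_apply_le_norm ENNReal.top_ne_zero x _

theorem continuous_ambientGauge {n : ℕ} (z : Circle) :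
    Continuous (ambientGauge z : Ambient n → Ambient n) :=
  AddMonoidHomClass.continuous_of_bound (ambientGauge z) 1
    fun x => by simpa using norm_ambientGauge_le z x

theorem ambientGauge_mem {n : ℕ} (z : Circle) {x : Ambient n} (hx : x ∈ subalgebra n) :
    ambientGauge z x ∈ subalgebra n := by
  have h : subalgebra n ≤ (subalgebra n).comap (ambientGauge z) := by
    refine StarSubalgebra.topologicalClosure_minimal ?_
      ((instIsClosedSubalgebra n).preimage (continuous_ambientGauge z))
    refine StarAlgebra.adjoin_le ?_
    rintro _ ⟨i, rfl⟩
    change ambientGauge z (ambientGen n i) ∈ subalgebra n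
    rw [ambientGauge_gen]
    exact (subalgebra n).smul_mem (ambientGen_mem n i) _
  exact h hx

/-- The gauge action `γ_z` on `O_n`, the `*`-homomorphism with `γ_z(S_i) = z S_i`. -/
def gauge {n : ℕ} (z : Circle) : Alg n →⋆ₐ[ℂ] Alg n where
  toFun a := ⟨ambientGauge z a.1, ambientGauge_mem z a.2⟩
  map_one' := rfl
  map_mul' _ _ := rfl
  map_zero' := rfl
  map_add' _ _ := rfl
  commutes' _ := rfl
  map_star' _ := rfl

theorem gauge_S {n : ℕ} (z : Circle) (i : Fin n) : gauge z (S i) = (z : ℂ) • S i := rfl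

theorem norm_gauge_le {n : ℕ} (z : Circle) (a : Alg n) : ‖gauge z a‖ ≤ ‖a‖ :=
  norm_ambientGauge_le z a.1

theorem rotate_rotate {n : ℕ} (z w : Circle) (T : Family n) :
    rotate z (rotate w T) = rotate (w * z) T := by
  apply Subtype.ext
  funext i
  change (z : ℂ) • ((w : ℂ) • T.1 i) = ((w * z : Circle) : ℂ) • T.1 i
  rw [smul_smul, Circle.coe_mul, mul_comm]

theorem gauge_gauge {n : ℕ} (z w : Circle) (a : Alg n) :
    gauge z (gauge w a) = gauge (z * w) a := by
  apply Subtype.ext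
  apply Subtype.ext
  funext T
  change a.1 (rotate w (rotate z T)) = a.1 (rotate (z * w) T)
  rw [rotate_rotate]

theorem continuous_gauge_apply {n : ℕ} (a : Alg n) :
    Continuous fun z : Circle => gauge z a := by
  let A : StarSubalgebra ℂ (Ambient n) :=
    { carrier := {x | Continuous fun z : Circle => ambientGauge z x}
      mul_mem' := fun {x y} hx hy => by
        simp only [Set.mem_ofPred_eq, map_mul] at *
        exact hx.mul hy
      add_mem' := fun {x y} hx hy => by
        simp only [Set.mem_ofPred_eq, map_add] at *
        exact hx.add hy
      algebraMap_mem' := fun r => by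
        simp only [Set.mem_ofPred_eq, AlgHomClass.commutes]
        exact continuous_const
      star_mem' := fun {x} hx => by
        change Continuous fun z : Circle => ambientGauge z (star x)
        simp only [map_star]
        exact Continuous.star hx }
  have hA : IsClosed (A : Set (Ambient n)) := by
    rw [← closure_subset_iff_isClosed]
    intro x hx
    change Continuous fun z : Circle => ambientGauge z x
    refine continuous_of_uniform_approx_of_continuous fun u hu => ?_
    obtain ⟨ε, hε, hεu⟩ := Metric.mem_uniformity_dist.1 hu
    obtain ⟨y, hy, hxy⟩ := Metric.mem_closure_iff.1 hx ε hε
    refine ⟨fun z => ambientGauge z y, hy, fun z => hεu ?_⟩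
    rw [dist_eq_norm, ← map_sub]
    exact (norm_ambientGauge_le z _).trans_lt (by rwa [← dist_eq_norm])
  have h : subalgebra n ≤ A := by
    refine StarSubalgebra.topologicalClosure_minimal (StarAlgebra.adjoin_le ?_) hA
    rintro _ ⟨i, rfl⟩
    change Continuous fun z : Circle => ambientGauge z (ambientGen n i)
    simp only [ambientGauge_gen]
    fun_prop
  exact (h a.2 : Continuous fun z : Circle => ambientGauge z a.1).subtype_mk _

/-- The gauge-fixed algebra `F = O_n^γ`. -/
def fixedAlg (n : ℕ) : StarSubalgebra ℂ (Alg n) where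
  carrier := {a | ∀ z : Circle, gauge z a = a}
  mul_mem' := fun {a b} ha hb z => by rw [map_mul, ha z, hb z]
  add_mem' := fun {a b} ha hb z => by rw [map_add, ha z, hb z]
  algebraMap_mem' := fun r z => by rw [AlgHomClass.commutes]
  star_mem' := fun {a} ha z => by rw [map_star, ha z]

theorem continuous_gauge_exp {n : ℕ} (a : Alg n) :
    Continuous fun θ : ℝ => gauge (Circle.exp θ) a :=
  (continuous_gauge_apply a).comp Circle.exp.continuous

/-- `Φ(a) = (1/2π) ∫ γ_z(a) dθ`, `z = e^{iθ}`, with values in `O_n`. -/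
def gaugeMean {n : ℕ} (a : Alg n) : Alg n :=
  (2 * Real.pi)⁻¹ • ∫ θ in (0 : ℝ)..(2 * Real.pi), gauge (Circle.exp θ) a

theorem continuous_gauge {n : ℕ} (z : Circle) : Continuous (gauge z : Alg n → Alg n) :=
  AddMonoidHomClass.continuous_of_bound (gauge z) 1
    fun x => by simpa using norm_gauge_le z x

/-- `γ_z` as a continuous real-linear map. -/
def gaugeCLM {n : ℕ} (z : Circle) : Alg n →L[ℝ] Alg n where
  toFun := gauge z
  map_add' := map_add _
  map_smul' r a := by
    have h := map_smul (gauge z) (r : ℂ) a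
    simpa using h
  cont := continuous_gauge z

theorem gaugeMean_mem {n : ℕ} (a : Alg n) : gaugeMean a ∈ fixedAlg n := by
  intro z
  obtain ⟨s, rfl⟩ : ∃ s : ℝ, Circle.exp s = z := ⟨Complex.arg z, Circle.exp_arg z⟩
  change gaugeCLM (Circle.exp s) (gaugeMean a) = gaugeMean a
  unfold gaugeMean
  rw [map_smul, ← ContinuousLinearMap.intervalIntegral_comp_comm _
    ((continuous_gauge_exp a).intervalIntegrable _ _)]
  congr 1
  have h1 : ∀ θ : ℝ, gaugeCLM (Circle.exp s) (gauge (Circle.exp θ) a)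
      = (fun θ : ℝ => gauge (Circle.exp θ) a) (θ + s) := by
    intro θ
    change gauge _ (gauge _ a) = gauge _ a
    rw [gauge_gauge, ← Circle.exp_add, add_comm]
  simp_rw [h1]
  rw [intervalIntegral.integral_comp_add_right (fun θ : ℝ => gauge (Circle.exp θ) a)]
  have hp : Function.Periodic (fun θ : ℝ => gauge (Circle.exp θ) a) (2 * Real.pi) := by
    intro θ
    change gauge _ a = gauge _ a
    rw [Circle.periodic_exp θ]
  have := hp.intervalIntegral_add_eq s 0
  rw [zero_add] at this ⊢
  rw [add_comm (2 * Real.pi) s, this]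

/-- The expectation `Φ : O_n → F`. -/
def expect (n : ℕ) : Alg n →ₗ[ℂ] fixedAlg n where
  toFun a := ⟨gaugeMean a, gaugeMean_mem a⟩
  map_add' a b := by
    apply Subtype.ext
    change gaugeMean (a + b) = gaugeMean a + gaugeMean b
    unfold gaugeMean
    simp_rw [map_add]
    rw [intervalIntegral.integral_add ((continuous_gauge_exp a).intervalIntegrable _ _)
      ((continuous_gauge_exp b).intervalIntegrable _ _), smul_add]
  map_smul' c a := by
    apply Subtype.ext
    change gaugeMean (c • a) = c • gaugeMean a
    unfold gaugeMean
    simp_rw [map_smul]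
    rw [intervalIntegral.integral_smul, smul_comm]

theorem gaugeMean_nonneg {n : ℕ} {a : Alg n} (ha : 0 ≤ a) : 0 ≤ gaugeMean a := by
  unfold gaugeMean
  refine smul_nonneg (by positivity) ?_
  rw [intervalIntegral.integral_of_le Real.two_pi_pos.le]
  exact integral_nonneg fun θ => map_nonneg (gauge (Circle.exp θ)) ha

/-! ### The trace on `F` and the Hilbert space `L²(O_n, τ ∘ Φ)` -/

/-- A normalised trace on the gauge-fixed algebra `F` (there is exactly one for `2 ≤ n`). -/
structure TracialState (n : ℕ) where
  toLinearMap : fixedAlg n →ₗ[ℂ] ℂ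
  nonneg : ∀ a : fixedAlg n, 0 ≤ (a : Alg n) → 0 ≤ toLinearMap a
  map_one : toLinearMap 1 = 1
  map_mul_comm : ∀ a b : fixedAlg n, toLinearMap (a * b) = toLinearMap (b * a)

variable {n : ℕ} (τ : TracialState n)

/-- The state `τ ∘ Φ` on `O_n`. -/
def kmsState : Alg n →ₚ[ℂ] ℂ :=
  PositiveLinearMap.mk₀ (τ.toLinearMap ∘ₗ expect n)
    fun _ ha => τ.nonneg _ (gaugeMean_nonneg ha)

/-- `ℋ = L²(O_n)`, the completion of `O_n` for `⟨a, b⟩ = (τ ∘ Φ)(a* b)`. -/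
abbrev Hilb : Type := (kmsState τ).GNS

/-- The canonical map `O_n → ℋ`. -/
def toHilb (a : Alg n) : Hilb τ := (((kmsState τ).toPreGNS a : (kmsState τ).PreGNS) : Hilb τ)

/-- The representation of `O_n` on `ℋ` by left multiplication. -/
abbrev rep : Alg n →⋆ₐ[ℂ] (Hilb τ →L[ℂ] Hilb τ) := (kmsState τ).gnsStarAlgHom

end Cuntz

/-! ### Unbounded operators through their graphs -/

namespace OperatorTheory

variable {H : Type*} [NormedAddCommGroup H] [InnerProductSpace ℂ H] [CompleteSpace H]

/-- `R = (1 + D²)^{-1/2}`: `R` is positive and `(1 + D²) R² = 1`, where `D` is given by its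
graph. For self-adjoint `D` there is exactly one such `R`. -/
def IsInvSqrtOneAddSq (D : Set (H × H)) (R : H →L[ℂ] H) : Prop :=
  0 ≤ R ∧ ∀ ξ : H, ∃ η ζ : H, (R (R ξ), η) ∈ D ∧ (η, ζ) ∈ D ∧ R (R ξ) + ζ = ξ

open Classical in
/-- The bounded operator `(1 + D²)^{-1/2}` for a self-adjoint `D`. -/
def invSqrtOneAddSq (D : Set (H × H)) : H →L[ℂ] H :=
  if h : ∃ R, IsInvSqrtOneAddSq D R then h.choose else 0

/-- `A = Δ (1 + ε Δ)⁻¹`, where `Δ` is given by its graph: `Δ` is defined at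
`(1 + ε Δ)⁻¹ ξ = ξ - ε A ξ` with value `A ξ`. For `Δ` positive self-adjoint and `ε > 0` there is
exactly one such `A`. -/
def IsBoundedApprox (Δ : Set (H × H)) (ε : ℝ) (A : H →L[ℂ] H) : Prop :=
  ∀ ξ : H, (ξ - (ε : ℂ) • A ξ, A ξ) ∈ Δ

open Classical in
/-- The bounded operator `Δ_ε = Δ (1 + ε Δ)⁻¹` for `Δ` positive self-adjoint. -/
def boundedApprox (Δ : Set (H × H)) (ε : ℝ) : H →L[ℂ] H :=
  if h : ∃ A, IsBoundedApprox Δ ε A then h.choose else 0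

/-- The graph of `S*S` for a closed densely defined conjugate-linear operator `S` given by its
graph: `S*S ξ = ζ` iff `ξ ∈ dom S` and `⟨ξ', ζ⟩ = ⟨S ξ, S ξ'⟩` for all `ξ' ∈ dom S`. -/
def antilinearStarMulSelf (S : Set (H × H)) : Set (H × H) :=
  {p | ∃ η : H, (p.1, η) ∈ S ∧ ∀ q ∈ S, ⟪q.1, p.2⟫_ℂ = ⟪η, q.2⟫_ℂ}

/-- For a trace `t` and a positive self-adjoint `Δ` (given by its graph), the weight
`T ↦ t(Δ T) = lim_{ε ↓ 0} t(Δ_ε^{1/2} T Δ_ε^{1/2})` on positive operators `T`, where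
`Δ_ε = Δ (1 + ε Δ)⁻¹`. The limit is increasing. -/
def weightOfTrace (t : (H →L[ℂ] H) → ℝ≥0∞) (Δ : Set (H × H)) (T : H →L[ℂ] H) : ℝ≥0∞ :=
  ⨆ (ε : ℝ) (_ : 0 < ε),
    t (CFC.sqrt (boundedApprox Δ ε) * T * CFC.sqrt (boundedApprox Δ ε))

/-- The von Neumann algebra `(s ∪ s*)''` generated by a set `s`. -/
def bicommutant (s : Set (H →L[ℂ] H)) : VonNeumannAlgebra H where
  toStarSubalgebra :=
    StarSubalgebra.centralizer ℂ (StarSubalgebra.centralizer ℂ s : Set (H →L[ℂ] H))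
  centralizer_centralizer' := by
    change Set.centralizer (Set.centralizer
      ((StarSubalgebra.centralizer ℂ (StarSubalgebra.centralizer ℂ s : Set (H →L[ℂ] H)) :
        StarSubalgebra ℂ (H →L[ℂ] H)) : Set (H →L[ℂ] H))) = _
    rw [StarSubalgebra.coe_centralizer_centralizer, Set.centralizer_centralizer_centralizer]
    exact (StarSubalgebra.coe_centralizer_centralizer ℂ s).symm

/-! ### Weights, modular automorphism groups -/

/-- `φ(y* x)` for `x, y` with `φ(x* x), φ(y* y) < ∞`, by polarisation from the values of the
weight `φ` on positive operators. -/
def weightForm (φ : (H →L[ℂ] H) → ℝ≥0∞) (y x : H →L[ℂ] H) : ℂ :=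
  (1 / 4 : ℂ) * ∑ k ∈ Finset.range 4, Complex.I ^ k *
    ((φ (star (x + Complex.I ^ k • y) * (x + Complex.I ^ k • y))).toReal : ℂ)

/-- `σ` is the modular automorphism group of the weight `φ` on `N`: a weakly continuous
one-parameter group of automorphisms that leaves `φ` invariant and satisfies the KMS condition,
that is, for all `x, y` with `x, x*, y, y*` square integrable there is a bounded continuous
function `f` on the strip `0 ≤ Im z ≤ 1`, holomorphic inside, with `f(t) = φ(σ_t(x) y)` and
`f(t + i) = φ(y σ_t(x))`. -/
structure IsModularGroup (N : StarSubalgebra ℂ (H →L[ℂ] H)) (φ : (H →L[ℂ] H) → ℝ≥0∞)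
    (σ : ℝ → (N ≃⋆ₐ[ℂ] N)) : Prop where
  map_zero : ∀ x, σ 0 x = x
  map_add : ∀ s t x, σ (s + t) x = σ s (σ t x)
  continuous : ∀ (x : N) (ξ η : H),
    Continuous fun t : ℝ => ⟪η, (σ t x : H →L[ℂ] H) ξ⟫_ℂ
  invariant : ∀ (t : ℝ) (x : N), 0 ≤ (x : H →L[ℂ] H) →
    φ (σ t x : H →L[ℂ] H) = φ (x : H →L[ℂ] H)
  kms : ∀ x y : N,
    φ ((star x * x : N) : H →L[ℂ] H) < ∞ → φ ((x * star x : N) : H →L[ℂ] H) < ∞ →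
    φ ((star y * y : N) : H →L[ℂ] H) < ∞ → φ ((y * star y : N) : H →L[ℂ] H) < ∞ →
    ∃ f : ℂ → ℂ,
      ContinuousOn f {z | 0 ≤ z.im ∧ z.im ≤ 1} ∧
      DifferentiableOn ℂ f {z | 0 < z.im ∧ z.im < 1} ∧
      (∃ C : ℝ, ∀ z : ℂ, 0 ≤ z.im → z.im ≤ 1 → ‖f z‖ ≤ C) ∧
      (∀ t : ℝ, f t = weightForm φ (star (σ t x) : N) (y : H →L[ℂ] H)) ∧
      (∀ t : ℝ, f (t + Complex.I) = weightForm φ (star y : N) (σ t x : H →L[ℂ] H))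

/-- The fixed-point algebra `N^σ`. -/
def fixedPoints (N : StarSubalgebra ℂ (H →L[ℂ] H)) (σ : ℝ → (N ≃⋆ₐ[ℂ] N)) :
    StarSubalgebra ℂ (H →L[ℂ] H) :=
  StarSubalgebra.map N.subtype
    { carrier := {x : N | ∀ t, σ t x = x}
      mul_mem' := fun {a b} ha hb t => by rw [map_mul, ha t, hb t]
      add_mem' := fun {a b} ha hb t => by rw [map_add, ha t, hb t]
      algebraMap_mem' := fun r t => by rw [AlgHomClass.commutes]
      star_mem' := fun {a} ha t => by rw [map_star, ha t] }

/-! ### Singular values, `ℒ^{(1,∞)}` and Dixmier traces -/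

/-- `μ_t(T) = inf {‖T E‖ : E a projection in M with φ(1 - E) ≤ t}`. -/
def singularValue (M : StarSubalgebra ℂ (H →L[ℂ] H)) (φ : (H →L[ℂ] H) → ℝ≥0∞)
    (T : H →L[ℂ] H) (t : ℝ) : ℝ :=
  sInf {r | ∃ E ∈ M, IsStarProjection E ∧ φ (1 - E) ≤ ENNReal.ofReal t ∧ r = ‖T * E‖}

/-- `F_T(t) = (1 / log (1 + t)) ∫₀ᵗ μ_s(T) ds`. -/
def logMean (M : StarSubalgebra ℂ (H →L[ℂ] H)) (φ : (H →L[ℂ] H) → ℝ≥0∞)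
    (T : H →L[ℂ] H) (t : ℝ) : ℝ :=
  (Real.log (1 + t))⁻¹ * ∫ s in (0 : ℝ)..t, singularValue M φ T s

/-- `ℒ^{(1,∞)}(M, φ)`: the `T ∈ M` for which `F_T` is bounded on `(0, ∞)`. -/
def L1Infty (M : StarSubalgebra ℂ (H →L[ℂ] H)) (φ : (H →L[ℂ] H) → ℝ≥0∞) :
    Set (H →L[ℂ] H) :=
  {T | T ∈ M ∧ ∃ C : ℝ, ∀ t : ℝ, 0 < t → logMean M φ T t ≤ C}

/-- The space `L^∞(ℝ₊^*)` of real-valued functions. -/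
abbrev LInftyPos : Type := Lp ℝ ∞ (volume.restrict (Set.Ioi (0 : ℝ)))

/-- A state `ω` on `L^∞(ℝ₊^*)` that extends the limit at infinity. The functionals that define
Dixmier traces are of this kind; the invariance properties which are usually imposed on
them in addition (under dilations, for example), and which make `τ_ω` additive, are not
required. -/
structure ExtendedLimit where
  toLinearMap : LInftyPos →ₗ[ℝ] ℝ
  nonneg : ∀ g : LInftyPos, 0 ≤ g → 0 ≤ toLinearMap g
  eq_of_tendsto : ∀ (g : LInftyPos) (h : ℝ → ℝ) (c : ℝ),
    (∀ᵐ t ∂(volume.restrict (Set.Ioi (0 : ℝ))), g t = h t) →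
    Filter.Tendsto h Filter.atTop (nhds c) → toLinearMap g = c

open Classical in
/-- `ω(F_T)`, which is `τ_ω(T)` for `0 ≤ T ∈ ℒ^{(1,∞)}`. -/
def dixmierPos (ω : ExtendedLimit) (M : StarSubalgebra ℂ (H →L[ℂ] H))
    (φ : (H →L[ℂ] H) → ℝ≥0∞) (T : H →L[ℂ] H) : ℝ :=
  if h : MemLp (logMean M φ T) ∞ (volume.restrict (Set.Ioi (0 : ℝ)))
  then ω.toLinearMap (h.toLp _) else 0

/-- The Dixmier trace `τ_ω`, extended by linearity from positive operators through the
decomposition `T = (Re T)₊ - (Re T)₋ + i ((Im T)₊ - (Im T)₋)`. -/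
def dixmierTrace (ω : ExtendedLimit) (M : StarSubalgebra ℂ (H →L[ℂ] H))
    (φ : (H →L[ℂ] H) → ℝ≥0∞) (T : H →L[ℂ] H) : ℂ :=
  ((dixmierPos ω M φ (realPart T : H →L[ℂ] H)⁺
      - dixmierPos ω M φ (realPart T : H →L[ℂ] H)⁻ : ℝ) : ℂ)
    + Complex.I * ((dixmierPos ω M φ (imaginaryPart T : H →L[ℂ] H)⁺
      - dixmierPos ω M φ (imaginaryPart T : H →L[ℂ] H)⁻ : ℝ) : ℂ)

end OperatorTheory

/-! ### The operators, algebras and weights attached to the Cuntz algebra -/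

namespace Cuntz

open OperatorTheory

variable {n : ℕ} (τ : TracialState n)

/-- The graph of the generator `𝒟` of the gauge action on `ℋ`: the closure of
`S_μ S_ν* ↦ (|μ| - |ν|) S_μ S_ν*` on `O_{nc}`. -/
def dirac : Submodule ℂ (Hilb τ × Hilb τ) :=
  (Submodule.span ℂ (Set.range fun p : List (Fin n) × List (Fin n) =>
    (toHilb τ (word p.1 * star (word p.2)),
      ((p.1.length : ℂ) - (p.2.length : ℂ)) •
        toHilb τ (word p.1 * star (word p.2))))).topologicalClosure

/-- The bounded operator `(1 + 𝒟²)^{-1/2}`. -/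
def resolventRoot : Hilb τ →L[ℂ] Hilb τ :=
  invSqrtOneAddSq (dirac τ : Set (Hilb τ × Hilb τ))

/-- The graph of Tomita's operator: the closure of `a ↦ a*` on `O_{nc}`. -/
def tomita : Set (Hilb τ × Hilb τ) :=
  closure {p | ∃ a ∈ core n, p = (toHilb τ a, toHilb τ (star a))}

/-- The graph of the modular operator `Δ = S*S`. -/
def modularOperator : Set (Hilb τ × Hilb τ) := antilinearStarMulSelf (tomita τ)

/-- `T` is the operator on `ℋ` given by the rank one endomorphism
`Θ_{x,y} z = x (y|z) = x Φ(y* z)` of `X_c = O_{nc}`. -/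
def IsRankOne (x y : Alg n) (T : Hilb τ →L[ℂ] Hilb τ) : Prop :=
  ∀ z ∈ core n, T (toHilb τ z) = toHilb τ (x * (expect n (star y * z) : Alg n))

/-- The finite rank endomorphisms `End⁰⁰_F(X_c)`, acting on `ℋ`. -/
def finiteRank : Submodule ℂ (Hilb τ →L[ℂ] Hilb τ) :=
  Submodule.span ℂ {T | ∃ x ∈ core n, ∃ y ∈ core n, IsRankOne τ x y T}

/-- The von Neumann algebra `𝒩 = (End⁰⁰_F(X_c))''`. -/
def vN : VonNeumannAlgebra (Hilb τ) :=
  bicommutant (finiteRank τ : Set (Hilb τ →L[ℂ] Hilb τ))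

/-- `⟨ξ, T ξ⟩` for positive `T`. -/
def vectorWeight (ξ : Hilb τ) (T : Hilb τ →L[ℂ] Hilb τ) : ℝ≥0∞ :=
  ENNReal.ofReal (⟪ξ, T ξ⟫_ℂ).re

/-- The trace `τ̃` on positive elements of `𝒩`: `τ̃(T) = ∑_μ ω_μ(T)` over all words `μ`, with
`ω_μ(T) = ⟨S_μ, T S_μ⟩ + n^{-|μ|} ⟨S_μ*, T S_μ*⟩` for `|μ| > 0` and `ω_∅(T) = ⟨1, T 1⟩`. -/
def tildeTrace (T : Hilb τ →L[ℂ] Hilb τ) : ℝ≥0∞ :=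
  ∑' μ : List (Fin n),
    if μ = [] then vectorWeight τ (toHilb τ 1) T
    else vectorWeight τ (toHilb τ (word μ)) T
      + ((n : ℝ≥0∞) ^ μ.length)⁻¹ * vectorWeight τ (toHilb τ (star (word μ))) T

/-- The weight `τ_Δ = τ̃(Δ ·)` on positive elements of `𝒩`. -/
def tauDelta (T : Hilb τ →L[ℂ] Hilb τ) : ℝ≥0∞ :=
  weightOfTrace (tildeTrace τ) (modularOperator τ) T

end Cuntz

end

/-! The gauge action grades `ℋ`: `S_μ S_ν*` has degree `|μ| - |ν|`, and `(1 + 𝒟²)^{-1/2}` is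
multiplication by `(1 + k²)^{-1/2}` in degree `k`. Write `φ = τ ∘ Φ` and let `Φ_k` be the projection
onto degree `k`. Traciality on the matrix units of `F` forces `φ(S_μ S_ν*) = δ_{μν} n^{-|μ|}`. Hence
`φ(b a) = n^k φ(a b)` for `a` of degree `k`, and `Δ` is multiplication by `n^{-k}`. So `τ_Δ` is the
sum of the vector functionals at `n^{-|μ|/2} S_μ` and, for `μ ≠ ∅`, at `S_μ*`. The KMS condition
then gives `τ_Δ(f Φ_k) = τ(f)` for every `k ∈ ℤ` and `f ∈ F`: all degrees carry the same mass.

Let `g = ∑ l_i p_i` with `l_i ≥ 0` and the `p_i ∈ F` projections that sum to one. Then `g (1 +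
𝒟²)^{-1/2}` is diagonal, with eigenvalue `l_i (1 + k²)^{-1/2}` on the range of `p_i Φ_k`, which has
weight `τ(p_i)`. About `2 l_i / a` degrees `k` have eigenvalue at least `a`, so the total weight
above the level `a` is about `2 τ(g) / a`, that is, `μ_s ∼ 2 τ(g) / s`. A positive `f ∈ F` is a norm
limit of such `g`, because the core part of `F` consists of matrices over words and these can be
diagonalised. A perturbation of size `η²` changes the count only by a relative error of order `η`
(`singularValue_le_of_near`, `le_singularValue_of_near`). Thus `s μ_s → 2 τ(f)` and the logarithmic
means converge to the same limit, so every `ω` agrees. A general `f` splits into four positive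
elements of `F`; orthogonality makes this the decomposition used by `dixmierTrace`, so no additivity
of `ω` is needed.

Singular values are infima over projections of `𝓜 = 𝒩^σ`, while `σ` is known only through its
defining properties. Two facts about bounded holomorphic functions on a strip suffice. For `f ∈ F`
the operator `f Φ_k` is in the centralizer of `τ_Δ`, so its KMS functions have equal boundary values
and are constant; faithfulness then gives `f Φ_k ∈ 𝓜`, which supplies the projections for the upper
bound. For elements of `𝓜` a KMS function is constant on each boundary line, so the two constants
agree and `τ_Δ` is tracial on `𝓜`. The lower bound follows by comparison of projections
(`weight_le_of_norm_lt`). Faithfulness and the centralizer property rest on the right action of `F`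
on `ℋ`, which commutes with `𝒩`. -/

set_option linter.unusedSectionVars false

noncomputable section

/-! ### Diagonal operators with respect to an orthogonal decomposition -/

namespace OperatorTheory

section Diagonal

variable {H : Type*} [NormedAddCommGroup H] [InnerProductSpace ℂ H] [CompleteSpace H]
  {ι : Type*}

/-- The subspaces `V i` are pairwise orthogonal and their algebraic sum is dense. -/
structure IsOrthogonalDecomposition (V : ι → Submodule ℂ H) : Prop where
  orthogonal : OrthogonalFamily ℂ (fun i => V i) fun i => (V i).subtypeₗᵢ
  dense : Dense ((⨆ i, V i : Submodule ℂ H) : Set H)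

open Classical in
/-- The operator that acts on `V i` as the scalar `c i`, for a bounded family `c`. -/
def diag (V : ι → Submodule ℂ H) (c : ι → ℂ) : H →L[ℂ] H :=
  (DFinsupp.lsum ℕ fun i => c i • (V i).subtype).extendOfNorm
    (DFinsupp.lsum ℕ fun i => (V i).subtype)

namespace IsOrthogonalDecomposition

variable {V : ι → Submodule ℂ H} (hV : IsOrthogonalDecomposition V)

include hV

theorem ext_clm {F : Type*} [NormedAddCommGroup F] [NormedSpace ℂ F] {A B : H →L[ℂ] F}
    (h : ∀ i, ∀ v ∈ V i, A v = B v) : A = B := by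
  have hs : (⨆ i, V i : Submodule ℂ H) ≤ LinearMap.eqLocus A.toLinearMap B.toLinearMap :=
    iSup_le fun i v hv => h i v hv
  exact ContinuousLinearMap.coeFn_injective
    (Continuous.ext_on hV.dense A.continuous B.continuous fun v hv => hs hv)

open Classical in
theorem denseRange_lsum :
    DenseRange (DFinsupp.lsum ℕ fun i => (V i).subtype : (Π₀ i, V i) →ₗ[ℂ] H) := by
  have h := hV.dense
  rw [Submodule.iSup_eq_range_dfinsupp_lsum] at h
  exact h

-- Pythagoras for finite orthogonal sums; this is the bound under which the extension defining
-- `diag` exists.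
open Classical in
theorem norm_lsum_smul_le {c : ι → ℂ} {C : ℝ} (hC : 0 ≤ C) (hc : ∀ i, ‖c i‖ ≤ C)
    (x : Π₀ i, V i) :
    ‖(DFinsupp.lsum ℕ fun i => c i • (V i).subtype : (Π₀ i, V i) →ₗ[ℂ] H) x‖
      ≤ C * ‖(DFinsupp.lsum ℕ fun i => (V i).subtype : (Π₀ i, V i) →ₗ[ℂ] H) x‖ := by
  have h1 : (DFinsupp.lsum ℕ fun i => c i • (V i).subtype : (Π₀ i, V i) →ₗ[ℂ] H) x
      = ∑ i ∈ x.support, (V i).subtypeₗᵢ (c i • x i) := by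
    rw [DFinsupp.lsum_apply_apply, DFinsupp.sumAddHom_apply]
    rfl
  have h2 : (DFinsupp.lsum ℕ fun i => (V i).subtype : (Π₀ i, V i) →ₗ[ℂ] H) x
      = ∑ i ∈ x.support, (V i).subtypeₗᵢ (x i) := by
    rw [DFinsupp.lsum_apply_apply, DFinsupp.sumAddHom_apply]
    rfl
  rw [h1, h2, ← sq_le_sq₀ (norm_nonneg _) (by positivity), mul_pow,
    hV.orthogonal.norm_sum (fun i => c i • x i), hV.orthogonal.norm_sum (fun i => x i),
    Finset.mul_sum]
  refine Finset.sum_le_sum fun i _ => ?_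
  rw [norm_smul, mul_pow]
  gcongr
  exact hc i

/-- `extendOfNorm` is a genuine extension only when a norm bound holds, hence the boundedness
hypothesis here and below. -/
theorem diag_apply {c : ι → ℂ} (hc : ∃ C, ∀ i, ‖c i‖ ≤ C) {i : ι} {v : H} (hv : v ∈ V i) :
    diag V c v = c i • v := by
  classical
  obtain ⟨C, hC⟩ := hc
  have h := LinearMap.extendOfNorm_eq
    (f := (DFinsupp.lsum ℕ fun i => c i • (V i).subtype : (Π₀ i, V i) →ₗ[ℂ] H))
    (e := (DFinsupp.lsum ℕ fun i => (V i).subtype : (Π₀ i, V i) →ₗ[ℂ] H)) hV.denseRange_lsum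
    ⟨C, hV.norm_lsum_smul_le ((norm_nonneg _).trans (hC i)) hC⟩ (DFinsupp.single i ⟨v, hv⟩)
  simpa [diag] using h

theorem norm_diag_le {c : ι → ℂ} {C : ℝ} (hC : 0 ≤ C) (hc : ∀ i, ‖c i‖ ≤ C) :
    ‖diag V c‖ ≤ C :=
  LinearMap.opNorm_extendOfNorm_le hV.denseRange_lsum hC (hV.norm_lsum_smul_le hC hc)

theorem diag_eq {c : ι → ℂ} (hc : ∃ C, ∀ i, ‖c i‖ ≤ C) {A : H →L[ℂ] H}
    (h : ∀ i, ∀ v ∈ V i, A v = c i • v) : diag V c = A :=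
  hV.ext_clm fun i v hv => by rw [hV.diag_apply hc hv, h i v hv]

theorem diag_mul {c d : ι → ℂ} (hc : ∃ C, ∀ i, ‖c i‖ ≤ C) (hd : ∃ C, ∀ i, ‖d i‖ ≤ C) :
    diag V c * diag V d = diag V fun i => c i * d i := by
  refine (hV.diag_eq ?_ fun i v hv => ?_).symm
  · obtain ⟨C, hC⟩ := hc
    obtain ⟨D, hD⟩ := hd
    refine ⟨C * D, fun i => ?_⟩
    rw [norm_mul]
    exact mul_le_mul (hC i) (hD i) (norm_nonneg _) ((norm_nonneg _).trans (hC i))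
  · rw [mul_apply_eq_comp, hV.diag_apply hd hv, map_smul, hV.diag_apply hc hv,
      smul_smul, mul_comm]

theorem star_diag {c : ι → ℂ} (hc : ∃ C, ∀ i, ‖c i‖ ≤ C) :
    star (diag V c) = diag V fun i => star (c i) := by
  have hc' : ∃ C, ∀ i, ‖star (c i)‖ ≤ C := by simpa using hc
  rw [ContinuousLinearMap.star_eq_adjoint]
  symm
  rw [ContinuousLinearMap.eq_adjoint_iff]
  have key : ∀ i, ∀ v ∈ V i, ∀ j, ∀ w ∈ V j,
      ⟪diag V (fun i => star (c i)) v, w⟫_ℂ = ⟪v, diag V c w⟫_ℂ := by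
    intro i v hv j w hw
    rw [hV.diag_apply hc' hv, hV.diag_apply hc hw, inner_smul_left, inner_smul_right]
    rcases eq_or_ne i j with rfl | hij
    · simp
    · have h : ⟪v, w⟫_ℂ = 0 := hV.orthogonal hij ⟨v, hv⟩ ⟨w, hw⟩
      rw [h, mul_zero, mul_zero]
  have h1 : ∀ i, ∀ v ∈ V i, ∀ w : H,
      ⟪diag V (fun i => star (c i)) v, w⟫_ℂ = ⟪v, diag V c w⟫_ℂ := by
    intro i v hv
    have := hV.ext_clm (A := innerSL ℂ (diag V (fun i => star (c i)) v))
      (B := (innerSL ℂ v).comp (diag V c)) fun j w hw => key i v hv j w hw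
    exact fun w => congrArg (fun f : H →L[ℂ] ℂ => f w) this
  intro v w
  -- The left variable enters conjugate-linearly, so `ext_clm` does not apply to it; the identity is
  -- extended through a submodule and a closed set.
  have hs : (⨆ i, V i : Submodule ℂ H) ≤
      { carrier := {v | ⟪diag V (fun i => star (c i)) v, w⟫_ℂ = ⟪v, diag V c w⟫_ℂ}
        add_mem' := fun {a b} ha hb => by
          simp only [Set.mem_ofPred_eq, map_add, inner_add_left] at *
          rw [ha, hb]
        zero_mem' := by simp
        smul_mem' := fun r a ha => by
          simp only [Set.mem_ofPred_eq, map_smul, inner_smul_left] at *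
          rw [ha] } := iSup_le fun i v hv => h1 i v hv w
  have hcl : IsClosed {v | ⟪diag V (fun i => star (c i)) v, w⟫_ℂ = ⟪v, diag V c w⟫_ℂ} :=
    isClosed_eq (by fun_prop) (by fun_prop)
  exact hcl.closure_subset_iff.2 hs (hV.dense v)

theorem diag_nonneg {c : ι → ℝ} (hc : ∃ C, ∀ i, c i ≤ C) (h0 : ∀ i, 0 ≤ c i) :
    0 ≤ diag V fun i => (c i : ℂ) := by
  obtain ⟨C, hC⟩ := hc
  have hb : ∃ C, ∀ i, ‖((√(c i) : ℝ) : ℂ)‖ ≤ C := ⟨√C, fun i => by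
    rw [Complex.norm_real, Real.norm_of_nonneg (Real.sqrt_nonneg _)]
    exact Real.sqrt_le_sqrt (hC i)⟩
  have h : (diag V fun i => (c i : ℂ))
      = star (diag V fun i => ((√(c i) : ℝ) : ℂ)) * diag V fun i => ((√(c i) : ℝ) : ℂ) := by
    rw [hV.star_diag hb, hV.diag_mul (by simpa using hb) hb]
    congr 1
    funext i
    rw [Complex.star_def, Complex.conj_ofReal, ← Complex.ofReal_mul, Real.mul_self_sqrt (h0 i)]
  rw [h]
  exact star_mul_self_nonneg _

theorem sqrt_diag {c : ι → ℝ} (hc : ∃ C, ∀ i, c i ≤ C) (h0 : ∀ i, 0 ≤ c i) :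
    CFC.sqrt (diag V fun i => (c i : ℂ)) = diag V fun i => ((√(c i) : ℝ) : ℂ) := by
  obtain ⟨C, hC⟩ := hc
  have hC' : ∀ i, √(c i) ≤ √C := fun i => Real.sqrt_le_sqrt (hC i)
  have hb : ∃ C, ∀ i, ‖((√(c i) : ℝ) : ℂ)‖ ≤ C := ⟨√C, fun i => by
    rw [Complex.norm_real, Real.norm_of_nonneg (Real.sqrt_nonneg _)]
    exact hC' i⟩
  refine CFC.sqrt_unique ?_ (hV.diag_nonneg ⟨_, hC'⟩ fun i => Real.sqrt_nonneg _)
  rw [hV.diag_mul hb hb]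
  congr 1
  funext i
  rw [← Complex.ofReal_mul, Real.mul_self_sqrt (h0 i)]

end IsOrthogonalDecomposition

end Diagonal

end OperatorTheory

/-! ### Bounded holomorphic functions on a strip -/

section Strip

open Complex Set

variable {f : ℂ → ℂ}

/-- The boundary integral of `f` over the rectangle `[a, b] × [0, 1]` vanishes. -/
theorem strip_rect_integral (hc : ContinuousOn f {z | 0 ≤ z.im ∧ z.im ≤ 1})
    (hd : DifferentiableOn ℂ f {z | 0 < z.im ∧ z.im < 1}) (a b : ℝ) :
    (∫ x : ℝ in a..b, f x) - (∫ x : ℝ in a..b, f (x + I))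
      + I * (∫ y : ℝ in (0 : ℝ)..1, f (b + y * I))
      - I * (∫ y : ℝ in (0 : ℝ)..1, f (a + y * I)) = 0 := by
  have h := integral_boundary_rect_eq_zero_of_continuousOn_of_differentiableOn f
    (a : ℂ) (b + I) (hc.mono ?_) (hd.mono ?_)
  · simpa using h
  · rintro z ⟨-, hz⟩
    simpa using hz
  · rintro z ⟨-, hz⟩
    simpa using hz

theorem norm_strip_integral_le {C : ℝ} (hb : ∀ z : ℂ, 0 ≤ z.im → z.im ≤ 1 → ‖f z‖ ≤ C) (x : ℝ) :
    ‖∫ y : ℝ in (0 : ℝ)..1, f (x + y * I)‖ ≤ C := by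
  have h := intervalIntegral.norm_integral_le_of_norm_le_const (a := 0) (b := 1) (C := C)
    (f := fun y : ℝ => f (x + y * I)) fun y hy => by
      rw [uIoc_of_le zero_le_one] at hy
      exact hb _ (by simpa using hy.1.le) (by simpa using hy.2)
  simpa using h

/-- A bounded holomorphic function on a strip that is constant on either boundary line takes the
same value on both. -/
theorem strip_boundary_values_eq (hc : ContinuousOn f {z | 0 ≤ z.im ∧ z.im ≤ 1})
    (hd : DifferentiableOn ℂ f {z | 0 < z.im ∧ z.im < 1})
    (hb : ∃ C : ℝ, ∀ z : ℂ, 0 ≤ z.im → z.im ≤ 1 → ‖f z‖ ≤ C) {c₀ c₁ : ℂ}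
    (h0 : ∀ t : ℝ, f t = c₀) (h1 : ∀ t : ℝ, f (t + I) = c₁) : c₀ = c₁ := by
  obtain ⟨C, hC⟩ := hb
  by_contra hne
  have hpos : 0 < ‖c₀ - c₁‖ := norm_pos_iff.2 (sub_ne_zero.2 hne)
  -- Around the rectangle over `[0, b]` the horizontal sides contribute `b (c₀ - c₁)`, while each
  -- vertical side contributes at most `C`.
  have key : ∀ b : ℝ, 0 ≤ b → b * ‖c₀ - c₁‖ ≤ 2 * C := by
    intro b hb0
    have h := strip_rect_integral hc hd 0 b
    simp_rw [h0, h1] at h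
    rw [intervalIntegral.integral_const, intervalIntegral.integral_const, sub_zero,
      ← smul_sub] at h
    have h2 : (b : ℝ) • (c₀ - c₁) = I * (∫ y : ℝ in (0 : ℝ)..1, f ((0 : ℝ) + y * I))
        - I * (∫ y : ℝ in (0 : ℝ)..1, f (b + y * I)) := by
      linear_combination h
    have h3 := congrArg norm h2
    rw [norm_smul, Real.norm_of_nonneg hb0] at h3
    rw [h3, two_mul]
    refine (norm_sub_le _ _).trans (add_le_add ?_ ?_) <;>
      rw [norm_mul, norm_I, one_mul] <;> exact norm_strip_integral_le hC _
  have hC0 : 0 ≤ C := (norm_nonneg _).trans (hC 0 (by simp) (by simp))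
  have h := key ((2 * C + 1) / ‖c₀ - c₁‖) (by positivity)
  rw [div_mul_cancel₀ _ hpos.ne'] at h
  linarith

/-- A bounded holomorphic function on the strip whose values on the two boundary lines agree is
constant. -/
theorem strip_const_of_periodic (hc : ContinuousOn f {z | 0 ≤ z.im ∧ z.im ≤ 1})
    (hd : DifferentiableOn ℂ f {z | 0 < z.im ∧ z.im < 1})
    (hb : ∃ C : ℝ, ∀ z : ℂ, 0 ≤ z.im → z.im ≤ 1 → ‖f z‖ ≤ C)
    (hp : ∀ t : ℝ, f (t + I) = f t) (t : ℝ) : f t = f 0 := by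
  obtain ⟨C, hC⟩ := hb
  have hC0 : 0 ≤ C := (norm_nonneg _).trans (hC 0 (by simp) (by simp))
  -- the Fourier modes along vertical segments, transported along the strip
  have hmode : ∀ (m : ℤ) (a b : ℝ),
      ∫ y : ℝ in (0 : ℝ)..1, exp (-(2 * Real.pi * m) * (b + y * I)) * f (b + y * I)
        = ∫ y : ℝ in (0 : ℝ)..1, exp (-(2 * Real.pi * m) * (a + y * I)) * f (a + y * I) := by
    intro m a b
    have h := strip_rect_integral
      (f := fun z => exp (-(2 * Real.pi * m) * z) * f z)
      ((by fun_prop : Continuous fun z : ℂ => exp (-(2 * Real.pi * m) * z)).continuousOn.mul hc)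
      ((by fun_prop : Differentiable ℂ fun z : ℂ =>
        exp (-(2 * Real.pi * m) * z)).differentiableOn.mul hd) a b
    have he : ∀ x : ℝ, exp (-(2 * Real.pi * m) * (x + I)) * f (x + I)
        = exp (-(2 * Real.pi * m) * x) * f x := by
      intro x
      rw [hp, mul_add, exp_add]
      have : exp (-(2 * Real.pi * m) * I) = 1 := by
        rw [exp_eq_one_iff]
        exact ⟨-m, by push_cast; ring⟩
      rw [this, mul_one]
    simp_rw [he, sub_self, zero_add, ← mul_sub] at h
    exact sub_eq_zero.1 ((mul_eq_zero.1 h).resolve_left I_ne_zero)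
  have hfac : ∀ (m : ℤ) (a : ℝ),
      ∫ y : ℝ in (0 : ℝ)..1, exp (-(2 * Real.pi * m) * (a + y * I)) * f (a + y * I)
        = exp (-(2 * Real.pi * m) * a) *
          ∫ y : ℝ in (0 : ℝ)..1, exp (-(2 * Real.pi * m) * (y * I)) * f (a + y * I) := by
    intro m a
    rw [← intervalIntegral.integral_const_mul]
    congr 1
    funext y
    rw [mul_add, exp_add, mul_assoc]
  have hbound : ∀ (m : ℤ) (a : ℝ),
      ‖∫ y : ℝ in (0 : ℝ)..1, exp (-(2 * Real.pi * m) * (y * I)) * f (a + y * I)‖ ≤ C := by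
    intro m a
    have h := intervalIntegral.norm_integral_le_of_norm_le_const (a := 0) (b := 1) (C := C)
      (f := fun y : ℝ => exp (-(2 * Real.pi * m) * (y * I)) * f (a + y * I)) fun y hy => by
        rw [uIoc_of_le zero_le_one] at hy
        rw [norm_mul]
        have h1 : ‖exp (-(2 * Real.pi * m) * (y * I))‖ = 1 := by
          have := norm_exp_ofReal_mul_I (-(2 * Real.pi * m) * y)
          push_cast at this
          rwa [← mul_assoc]
        rw [h1, one_mul]
        exact hC _ (by simpa using hy.1.le) (by simpa using hy.2)
    simpa using h
  -- Moving from abscissa `a` to `b` multiplies the `m`-th Fourier coefficient by an exponential in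
  -- `m (b - a)`, but all coefficients are bounded by `C`. For `m ≠ 0` one of the directions `b →
  -- ±∞` forces the coefficient to vanish.
  have hzero : ∀ m : ℤ, m ≠ 0 → ∀ a : ℝ,
      ∫ y : ℝ in (0 : ℝ)..1, exp (-(2 * Real.pi * m) * (y * I)) * f (a + y * I) = 0 := by
    intro m hm a
    set A := ∫ y : ℝ in (0 : ℝ)..1, exp (-(2 * Real.pi * m) * (y * I)) * f (a + y * I) with hA
    have hle : ∀ b : ℝ, ‖A‖ ≤ Real.exp (-(2 * Real.pi * m) * (b - a)) * C := by
      intro b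
      have h := hmode m a b
      rw [hfac, hfac, ← hA] at h
      have h2 : A = exp (-(2 * Real.pi * m) * (b - a)) *
          ∫ y : ℝ in (0 : ℝ)..1, exp (-(2 * Real.pi * m) * (y * I)) * f (b + y * I) := by
        rw [mul_sub, exp_sub, div_mul_eq_mul_div, h, mul_div_cancel_left₀ _ (exp_ne_zero _)]
      rw [h2, norm_mul]
      have h3 : ‖exp (-(2 * Real.pi * m) * (b - a))‖ = Real.exp (-(2 * Real.pi * m) * (b - a)) := by
        rw [norm_exp]
        congr 1
        have : (-(2 * (Real.pi : ℂ) * m) * (b - a))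
            = ((-(2 * Real.pi * m) * (b - a) : ℝ) : ℂ) := by push_cast; ring
        rw [this, ofReal_re]
      rw [h3]
      gcongr
      exact hbound m b
    have hlim : Filter.Tendsto (fun s : ℝ => Real.exp (-s) * C) Filter.atTop (nhds 0) := by
      simpa using (Real.tendsto_exp_atBot.comp Filter.tendsto_neg_atTop_atBot).mul_const C
    have hk : (2 * Real.pi * m : ℝ) ≠ 0 := by
      have : (m : ℝ) ≠ 0 := by exact_mod_cast hm
      positivity
    have : ‖A‖ ≤ 0 := ge_of_tendsto' hlim fun s => by
      -- Dividing by `2πm` selects the direction according to the sign of `m`, so that the bound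
      -- reads `e^{-s} C`.
      have h := hle (a + s / (2 * Real.pi * m))
      rwa [add_sub_cancel_left, neg_mul, mul_div_cancel₀ _ hk] at h
    exact norm_le_zero_iff.1 this
  -- The restriction to a vertical segment is a continuous function on the circle whose only
  -- possible nonzero Fourier coefficient is the zeroth, so it equals its mean.
  have hvert : ∀ a : ℝ, f a = ∫ y : ℝ in (0 : ℝ)..1, f (a + y * I) := by
    intro a
    let g : ℝ → ℂ := fun y => f (a + y * I)
    have hgc : ContinuousOn g (Icc 0 (0 + 1)) := by
      refine hc.comp (by fun_prop : Continuous fun y : ℝ => (a : ℂ) + y * I).continuousOn ?_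
      intro y hy
      simpa using hy
    have hg1 : g 0 = g (0 + 1) := by simpa [g] using (hp a).symm
    let G : C(AddCircle (1 : ℝ), ℂ) :=
      ⟨AddCircle.liftIco 1 0 g, AddCircle.liftIco_continuous hg1 hgc⟩
    have hco : ∀ m : ℤ, fourierCoeff G m
        = ∫ y : ℝ in (0 : ℝ)..1, exp (-(2 * Real.pi * m) * (y * I)) * f (a + y * I) := by
      intro m
      change fourierCoeff (AddCircle.liftIco 1 0 g) m = _
      rw [fourierCoeff_liftIco_eq, fourierCoeffOn_eq_integral]
      simp only [zero_add, sub_zero, div_one, one_smul, smul_eq_mul]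
      refine intervalIntegral.integral_congr fun y _ => ?_
      simp only [g]
      rw [fourier_coe_apply]
      congr 2
      push_cast
      ring
    have hco0 : ∀ m : ℤ, m ≠ 0 → fourierCoeff G m = 0 := fun m hm => by rw [hco, hzero m hm]
    have hs : Summable (fourierCoeff G) :=
      summable_of_ne_finset_zero (s := {0}) fun m hm => hco0 m (by simpa using hm)
    have h := has_pointwise_sum_fourier_series_of_summable hs ((0 : ℝ) : AddCircle (1 : ℝ))
    have h2 := h.unique (hasSum_single 0 fun m hm => by rw [hco0 m hm, zero_smul])
    have h3 : G ((0 : ℝ) : AddCircle (1 : ℝ)) = f a := by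
      change AddCircle.liftIco 1 0 g _ = _
      rw [AddCircle.liftIco_coe_apply (by simp)]
      simp [g]
    rw [h3, hco] at h2
    simpa using h2
  -- The mean over a vertical segment is the mode `m = 0`, which does not depend on the abscissa.
  have hconst := hmode 0 0 t
  simp only [Int.cast_zero, mul_zero, neg_zero, zero_mul, exp_zero, one_mul] at hconst
  rw [hvert t, hconst, ← hvert 0]
  simp

end Strip

/-! ### Weights given by a family of vectors and their modular groups -/

namespace OperatorTheory

section Weight

variable {H : Type*} [NormedAddCommGroup H] [InnerProductSpace ℂ H] [CompleteSpace H]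
  {κ : Type*}

/-- The weight `T ↦ ∑ᵢ ⟨ξᵢ, T ξᵢ⟩` on positive operators. -/
def vectorSumWeight (ξ : κ → H) (T : H →L[ℂ] H) : ℝ≥0∞ :=
  ∑' i, ENNReal.ofReal (⟪ξ i, T (ξ i)⟫_ℂ).re

/-- `x` is square integrable for the weight given by the vectors `ξ`. -/
def SqIntegrable (ξ : κ → H) (x : H →L[ℂ] H) : Prop := Summable fun i => ‖x (ξ i)‖ ^ 2

variable {ξ : κ → H}

theorem ofReal_norm_sq (v : H) : ((‖v‖ ^ 2 : ℝ) : ℂ) = ⟪v, v⟫_ℂ := by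
  rw [inner_self_eq_norm_sq_to_K]
  norm_cast

theorem inner_star_mul_self (x : H →L[ℂ] H) (v : H) :
    ⟪v, (star x * x) v⟫_ℂ = ((‖x v‖ ^ 2 : ℝ) : ℂ) := by
  rw [mul_apply_eq_comp, ContinuousLinearMap.star_eq_adjoint,
    ContinuousLinearMap.adjoint_inner_right, ofReal_norm_sq]

theorem vectorSumWeight_star_mul_self (x : H →L[ℂ] H) :
    vectorSumWeight ξ (star x * x) = ∑' i, ENNReal.ofReal (‖x (ξ i)‖ ^ 2) := by
  unfold vectorSumWeight
  simp_rw [inner_star_mul_self, Complex.ofReal_re]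

theorem vectorSumWeight_lt_top_iff {x : H →L[ℂ] H} :
    vectorSumWeight ξ (star x * x) < ∞ ↔ SqIntegrable ξ x := by
  rw [vectorSumWeight_star_mul_self, lt_top_iff_ne_top]
  constructor
  · intro h
    have := ENNReal.summable_toReal h
    simpa [ENNReal.toReal_ofReal, SqIntegrable, sq_nonneg] using this
  · intro h
    rw [← ENNReal.ofReal_tsum_of_nonneg (fun i => sq_nonneg _) h]
    exact ENNReal.ofReal_ne_top

theorem vectorSumWeight_toReal (x : H →L[ℂ] H) :
    (vectorSumWeight ξ (star x * x)).toReal = ∑' i, ‖x (ξ i)‖ ^ 2 := by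
  rw [vectorSumWeight_star_mul_self, ENNReal.tsum_toReal_eq fun _ => ENNReal.ofReal_ne_top]
  simp_rw [ENNReal.toReal_ofReal (sq_nonneg _)]

theorem SqIntegrable.mono {x y : H →L[ℂ] H} (C : ℝ) (hx : SqIntegrable ξ x)
    (h : ∀ v, ‖y v‖ ≤ C * ‖x v‖) : SqIntegrable ξ y := by
  refine Summable.of_nonneg_of_le (fun i => sq_nonneg _) (fun i => ?_) (hx.mul_left (C ^ 2))
  rw [← mul_pow]
  exact pow_le_pow_left₀ (norm_nonneg _) (h _) 2

theorem SqIntegrable.left_mul {x : H →L[ℂ] H} (hx : SqIntegrable ξ x) (a : H →L[ℂ] H) :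
    SqIntegrable ξ (a * x) :=
  hx.mono ‖a‖ fun _ => a.le_opNorm _

theorem SqIntegrable.const_smul {x : H →L[ℂ] H} (hx : SqIntegrable ξ x) (c : ℂ) :
    SqIntegrable ξ (c • x) :=
  hx.mono ‖c‖ fun v => (norm_smul c (x v)).le

theorem SqIntegrable.add {x y : H →L[ℂ] H} (hx : SqIntegrable ξ x) (hy : SqIntegrable ξ y) :
    SqIntegrable ξ (x + y) := by
  refine Summable.of_nonneg_of_le (fun i => sq_nonneg _) (fun i => ?_)
    ((Summable.add hx hy).mul_left 2)
  have h := norm_add_le (x (ξ i)) (y (ξ i))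
  have h2 := pow_le_pow_left₀ (norm_nonneg _) h 2
  simp only [add_apply]
  nlinarith [sq_nonneg (‖x (ξ i)‖ - ‖y (ξ i)‖)]

theorem SqIntegrable.neg {x : H →L[ℂ] H} (hx : SqIntegrable ξ x) : SqIntegrable ξ (-x) :=
  hx.mono 1 fun v => by simp

theorem SqIntegrable.sub {x y : H →L[ℂ] H} (hx : SqIntegrable ξ x) (hy : SqIntegrable ξ y) :
    SqIntegrable ξ (x - y) := by
  rw [sub_eq_add_neg]
  exact hx.add hy.neg

/-- `φ(y* x) = ∑ᵢ ⟨y ξᵢ, x ξᵢ⟩`. -/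
theorem hasSum_weightForm {x y : H →L[ℂ] H} (hx : SqIntegrable ξ x) (hy : SqIntegrable ξ y) :
    HasSum (fun i => ⟪y (ξ i), x (ξ i)⟫_ℂ) (weightForm (vectorSumWeight ξ) y x) := by
  unfold weightForm
  have h : ∀ i, ⟪y (ξ i), x (ξ i)⟫_ℂ = (1 / 4 : ℂ) * ∑ k ∈ Finset.range 4, Complex.I ^ k *
      ((‖(x + Complex.I ^ k • y) (ξ i)‖ ^ 2 : ℝ) : ℂ) := by
    intro i
    simp only [ofReal_norm_sq, Finset.sum_range_succ, Finset.sum_range_zero, add_apply, smul_apply,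
      inner_add_left, inner_add_right, inner_smul_left, inner_smul_right, map_pow, Complex.conj_I]
    ring_nf
    have h6 : Complex.I ^ 6 = -1 := by
      rw [show 6 = 2 * 3 from rfl, pow_mul, Complex.I_sq]; norm_num
    have h9 : Complex.I ^ 9 = Complex.I := by
      rw [show 9 = 4 * 2 + 1 from rfl, pow_succ, pow_mul, Complex.I_pow_four]; norm_num
    simp only [Complex.I_sq, Complex.I_pow_three, Complex.I_pow_four, h6, h9]
    ring
  simp_rw [h]
  refine HasSum.mul_left _ (hasSum_sum fun k _ => HasSum.mul_left _ ?_)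
  rw [vectorSumWeight_toReal]
  exact Complex.hasSum_ofReal.2 (hx.add (hy.const_smul _)).hasSum

/-! ### Consequences of the KMS condition: the centralizer and the trace property -/

section Modular

variable {N : StarSubalgebra ℂ (H →L[ℂ] H)} {σ : ℝ → (N ≃⋆ₐ[ℂ] N)}

theorem mem_fixedPoints {x : H →L[ℂ] H} :
    x ∈ fixedPoints N σ ↔ ∃ h : x ∈ N, ∀ t, σ t ⟨x, h⟩ = ⟨x, h⟩ := by
  constructor
  · rintro ⟨y, hy, rfl⟩
    exact ⟨y.2, hy⟩
  · rintro ⟨h, hx⟩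
    exact ⟨⟨x, h⟩, hx, rfl⟩

variable (hσ : IsModularGroup N (vectorSumWeight ξ) σ)

include hσ

theorem IsModularGroup.sqIntegrable (t : ℝ) {x : N} (hx : SqIntegrable ξ (x : H →L[ℂ] H)) :
    SqIntegrable ξ (σ t x : H →L[ℂ] H) := by
  rw [← vectorSumWeight_lt_top_iff] at hx ⊢
  have h := hσ.invariant t (star x * x) (star_mul_self_nonneg (x : H →L[ℂ] H))
  rw [map_mul, map_star] at h
  exact lt_of_eq_of_lt h hx

theorem IsModularGroup.weightForm_invariant (t : ℝ) (x y : N) :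
    weightForm (vectorSumWeight ξ) (σ t y : H →L[ℂ] H) (σ t x : H →L[ℂ] H)
      = weightForm (vectorSumWeight ξ) (y : H →L[ℂ] H) (x : H →L[ℂ] H) := by
  unfold weightForm
  congr 1
  refine Finset.sum_congr rfl fun k _ => ?_
  have h := hσ.invariant t (star (x + Complex.I ^ k • y) * (x + Complex.I ^ k • y))
    (star_mul_self_nonneg ((x + Complex.I ^ k • y : N) : H →L[ℂ] H))
  rw [map_mul, map_star, _root_.map_add, map_smul] at h
  congr 3

theorem IsModularGroup.kms_sqIntegrable {x y : N} (hx : SqIntegrable ξ (x : H →L[ℂ] H))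
    (hx' : SqIntegrable ξ (star x : H →L[ℂ] H)) (hy : SqIntegrable ξ (y : H →L[ℂ] H))
    (hy' : SqIntegrable ξ (star y : H →L[ℂ] H)) :
    ∃ f : ℂ → ℂ,
      ContinuousOn f {z | 0 ≤ z.im ∧ z.im ≤ 1} ∧
      DifferentiableOn ℂ f {z | 0 < z.im ∧ z.im < 1} ∧
      (∃ C : ℝ, ∀ z : ℂ, 0 ≤ z.im → z.im ≤ 1 → ‖f z‖ ≤ C) ∧
      (∀ t : ℝ, f t = weightForm (vectorSumWeight ξ) (star (σ t x) : N) (y : H →L[ℂ] H)) ∧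
      (∀ t : ℝ, f (t + Complex.I)
        = weightForm (vectorSumWeight ξ) (star y : N) (σ t x : H →L[ℂ] H)) := by
  refine hσ.kms x y ?_ ?_ ?_ ?_
  · exact vectorSumWeight_lt_top_iff.2 hx
  · have := vectorSumWeight_lt_top_iff.2 hx'
    rwa [star_star] at this
  · exact vectorSumWeight_lt_top_iff.2 hy
  · have := vectorSumWeight_lt_top_iff.2 hy'
    rwa [star_star] at this

/-- Square integrable elements of the centralizer of the weight are fixed by its modular group. -/
theorem IsModularGroup.apply_eq_self_of_centralizer
    (hfaith : ∀ x ∈ N, (∀ i, x (ξ i) = 0) → x = 0) {a : N}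
    (ha : SqIntegrable ξ (a : H →L[ℂ] H)) (ha' : SqIntegrable ξ (star a : H →L[ℂ] H))
    (hcomm : ∀ z : N, SqIntegrable ξ (z : H →L[ℂ] H) → SqIntegrable ξ (star z : H →L[ℂ] H) →
      weightForm (vectorSumWeight ξ) (star a : N) (z : H →L[ℂ] H)
        = weightForm (vectorSumWeight ξ) (star z : N) (a : H →L[ℂ] H)) (t : ℝ) :
    σ t a = a := by
  have hs : ∀ x : N, σ (-t) (σ t x) = x := fun x => by
    rw [← hσ.map_add, neg_add_cancel, hσ.map_zero]
  have hstar : ∀ (s : ℝ) {x : N}, SqIntegrable ξ (star x : H →L[ℂ] H) →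
      SqIntegrable ξ (star (σ s x : H →L[ℂ] H)) := by
    intro s x hx
    have := hσ.sqIntegrable s (x := star x) hx
    rwa [map_star] at this
  have key : ∀ y : N, SqIntegrable ξ (y : H →L[ℂ] H) → SqIntegrable ξ (star y : H →L[ℂ] H) →
      weightForm (vectorSumWeight ξ) (star (σ t a) : N) (y : H →L[ℂ] H)
        = weightForm (vectorSumWeight ξ) (star a : N) (y : H →L[ℂ] H) := by
    intro y hy hy'
    obtain ⟨f, hfc, hfd, hfb, hf0, hf1⟩ := hσ.kms_sqIntegrable ha ha' hy hy'
    -- Invariance of the weight moves `σ_s` from `a` onto `y` as `σ_{-s}`; the centralizer identity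
    -- then identifies the two boundary values.
    have hper : ∀ s : ℝ, f (s + Complex.I) = f s := by
      intro s
      have hs' : ∀ x : N, σ s (σ (-s) x) = x := fun x => by
        rw [← hσ.map_add, add_neg_cancel, hσ.map_zero]
      rw [hf0, hf1]
      have h1 := hσ.weightForm_invariant s a (star (σ (-s) y))
      have h2 := hσ.weightForm_invariant s (σ (-s) y) (star a)
      rw [map_star, hs'] at h1
      rw [map_star, hs'] at h2
      rw [h1, h2]
      exact (hcomm (σ (-s) y) (hσ.sqIntegrable _ hy) (hstar _ hy')).symm
    have h := strip_const_of_periodic hfc hfd hfb hper t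
    have h0 := hf0 0
    rw [hσ.map_zero, Complex.ofReal_zero] at h0
    rw [← hf0 t, h, h0]
  have hb' : SqIntegrable ξ ((star (σ t a - a) : N) : H →L[ℂ] H) := by
    have := (hstar t ha').sub ha'
    rwa [← star_sub] at this
  have hb : SqIntegrable ξ (star ((star (σ t a - a) : N) : H →L[ℂ] H)) := by
    have h := (hσ.sqIntegrable t ha).sub ha
    have e : star ((star (σ t a - a) : N) : H →L[ℂ] H) = (σ t a : H →L[ℂ] H) - a :=
      star_star _
    rwa [e]
  have h := key _ hb' hb
  have h1 := hasSum_weightForm hb' (hstar t ha')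
  have h2 := hasSum_weightForm hb' ha'
  have h3 := h1.sub h2
  -- With `y = (σ_t a - a)*` the identity `key` says that `∑ ‖y ξ_i‖² = 0`.
  have h4 : HasSum (fun i => ‖((star (σ t a - a) : N) : H →L[ℂ] H) (ξ i)‖ ^ 2) 0 := by
    rw [← Complex.hasSum_ofReal]
    have e0 : weightForm (vectorSumWeight ξ) (star (σ t a : H →L[ℂ] H))
        ((star (σ t a - a) : N) : H →L[ℂ] H)
        - weightForm (vectorSumWeight ξ) (star (a : H →L[ℂ] H))
        ((star (σ t a - a) : N) : H →L[ℂ] H) = ((0 : ℝ) : ℂ) := by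
      rw [Complex.ofReal_zero, sub_eq_zero]
      exact h
    rw [e0] at h3
    refine h3.congr_fun fun i => ?_
    rw [← inner_sub_left]
    have e1 : (star (σ t a : H →L[ℂ] H)) (ξ i) - (star (a : H →L[ℂ] H)) (ξ i)
        = ((star (σ t a - a) : N) : H →L[ℂ] H) (ξ i) := by
      change _ = (star ((σ t a : H →L[ℂ] H) - a)) (ξ i)
      rw [star_sub, sub_apply]
    rw [e1, ofReal_norm_sq]
  have h5 : ∀ i, ((star (σ t a - a) : N) : H →L[ℂ] H) (ξ i) = 0 := by
    intro i
    have := (hasSum_zero_iff_of_nonneg fun i => sq_nonneg _).1 h4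
    have := congrFun this i
    simpa using this
  have h6 := hfaith _ (star (σ t a - a) : N).2 h5
  have h7 : star (σ t a - a) = 0 := Subtype.ext h6
  exact sub_eq_zero.1 (star_eq_zero.1 h7)

/-- The weight is tracial on the fixed-point algebra of its modular group. -/
theorem IsModularGroup.tsum_inner_comm {x y : H →L[ℂ] H} (hxM : x ∈ fixedPoints N σ)
    (hyM : y ∈ fixedPoints N σ) (hx : SqIntegrable ξ x) (hx' : SqIntegrable ξ (star x))
    (hy : SqIntegrable ξ y) (hy' : SqIntegrable ξ (star y)) :
    ∑' i, ⟪ξ i, (x * y) (ξ i)⟫_ℂ = ∑' i, ⟪ξ i, (y * x) (ξ i)⟫_ℂ := by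
  obtain ⟨hxN, hxf⟩ := mem_fixedPoints.1 hxM
  obtain ⟨hyN, hyf⟩ := mem_fixedPoints.1 hyM
  obtain ⟨f, hfc, hfd, hfb, hf0, hf1⟩ :=
    hσ.kms_sqIntegrable (x := ⟨x, hxN⟩) (y := ⟨y, hyN⟩) hx hx' hy hy'
  simp_rw [hxf] at hf0 hf1
  -- For `σ`-fixed `x` the KMS function has the constant boundary values `φ(x y)` and `φ(y x)`.
  have h := strip_boundary_values_eq hfc hfd hfb hf0 hf1
  have h1 := (hasSum_weightForm hy hx').tsum_eq
  have h2 := (hasSum_weightForm hx hy').tsum_eq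
  have e : ∀ (u v : H →L[ℂ] H) (w : H), ⟪w, (u * v) w⟫_ℂ = ⟪(star u) w, v w⟫_ℂ := by
    intro u v w
    rw [mul_apply_eq_comp, ContinuousLinearMap.star_eq_adjoint,
      ContinuousLinearMap.adjoint_inner_left]
  simp_rw [e, h1, h2]
  exact h

end Modular

end Weight

end OperatorTheory

/-! ### Comparison of projections and singular values -/

namespace OperatorTheory

section Comparison

variable {H : Type*} [NormedAddCommGroup H] [InnerProductSpace ℂ H] [CompleteSpace H]
  {κ : Type*} {ξ : κ → H}

theorem star_mul_self_of_isStarProjection {Q : H →L[ℂ] H} (hQ : IsStarProjection Q) :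
    star Q * Q = Q := by
  rw [hQ.isSelfAdjoint.star_eq, hQ.isIdempotentElem.eq]

theorem inner_apply_of_isStarProjection {Q : H →L[ℂ] H} (hQ : IsStarProjection Q) (v : H) :
    ⟪v, Q v⟫_ℂ = ((‖Q v‖ ^ 2 : ℝ) : ℂ) := by
  rw [← inner_star_mul_self, star_mul_self_of_isStarProjection hQ]

theorem norm_sq_add_of_isStarProjection {Q : H →L[ℂ] H} (hQ : IsStarProjection Q) (v : H) :
    ‖Q v‖ ^ 2 + ‖(1 - Q) v‖ ^ 2 = ‖v‖ ^ 2 := by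
  have h1 := inner_apply_of_isStarProjection hQ v
  have h2 := inner_apply_of_isStarProjection hQ.one_sub v
  have h3 := (ofReal_norm_sq v).symm
  have h4 : ⟪v, Q v⟫_ℂ + ⟪v, (1 - Q) v⟫_ℂ = ⟪v, v⟫_ℂ := by
    rw [← inner_add_right, ← add_apply, add_sub_cancel, one_apply_eq_self]
  rw [h1, h2, h3] at h4
  exact_mod_cast h4

theorem norm_apply_le_of_isStarProjection {Q : H →L[ℂ] H} (hQ : IsStarProjection Q) (v : H) :
    ‖Q v‖ ≤ ‖v‖ := by
  have h := norm_sq_add_of_isStarProjection hQ v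
  exact (sq_le_sq₀ (norm_nonneg _) (norm_nonneg _)).1 (by nlinarith [sq_nonneg ‖(1 - Q) v‖])

theorem vectorSumWeight_of_isStarProjection {Q : H →L[ℂ] H} (hQ : IsStarProjection Q)
    (hs : SqIntegrable ξ Q) :
    vectorSumWeight ξ Q = ENNReal.ofReal (∑' i, ‖Q (ξ i)‖ ^ 2) := by
  rw [ENNReal.ofReal_tsum_of_nonneg (fun i => sq_nonneg _) hs, ← vectorSumWeight_star_mul_self,
    star_mul_self_of_isStarProjection hQ]

theorem sqIntegrable_iff_of_isStarProjection {Q : H →L[ℂ] H} (hQ : IsStarProjection Q) :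
    SqIntegrable ξ Q ↔ vectorSumWeight ξ Q < ∞ := by
  rw [← vectorSumWeight_lt_top_iff, star_mul_self_of_isStarProjection hQ]

/-- The fixed-point algebra contains the inverses of its elements. -/
theorem inverse_mem_fixedPoints {N : VonNeumannAlgebra H}
    {σ : ℝ → (N.toStarSubalgebra ≃⋆ₐ[ℂ] N.toStarSubalgebra)} {Y W : H →L[ℂ] H}
    (hY : Y ∈ fixedPoints N.toStarSubalgebra σ) (hWY : W * Y = 1) (hYW : Y * W = 1) :
    W ∈ fixedPoints N.toStarSubalgebra σ := by
  obtain ⟨hYN, hYf⟩ := mem_fixedPoints.1 hY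
  have hWN : W ∈ N.toStarSubalgebra := by
    change W ∈ (N : Set (H →L[ℂ] H))
    rw [← N.centralizer_centralizer, Set.mem_centralizer_iff]
    intro z hz
    have hc : Y * z = z * Y := Set.mem_centralizer_iff.1 hz Y hYN
    calc z * W = W * Y * z * W := by rw [hWY, one_mul]
      _ = W * (z * Y) * W := by rw [mul_assoc W Y z, hc]
      _ = W * z := by rw [mul_assoc, mul_assoc, hYW, mul_one]
  refine mem_fixedPoints.2 ⟨hWN, fun t => ?_⟩
  have h1 : σ t ⟨W, hWN⟩ * ⟨Y, hYN⟩ = 1 := by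
    have h : (⟨W, hWN⟩ : N.toStarSubalgebra) * ⟨Y, hYN⟩ = 1 := Subtype.ext hWY
    have h' := congrArg (σ t) h
    rwa [map_mul, hYf t, map_one] at h'
  have h2 : (⟨Y, hYN⟩ : N.toStarSubalgebra) * ⟨W, hWN⟩ = 1 := Subtype.ext hYW
  calc σ t ⟨W, hWN⟩ = σ t ⟨W, hWN⟩ * (⟨Y, hYN⟩ * ⟨W, hWN⟩) := by rw [h2, mul_one]
    _ = ⟨W, hWN⟩ := by rw [← mul_assoc, h1, one_mul]

variable {N : VonNeumannAlgebra H}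
  {σ : ℝ → (N.toStarSubalgebra ≃⋆ₐ[ℂ] N.toStarSubalgebra)}
  (hσ : IsModularGroup N.toStarSubalgebra (vectorSumWeight ξ) σ)

include hσ

/-- If `‖T E‖ < l` and `T` is bounded below by `l` on the range of `P`, then `P` is equivalent to a
subprojection of `1 - E`. -/
theorem IsModularGroup.weight_le_of_norm_lt {P E T : H →L[ℂ] H} {l : ℝ}
    (hP : IsStarProjection P) (hPM : P ∈ fixedPoints N.toStarSubalgebra σ)
    (hPs : vectorSumWeight ξ P < ∞)
    (hE : IsStarProjection E) (hEM : E ∈ fixedPoints N.toStarSubalgebra σ)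
    (hEs : vectorSumWeight ξ (1 - E) < ∞)
    (hT : ∀ v, l * ‖P v‖ ≤ ‖T (P v)‖) (hlt : ‖T * E‖ < l) :
    vectorSumWeight ξ P ≤ vectorSumWeight ξ (1 - E) := by
  have hPP : P * P = P := hP.isIdempotentElem.eq
  have hPstar : star P = P := hP.isSelfAdjoint.star_eq
  set F := 1 - E with hFdef
  have hF : IsStarProjection F := hE.one_sub
  have hFF : F * F = F := hF.isIdempotentElem.eq
  have hFstar : star F = F := hF.isSelfAdjoint.star_eq
  have hPs' := (sqIntegrable_iff_of_isStarProjection hP).2 hPs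
  have hFs' := (sqIntegrable_iff_of_isStarProjection hF).2 hEs
  -- `1 - P E P` is invertible
  set c := (l - ‖T * E‖) / (‖T‖ + 1) with hcdef
  have hc : 0 < c := div_pos (sub_pos.2 hlt) (by positivity)
  -- Splitting `P v` into its parts in `E` and `F = 1 - E`, the `E` part accounts for at most `‖T E‖
  -- ‖P v‖ < l ‖P v‖`, so the `F` part must supply the rest. The `+ 1` in `c` guards against `T =
  -- 0`.
  have hlow : ∀ v, c * ‖P v‖ ≤ ‖F (P v)‖ := by
    intro v
    have h1 : T (P v) = (T * E) (P v) + T (F (P v)) := by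
      rw [mul_apply_eq_comp, ← _root_.map_add T, ← add_apply, hFdef, add_sub_cancel,
        one_apply_eq_self]
    have h2 : ‖T (P v)‖ ≤ ‖T * E‖ * ‖P v‖ + ‖T‖ * ‖F (P v)‖ := by
      rw [h1]
      exact (norm_add_le _ _).trans (add_le_add ((T * E).le_opNorm _) (T.le_opNorm _))
    rw [hcdef, div_mul_eq_mul_div, div_le_iff₀ (by positivity)]
    nlinarith [hT v, norm_nonneg (F (P v))]
  -- The norm bound for `E P` from Pythagoras. The `max` covers `P = 0`, the only case in which `c >
  -- 1` is possible.
  set q := √(max 0 (1 - c ^ 2)) with hqdef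
  have hq : q < 1 := by
    rw [hqdef, Real.sqrt_lt' one_pos]
    have : 0 < c ^ 2 := by positivity
    exact max_lt (by norm_num) (by linarith)
  have hEP : ∀ v, ‖(P * E * P) v‖ ≤ q * ‖v‖ := by
    intro v
    have h1 := norm_sq_add_of_isStarProjection hE (P v)
    have h2 : (c * ‖P v‖) ^ 2 ≤ ‖F (P v)‖ ^ 2 := pow_le_pow_left₀ (by positivity) (hlow v) 2
    have h3 : ‖E (P v)‖ ^ 2 ≤ (q * ‖P v‖) ^ 2 := by
      rw [mul_pow, hqdef, Real.sq_sqrt (le_max_left _ _)]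
      have h4 : (1 - c ^ 2) * ‖P v‖ ^ 2 ≤ max 0 (1 - c ^ 2) * ‖P v‖ ^ 2 := by
        gcongr; exact le_max_right _ _
      rw [mul_pow] at h2
      linarith
    have hq0 : 0 ≤ q := Real.sqrt_nonneg _
    calc ‖(P * E * P) v‖ ≤ ‖E (P v)‖ := norm_apply_le_of_isStarProjection hP _
      _ ≤ q * ‖P v‖ := (sq_le_sq₀ (norm_nonneg _) (by positivity)).1 h3
      _ ≤ q * ‖v‖ := by gcongr; exact norm_apply_le_of_isStarProjection hP v
  have hunit : IsUnit (1 - P * E * P) := isUnit_one_sub_of_norm_lt_one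
    (((P * E * P).opNorm_le_bound (Real.sqrt_nonneg _) hEP).trans_lt hq)
  set Y := 1 - P * E * P with hYdef
  -- On the range of `P` the operator `Y` acts as `P F P`. Inverting `Y` in the whole algebra avoids
  -- the corner algebra of `P`.
  have hYP : Y * P = P * F * P := by
    rw [hYdef, hFdef, sub_mul, mul_sub, sub_mul, mul_assoc (P * E), hPP, one_mul, mul_one, hPP]
  have hPY : P * Y = P * F * P := by
    rw [hYdef, hFdef, mul_sub, mul_sub, sub_mul, ← mul_assoc, ← mul_assoc, hPP, mul_one, hPP]
  obtain ⟨W, hYW, hWY⟩ := isUnit_iff_exists.1 hunit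
  have hYstar : star Y = Y := by
    rw [hYdef, star_sub, star_one, star_mul, star_mul, hPstar, hE.isSelfAdjoint.star_eq, mul_assoc]
  have hWstar : star W = W := by
    have h : star W * Y = 1 := by
      have := congrArg star hYW
      rwa [star_mul, hYstar, star_one] at this
    calc star W = star W * (Y * W) := by rw [hYW, mul_one]
      _ = W := by rw [← mul_assoc, h, one_mul]
  have hWP : W * P = P * W := by
    calc W * P = W * (P * Y) * W := by rw [mul_assoc, mul_assoc, hYW, mul_one]
      _ = W * Y * P * W := by rw [hPY, ← hYP, mul_assoc W Y P]
      _ = P * W := by rw [hWY, one_mul]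
  have hYM : Y ∈ fixedPoints N.toStarSubalgebra σ :=
    sub_mem (one_mem _) (mul_mem (mul_mem hPM hEM) hPM)
  have hWM := inverse_mem_fixedPoints hYM hWY hYW
  have hFM : F ∈ fixedPoints N.toStarSubalgebra σ := sub_mem (one_mem _) hEM
  -- An equivalence of `P` with a subprojection of `F` that needs no polar decomposition: `x y = W
  -- (P F P) = P`, while `y x = F P W P F` is a projection below `F`.
  set x := W * (P * F) with hxdef
  set y := F * P with hydef
  have hxstar : star x = F * W * P := by
    rw [hxdef, star_mul, star_mul, hWstar, hFstar, hPstar, mul_assoc, ← hWP, mul_assoc]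
  have hystar : star y = P * F := by rw [hydef, star_mul, hFstar, hPstar]
  have htr := hσ.tsum_inner_comm (x := x) (y := y)
    (mul_mem hWM (mul_mem hPM hFM)) (mul_mem hFM hPM)
    ((hFs'.left_mul P).left_mul W) (by rw [hxstar]; exact hPs'.left_mul _)
    (hPs'.left_mul F) (by rw [hystar]; exact hFs'.left_mul P)
  have hxy : x * y = P := by
    calc x * y = W * (P * (F * F) * P) := by simp only [hxdef, hydef, mul_assoc]
      _ = W * Y * P := by rw [hFF, ← hYP, mul_assoc]
      _ = P := by rw [hWY, one_mul]
  set Q := y * x with hQdef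
  have hQ : IsStarProjection Q := by
    constructor
    · change y * x * (y * x) = y * x
      rw [mul_assoc y x, ← mul_assoc x y x, hxy, ← mul_assoc y P x, hydef, mul_assoc F P P, hPP]
    · change star (y * x) = y * x
      rw [star_mul, hxstar, hystar, hxdef, hydef]
      simp only [mul_assoc]
      rw [← mul_assoc P P F, hPP, ← mul_assoc W P F, hWP, ← mul_assoc P (P * W) F,
        ← mul_assoc P P W, hPP]
  have hQF : Q * F = Q := by
    rw [hQdef, hxdef]
    simp only [mul_assoc, hFF]
  have hQle : ∀ v, ‖Q v‖ ≤ ‖F v‖ := by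
    intro v
    have h : Q v = Q (F v) := by rw [← mul_apply_eq_comp, hQF]
    rw [h]
    exact norm_apply_le_of_isStarProjection hQ _
  have hQs : SqIntegrable ξ Q := hFs'.mono 1 fun v => by rw [one_mul]; exact hQle v
  -- Traciality now says that `P` and `Q = y x` have the same weight, and `Q ≤ F`.
  rw [hxy] at htr
  simp_rw [inner_apply_of_isStarProjection hP, inner_apply_of_isStarProjection hQ,
    ← Complex.ofReal_tsum] at htr
  rw [vectorSumWeight_of_isStarProjection hP hPs', vectorSumWeight_of_isStarProjection hF hFs',
    Complex.ofReal_injective htr]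
  exact ENNReal.ofReal_le_ofReal
    (hQs.tsum_le_tsum (fun i => pow_le_pow_left₀ (norm_nonneg _) (hQle _) 2) hFs')

end Comparison

/-! ### Elementary properties of singular values -/

section SingularValue

variable {H : Type*} [NormedAddCommGroup H] [InnerProductSpace ℂ H] [CompleteSpace H]
  {M : StarSubalgebra ℂ (H →L[ℂ] H)} {φ : (H →L[ℂ] H) → ℝ≥0∞} {T : H →L[ℂ] H}

theorem singularValue_le {E : H →L[ℂ] H} (hEM : E ∈ M) (hE : IsStarProjection E) {t : ℝ}
    (ht : φ (1 - E) ≤ ENNReal.ofReal t) : singularValue M φ T t ≤ ‖T * E‖ :=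
  csInf_le ⟨0, by rintro _ ⟨E, -, -, -, rfl⟩; exact norm_nonneg _⟩ ⟨E, hEM, hE, ht, rfl⟩

theorem singularValue_nonneg (t : ℝ) : 0 ≤ singularValue M φ T t :=
  Real.sInf_nonneg (by rintro _ ⟨E, -, -, -, rfl⟩; exact norm_nonneg _)

/-- `φ 0 = 0` makes `E = 1` admissible, so the infimum is not over the empty set, where `sInf` would
be `0`. -/
theorem le_singularValue (h0 : φ 0 = 0) {t l : ℝ}
    (h : ∀ E ∈ M, IsStarProjection E → φ (1 - E) ≤ ENNReal.ofReal t → l ≤ ‖T * E‖) :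
    l ≤ singularValue M φ T t := by
  refine le_csInf ⟨‖T * 1‖, 1, one_mem M, .one _, by simp [h0], rfl⟩ ?_
  rintro _ ⟨E, hEM, hE, ht, rfl⟩
  exact h E hEM hE ht

theorem singularValue_le_norm (h0 : φ 0 = 0) (t : ℝ) : singularValue M φ T t ≤ ‖T‖ := by
  have h := singularValue_le (M := M) (φ := φ) (T := T) (one_mem M) (.one _) (t := t)
    (by simp [h0])
  rwa [mul_one] at h

theorem antitone_singularValue (h0 : φ 0 = 0) : Antitone (singularValue M φ T) :=
  fun _ _ hst => le_singularValue h0 fun _ hEM hE hs =>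
    singularValue_le hEM hE (hs.trans (ENNReal.ofReal_le_ofReal hst))

theorem singularValue_mul_le (h0 : φ 0 = 0) (A : H →L[ℂ] H) (t : ℝ) :
    singularValue M φ (A * T) t ≤ ‖A‖ * singularValue M φ T t := by
  rcases (norm_nonneg A).eq_or_lt with hA | hA
  · rw [← hA, zero_mul]
    refine (singularValue_le_norm h0 t).trans ?_
    simpa [← hA] using norm_mul_le A T
  · rw [← div_le_iff₀' hA]
    refine le_singularValue h0 fun E hEM hE ht => ?_
    rw [div_le_iff₀' hA]
    refine (singularValue_le hEM hE ht).trans ?_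
    rw [mul_assoc]
    exact norm_mul_le _ _

end SingularValue

end OperatorTheory

/-! ### Logarithmic means -/

section LogMean

open Filter Topology

/-- Since `m(s) = c / (1 + s) + o(1 / (1 + s))` and `∫₀ᵗ ds / (1 + s) = log (1 + t)`, the main term
gives exactly `c`. The error splits into a fixed initial piece, divided by a diverging logarithm,
and a tail of size `ε/2 · log (1 + t)`. -/
theorem tendsto_inv_log_mul_integral {m : ℝ → ℝ} (hm : Antitone m) {c : ℝ}
    (hlim : Tendsto (fun s => s * m s) atTop (𝓝 c)) :
    Tendsto (fun t => (Real.log (1 + t))⁻¹ * ∫ s in (0 : ℝ)..t, m s) atTop (𝓝 c) := by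
  have hmint : ∀ a b : ℝ, IntervalIntegrable m volume a b := fun a b => hm.intervalIntegrable
  have hinv : ∀ {a b : ℝ}, 0 ≤ a → 0 ≤ b →
      IntervalIntegrable (fun s : ℝ => (1 + s)⁻¹) volume a b := by
    intro a b ha hb
    refine ContinuousOn.intervalIntegrable fun s hs => ?_
    have h0 : 0 ≤ s := (le_min ha hb).trans hs.1
    have h1 : 1 + s ≠ 0 := by positivity
    exact ContinuousAt.continuousWithinAt (by fun_prop (disch := exact h1))
  have hlog : ∀ {a b : ℝ}, 0 ≤ a → 0 ≤ b →
      ∫ s in a..b, (1 + s)⁻¹ = Real.log (1 + b) - Real.log (1 + a) := by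
    intro a b ha hb
    refine intervalIntegral.integral_eq_sub_of_hasDerivAt (f := fun s => Real.log (1 + s))
      (fun s hs => ?_) (hinv ha hb)
    have h0 : 0 ≤ s := (le_min ha hb).trans hs.1
    have h1 : 1 + s ≠ 0 := by positivity
    simpa using ((hasDerivAt_id s).const_add 1).log h1
  have hm0 : Tendsto m atTop (𝓝 0) := by
    have h := hlim.mul tendsto_inv_atTop_zero
    rw [mul_zero] at h
    refine h.congr' ?_
    filter_upwards [eventually_gt_atTop 0] with s hs
    field_simp
  have hd : Tendsto (fun s => (1 + s) * (m s - c * (1 + s)⁻¹)) atTop (𝓝 0) := by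
    have h := (hm0.add hlim).sub_const c
    rw [zero_add, sub_self] at h
    refine h.congr' ?_
    filter_upwards [eventually_gt_atTop 0] with s hs
    have : 1 + s ≠ 0 := by positivity
    field_simp
  have hloginf : Tendsto (fun t : ℝ => Real.log (1 + t)) atTop atTop :=
    Real.tendsto_log_atTop.comp (tendsto_atTop_add_const_left _ _ tendsto_id)
  rw [Metric.tendsto_atTop]
  intro ε hε
  obtain ⟨S, hS⟩ := Metric.tendsto_atTop.1 hd (ε / 2) (by positivity)
  set S' := max S 1 with hS'
  have hS'1 : 1 ≤ S' := le_max_right _ _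
  set K := ‖∫ s in (0 : ℝ)..S', (m s - c * (1 + s)⁻¹)‖ with hK
  have hdint : ∀ {a b : ℝ}, 0 ≤ a → 0 ≤ b →
      IntervalIntegrable (fun s : ℝ => m s - c * (1 + s)⁻¹) volume a b :=
    fun ha hb => (hmint _ _).sub ((hinv ha hb).const_mul c)
  -- Beyond `T0` the initial error `K` is less than `ε/2 · log (1 + t)`.
  obtain ⟨T0, hT0⟩ := (hloginf.eventually (eventually_gt_atTop (2 * K / ε))).exists_forall_of_atTop
  refine ⟨max T0 S', fun t ht => ?_⟩
  have htS : S' ≤ t := (le_max_right _ _).trans ht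
  have ht0 : 0 < t := by linarith
  have hLpos : 0 < Real.log (1 + t) := Real.log_pos (by linarith)
  have hL := hT0 t ((le_max_left _ _).trans ht)
  have h1 : ∫ s in (0 : ℝ)..t, (m s - c * (1 + s)⁻¹)
      = (∫ s in (0 : ℝ)..t, m s) - c * Real.log (1 + t) := by
    rw [intervalIntegral.integral_sub (hmint _ _) ((hinv le_rfl ht0.le).const_mul c),
      intervalIntegral.integral_const_mul, hlog le_rfl ht0.le]
    simp
  have h2 : ‖∫ s in S'..t, (m s - c * (1 + s)⁻¹)‖ ≤ ε / 2 * Real.log (1 + t) := by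
    have h3 : ‖∫ s in S'..t, (m s - c * (1 + s)⁻¹)‖ ≤ ∫ s in S'..t, ε / 2 * (1 + s)⁻¹ := by
      refine intervalIntegral.norm_integral_le_of_norm_le htS (.of_forall fun s hs => ?_)
        ((hinv (by linarith) ht0.le).const_mul _)
      have hsp : 0 < 1 + s := by linarith [hs.1]
      have h4 := hS s ((le_max_left _ _).trans hs.1.le)
      rw [dist_zero_right, norm_mul, Real.norm_of_nonneg hsp.le] at h4
      rw [← div_eq_mul_inv (ε / 2), le_div_iff₀' hsp]
      exact h4.le
    rw [intervalIntegral.integral_const_mul, hlog (by linarith) ht0.le] at h3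
    refine h3.trans ?_
    have : 0 ≤ Real.log (1 + S') := Real.log_nonneg (by linarith)
    gcongr
    linarith
  have h5 : ‖(∫ s in (0 : ℝ)..t, m s) - c * Real.log (1 + t)‖ ≤ K + ε / 2 * Real.log (1 + t) := by
    rw [← h1, ← intervalIntegral.integral_add_adjacent_intervals
      (hdint le_rfl (by linarith : (0 : ℝ) ≤ S')) (hdint (by linarith) ht0.le)]
    exact (norm_add_le _ _).trans (by gcongr)
  rw [Real.dist_eq]
  have h6 : (Real.log (1 + t))⁻¹ * (∫ s in (0 : ℝ)..t, m s) - c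
      = (Real.log (1 + t))⁻¹ * ((∫ s in (0 : ℝ)..t, m s) - c * Real.log (1 + t)) := by
    field_simp
  rw [h6, abs_mul, abs_of_pos (inv_pos.2 hLpos), inv_mul_lt_iff₀ hLpos, ← Real.norm_eq_abs]
  rw [div_lt_iff₀ hε] at hL
  linarith

/-- The logarithmic mean of a bounded function is bounded near the origin. -/
theorem inv_log_mul_integral_le {m : ℝ → ℝ} {B : ℝ} (hB : ∀ s, ‖m s‖ ≤ B) {t : ℝ} (ht : 0 < t) :
    ‖(Real.log (1 + t))⁻¹ * ∫ s in (0 : ℝ)..t, m s‖ ≤ B * (1 + t) := by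
  have hL : 0 < Real.log (1 + t) := Real.log_pos (by linarith)
  have h1 : ‖∫ s in (0 : ℝ)..t, m s‖ ≤ B * t := by
    simpa [abs_of_pos ht] using
      intervalIntegral.norm_integral_le_of_norm_le_const (a := 0) (b := t) fun s _ => hB s
  have h2 : t ≤ Real.log (1 + t) * (1 + t) := by
    have h := Real.one_sub_inv_le_log_of_pos (by linarith : 0 < 1 + t)
    have h3 : (1 - (1 + t)⁻¹) * (1 + t) = t := by
      have : 1 + t ≠ 0 := by linarith
      field_simp
      ring
    calc t = (1 - (1 + t)⁻¹) * (1 + t) := h3.symm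
      _ ≤ _ := by gcongr
  have hB0 : 0 ≤ B := (norm_nonneg _).trans (hB 0)
  rw [norm_mul, norm_inv, Real.norm_of_nonneg hL.le, inv_mul_le_iff₀ hL]
  calc _ ≤ B * t := h1
    _ ≤ B * (Real.log (1 + t) * (1 + t)) := by gcongr
    _ = _ := by ring

/-- Large `t` are controlled by convergence. For small `t` the vanishing of `log (1 + t)` is
compensated by that of the integral. -/
theorem exists_norm_inv_log_mul_integral_le {m : ℝ → ℝ} {B : ℝ} (hB : ∀ s, ‖m s‖ ≤ B) {c : ℝ}
    (hlim : Tendsto (fun t => (Real.log (1 + t))⁻¹ * ∫ s in (0 : ℝ)..t, m s) atTop (𝓝 c)) :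
    ∃ C, ∀ t : ℝ, 0 < t → ‖(Real.log (1 + t))⁻¹ * ∫ s in (0 : ℝ)..t, m s‖ ≤ C := by
  obtain ⟨T0, hT0⟩ := Metric.tendsto_atTop.1 hlim 1 one_pos
  have hB0 : 0 ≤ B := (norm_nonneg _).trans (hB 0)
  refine ⟨max (B * (1 + T0)) (1 + ‖c‖), fun t ht => ?_⟩
  rcases le_total T0 t with h | h
  · refine le_trans ?_ (le_max_right _ _)
    have := hT0 t h
    rw [dist_eq_norm] at this
    linarith [norm_le_norm_sub_add ((Real.log (1 + t))⁻¹ * ∫ s in (0 : ℝ)..t, m s) c]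
  · refine le_trans ?_ (le_max_left _ _)
    refine (inv_log_mul_integral_le hB ht).trans ?_
    gcongr

end LogMean

/-! ### Words, homogeneous elements and the dense core -/

namespace Cuntz

section Words

variable {n : ℕ}

theorem star_S_mul_S (i j : Fin n) : star (S i : Alg n) * S j = if i = j then 1 else 0 := by
  have hiso := (isCuntzFamily_S n).1
  have hsum := (isCuntzFamily_S n).2
  split_ifs with hij
  · rw [← hij, hiso]
  · -- `S_j* S_j = 1 = ∑ S_j* S_k S_k* S_j` forces the other summands to vanish
    have h1 : star (S j : Alg n) * (∑ k, S k * star (S k)) * S j = 1 := by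
      rw [hsum, mul_one, hiso]
    rw [Finset.mul_sum, Finset.sum_mul, ← Finset.add_sum_erase _ _ (Finset.mem_univ j)] at h1
    have h2 : star (S j : Alg n) * (S j * star (S j)) * S j = 1 := by
      rw [← mul_assoc, hiso, one_mul, hiso]
    rw [h2, add_eq_left] at h1
    have h3 : ∀ k, star (S j : Alg n) * (S k * star (S k)) * S j
        = star (star (S k) * S j) * (star (S k) * S j) := by
      intro k
      rw [star_mul, star_star]
      simp only [mul_assoc]
    simp_rw [h3] at h1
    have h4 := (Finset.sum_eq_zero_iff_of_nonneg fun k _ => star_mul_self_nonneg _).1 h1 i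
      (Finset.mem_erase.2 ⟨hij, Finset.mem_univ _⟩)
    exact CStarRing.star_mul_self_eq_zero_iff _ |>.1 h4

@[simp]
theorem word_nil : (word [] : Alg n) = 1 := rfl

theorem word_cons (i : Fin n) (μ : List (Fin n)) : word (i :: μ) = S i * word μ := by
  simp [word]

theorem word_append (μ ν : List (Fin n)) : word (μ ++ ν) = word μ * word ν := by
  simp [word]

theorem star_word_mul_word_of_length_eq {μ ν : List (Fin n)} (h : μ.length = ν.length) :
    star (word μ) * word ν = if μ = ν then 1 else 0 := by
  induction μ generalizing ν with
  | nil =>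
    have : ν = [] := List.length_eq_zero_iff.1 h.symm
    simp [this]
  | cons i μ ih =>
    cases ν with
    | nil => simp at h
    | cons j ν =>
      rw [word_cons, word_cons, star_mul, mul_assoc, ← mul_assoc (star (S i)), star_S_mul_S]
      by_cases hij : i = j
      · rw [if_pos hij, one_mul, ih (by simpa using h)]
        simp [hij]
      · simp [hij]

theorem star_word_mul_word (μ : List (Fin n)) : star (word μ) * word μ = 1 := by
  rw [star_word_mul_word_of_length_eq rfl, if_pos rfl]

variable (n) in
/-- The words of length `k`. -/
def words (k : ℕ) : Finset (List (Fin n)) :=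
  Finset.univ.image (List.ofFn : (Fin k → Fin n) → List (Fin n))

@[simp]
theorem mem_words {k : ℕ} {μ : List (Fin n)} : μ ∈ words n k ↔ μ.length = k := by
  simp only [words, Finset.mem_image, Finset.mem_univ, true_and]
  constructor
  · rintro ⟨f, rfl⟩
    simp
  · rintro rfl
    exact ⟨μ.get, List.ofFn_get μ⟩

theorem card_words (k : ℕ) : (words n k).card = n ^ k := by
  rw [words, Finset.card_image_of_injective _ List.ofFn_injective]
  simp

theorem sum_words_succ {M : Type*} [AddCommMonoid M] (k : ℕ) (g : List (Fin n) → M) :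
    ∑ μ ∈ words n (k + 1), g μ = ∑ i, ∑ μ ∈ words n k, g (i :: μ) := by
  rw [← Finset.sum_product']
  symm
  refine Finset.sum_bij (fun p _ => p.1 :: p.2) ?_ ?_ ?_ fun _ _ => rfl
  · rintro ⟨i, μ⟩ h
    simpa using h
  · rintro ⟨i, μ⟩ _ ⟨j, ν⟩ _ h
    simpa using h
  · intro μ h
    cases μ with
    | nil => simp at h
    | cons i μ => exact ⟨(i, μ), by simpa using h, rfl⟩

theorem sum_word_mul_star_word (k : ℕ) :
    ∑ μ ∈ words n k, (word μ : Alg n) * star (word μ) = 1 := by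
  induction k with
  | zero =>
    have : words n 0 = {[]} := by ext μ; simp
    simp [this]
  | succ k ih =>
    rw [sum_words_succ, ← (isCuntzFamily_S n).2]
    refine Finset.sum_congr rfl fun i _ => ?_
    calc ∑ μ ∈ words n k, (word (i :: μ) : Alg n) * star (word (i :: μ))
        = ∑ μ ∈ words n k, S i * (word μ * star (word μ)) * star (S i) :=
          Finset.sum_congr rfl fun μ _ => by rw [word_cons, star_mul]; simp only [mul_assoc]
      _ = S i * star (S i) := by rw [← Finset.sum_mul, ← Finset.mul_sum, ih, mul_one]

theorem word_mul_star_word_mem_core (μ ν : List (Fin n)) : word μ * star (word ν) ∈ core n :=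
  Submodule.subset_span ⟨(μ, ν), rfl⟩

theorem one_mem_core : (1 : Alg n) ∈ core n := by
  simpa using word_mul_star_word_mem_core ([] : List (Fin n)) []

theorem word_mem_core (μ : List (Fin n)) : word μ ∈ core n := by
  simpa using word_mul_star_word_mem_core μ []

theorem star_word_mem_core (μ : List (Fin n)) : star (word μ) ∈ core n := by
  simpa using word_mul_star_word_mem_core [] μ

theorem S_mul_mem_core (i : Fin n) {c : Alg n} (hc : c ∈ core n) : S i * c ∈ core n := by
  induction hc using Submodule.span_induction with
  | mem x h =>
    obtain ⟨⟨μ, ν⟩, rfl⟩ := h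
    change S i * (word μ * star (word ν)) ∈ core n
    rw [← mul_assoc, ← word_cons]
    exact word_mul_star_word_mem_core _ _
  | zero => rw [mul_zero]; exact zero_mem _
  | add x y _ _ hx hy => rw [mul_add]; exact add_mem hx hy
  | smul a x _ hx => rw [mul_smul_comm]; exact Submodule.smul_mem _ _ hx

/-- `S_i*` cancels the first letter of `μ` or annihilates the product; if `μ` is empty, it is
absorbed into `S_ν*` as a last letter `i`. -/
theorem star_S_mul_mem_core (i : Fin n) {c : Alg n} (hc : c ∈ core n) :
    star (S i) * c ∈ core n := by
  induction hc using Submodule.span_induction with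
  | mem x h =>
    obtain ⟨⟨μ, ν⟩, rfl⟩ := h
    change star (S i) * (word μ * star (word ν)) ∈ core n
    cases μ with
    | nil =>
      have h : star (S i : Alg n) * (word [] * star (word ν)) = star (word (ν ++ [i])) := by
        rw [word_append, star_mul, word_cons]
        simp
      rw [h]
      exact star_word_mem_core _
    | cons j μ =>
      rw [word_cons, mul_assoc (S j), ← mul_assoc (star (S i)), star_S_mul_S]
      split_ifs
      · rw [one_mul]; exact word_mul_star_word_mem_core _ _
      · rw [zero_mul]; exact zero_mem _
  | zero => rw [mul_zero]; exact zero_mem _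
  | add x y _ _ hx hy => rw [mul_add]; exact add_mem hx hy
  | smul a x _ hx => rw [mul_smul_comm]; exact Submodule.smul_mem _ _ hx

theorem word_mul_mem_core (μ : List (Fin n)) {c : Alg n} (hc : c ∈ core n) :
    word μ * c ∈ core n := by
  induction μ with
  | nil => simpa using hc
  | cons i μ ih => rw [word_cons, mul_assoc]; exact S_mul_mem_core i ih

theorem star_word_mul_mem_core (μ : List (Fin n)) {c : Alg n} (hc : c ∈ core n) :
    star (word μ) * c ∈ core n := by
  induction μ generalizing c with
  | nil => simpa using hc
  | cons i μ ih => rw [word_cons, star_mul, mul_assoc]; exact ih (star_S_mul_mem_core i hc)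

theorem mul_mem_core {a b : Alg n} (ha : a ∈ core n) (hb : b ∈ core n) : a * b ∈ core n := by
  induction ha using Submodule.span_induction with
  | mem x h =>
    obtain ⟨⟨μ, ν⟩, rfl⟩ := h
    change word μ * star (word ν) * b ∈ core n
    rw [mul_assoc]
    exact word_mul_mem_core _ (star_word_mul_mem_core _ hb)
  | zero => rw [zero_mul]; exact zero_mem _
  | add x y _ _ hx hy => rw [add_mul]; exact add_mem hx hy
  | smul a x _ hx => rw [smul_mul_assoc]; exact Submodule.smul_mem _ _ hx

/-- An element of the ambient algebra that lies in `O_n`, as an element of `O_n`. -/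
def ofAmbient {x : Ambient n} (h : x ∈ subalgebra n) : Alg n := ⟨x, h⟩

/-- Every element of the `*`-algebra generated by the isometries, as well as its adjoint, multiplies
the core into itself; carrying both statements lets the induction pass through `star`. Applying such
an element to `1` shows that it lies in the core. -/
theorem dense_core : Dense (core n : Set (Alg n)) := by
  have hadj : ∀ x ∈ StarAlgebra.adjoin ℂ (Set.range (ambientGen n)),
      ∃ h : x ∈ subalgebra n, (∀ c ∈ core n, ofAmbient h * c ∈ core n) ∧
        ∀ c ∈ core n, star (ofAmbient h) * c ∈ core n := by
    intro x hx
    induction hx using StarAlgebra.adjoin_induction with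
    | mem x h =>
      obtain ⟨i, rfl⟩ := h
      exact ⟨ambientGen_mem n i, fun c hc => S_mul_mem_core i hc,
        fun c hc => star_S_mul_mem_core i hc⟩
    | algebraMap r =>
      refine ⟨(subalgebra n).algebraMap_mem r, fun c hc => ?_, fun c hc => ?_⟩
      · have h : ofAmbient ((subalgebra n).algebraMap_mem r)
            = algebraMap ℂ (Alg n) r := rfl
        rw [h, ← Algebra.smul_def]
        exact Submodule.smul_mem _ _ hc
      · have h : ofAmbient ((subalgebra n).algebraMap_mem r)
            = algebraMap ℂ (Alg n) r := rfl
        rw [h, ← algebraMap_star_comm, ← Algebra.smul_def]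
        exact Submodule.smul_mem _ _ hc
    | add x y _ _ hx hy =>
      obtain ⟨hx0, hx1, hx2⟩ := hx
      obtain ⟨hy0, hy1, hy2⟩ := hy
      have h : ofAmbient (add_mem hx0 hy0) = ofAmbient hx0 + ofAmbient hy0 := rfl
      refine ⟨add_mem hx0 hy0, fun c hc => ?_, fun c hc => ?_⟩
      · rw [h, add_mul]; exact add_mem (hx1 c hc) (hy1 c hc)
      · rw [h, star_add, add_mul]; exact add_mem (hx2 c hc) (hy2 c hc)
    | mul x y _ _ hx hy =>
      obtain ⟨hx0, hx1, hx2⟩ := hx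
      obtain ⟨hy0, hy1, hy2⟩ := hy
      have h : ofAmbient (mul_mem hx0 hy0) = ofAmbient hx0 * ofAmbient hy0 := rfl
      refine ⟨mul_mem hx0 hy0, fun c hc => ?_, fun c hc => ?_⟩
      · rw [h, mul_assoc]; exact hx1 _ (hy1 c hc)
      · rw [h, star_mul, mul_assoc]; exact hy2 _ (hx2 c hc)
    | star x _ hx =>
      obtain ⟨hx0, hx1, hx2⟩ := hx
      have h : ofAmbient (star_mem hx0) = star (ofAmbient hx0) := rfl
      refine ⟨star_mem hx0, fun c hc => ?_, fun c hc => ?_⟩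
      · rw [h]; exact hx2 c hc
      · rw [h, star_star]; exact hx1 c hc
  intro a
  rw [Metric.mem_closure_iff]
  intro ε hε
  have ha : a.1 ∈ closure (StarAlgebra.adjoin ℂ (Set.range (ambientGen n)) : Set (Ambient n)) :=
    a.2
  obtain ⟨y, hy, hay⟩ := Metric.mem_closure_iff.1 ha ε hε
  obtain ⟨hy0, hy1, -⟩ := hadj y hy
  refine ⟨ofAmbient hy0, ?_, hay⟩
  have := hy1 1 one_mem_core
  rwa [mul_one] at this

end Words

/-! ### Degrees for the gauge action and the expectation -/

section Homogeneous

variable {n : ℕ}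

theorem circle_ne_zero (z : Circle) : (z : ℂ) ≠ 0 := z.coe_ne_zero

variable (n) in
/-- The elements of degree `k` for the gauge action. -/
def homogeneous (k : ℤ) : Submodule ℂ (Alg n) where
  carrier := {a | ∀ z : Circle, gauge z a = (z : ℂ) ^ k • a}
  add_mem' := fun {a b} ha hb z => by rw [map_add, ha z, hb z, smul_add]
  zero_mem' := fun z => by rw [map_zero, smul_zero]
  smul_mem' := fun c a ha z => by rw [map_smul, ha z, smul_comm]

theorem mul_mem_homogeneous {k l : ℤ} {a b : Alg n} (ha : a ∈ homogeneous n k)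
    (hb : b ∈ homogeneous n l) : a * b ∈ homogeneous n (k + l) := fun z => by
  rw [map_mul, ha z, hb z, smul_mul_smul_comm, zpow_add₀ (circle_ne_zero z)]

theorem star_mem_homogeneous {k : ℤ} {a : Alg n} (ha : a ∈ homogeneous n k) :
    star a ∈ homogeneous n (-k) := fun z => by
  rw [map_star, ha z, star_smul, star_zpow₀, zpow_neg, ← inv_zpow, Complex.star_def,
    ← Circle.coe_inv_eq_conj, Circle.coe_inv]

theorem one_mem_homogeneous : (1 : Alg n) ∈ homogeneous n 0 := fun z => by
  rw [map_one, zpow_zero, one_smul]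

theorem word_mem_homogeneous (μ : List (Fin n)) : word μ ∈ homogeneous n μ.length := by
  induction μ with
  | nil => exact one_mem_homogeneous
  | cons i μ ih =>
    rw [word_cons, List.length_cons, Nat.cast_add, add_comm, Nat.cast_one]
    exact mul_mem_homogeneous (fun z => by rw [gauge_S, zpow_one]) ih

theorem star_word_mem_homogeneous (μ : List (Fin n)) :
    star (word μ) ∈ homogeneous n (-μ.length) :=
  star_mem_homogeneous (word_mem_homogeneous μ)

theorem word_mul_star_word_mem_homogeneous (μ ν : List (Fin n)) :
    word μ * star (word ν) ∈ homogeneous n (μ.length - ν.length) :=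
  mul_mem_homogeneous (word_mem_homogeneous μ) (star_word_mem_homogeneous ν)

theorem mem_homogeneous_zero_iff {a : Alg n} : a ∈ homogeneous n 0 ↔ a ∈ fixedAlg n := by
  change (∀ z : Circle, gauge z a = (z : ℂ) ^ (0 : ℤ) • a) ↔ ∀ z : Circle, gauge z a = a
  simp only [zpow_zero, one_smul]

theorem gaugeMean_of_mem_fixedAlg {a : Alg n} (ha : a ∈ fixedAlg n) : gaugeMean a = a := by
  unfold gaugeMean
  have h : ∀ θ : ℝ, gauge (Circle.exp θ) a = a := fun θ => ha _
  simp_rw [h]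
  rw [intervalIntegral.integral_const, sub_zero, smul_smul,
    inv_mul_cancel₀ Real.two_pi_pos.ne', one_smul]

theorem gaugeMean_gauge (z : Circle) (a : Alg n) : gaugeMean (gauge z a) = gaugeMean a := by
  rw [← gaugeMean_mem a z]
  change _ = gaugeCLM z (gaugeMean a)
  unfold gaugeMean
  rw [map_smul, ← ContinuousLinearMap.intervalIntegral_comp_comm _
    ((continuous_gauge_exp a).intervalIntegrable _ _)]
  congr 2
  funext θ
  change gauge _ (gauge _ a) = gauge _ (gauge _ a)
  rw [gauge_gauge, gauge_gauge, mul_comm]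

/-- The mean does not change when `a` is replaced by `γ_z(a) = z^k a`, so `z^k Φ(a) = Φ(a)` for all
`z`. -/
theorem gaugeMean_of_mem_homogeneous {k : ℤ} (hk : k ≠ 0) {a : Alg n}
    (ha : a ∈ homogeneous n k) : gaugeMean a = 0 := by
  have hsmul : ∀ c : ℂ, gaugeMean (c • a) = c • gaugeMean a := fun c =>
    congrArg Subtype.val ((expect n).map_smul c a)
  have h : ∀ z : Circle, (z : ℂ) ^ k • gaugeMean a = gaugeMean a := fun z => by
    rw [← hsmul, ← ha z, gaugeMean_gauge]
  -- For this `z` one has `z^k = e^i`, which is not `1` since `1` is not an integer multiple of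
  -- `2π`.
  have hz := h (Circle.exp (1 / k))
  have hne : ((Circle.exp (1 / k) : Circle) : ℂ) ^ k ≠ 1 := by
    rw [Circle.coe_exp, ← Complex.exp_int_mul, Ne, Complex.exp_eq_one_iff]
    rintro ⟨m, hm⟩
    have hk' : (k : ℂ) ≠ 0 := by exact_mod_cast hk
    have h1 : (1 : ℂ) * Complex.I = (m * (2 * Real.pi)) * Complex.I := by
      rw [show (m * (2 * (Real.pi : ℂ))) * Complex.I = m * (2 * Real.pi * Complex.I) by ring, ← hm]
      push_cast
      field_simp
    have h2 := mul_right_cancel₀ Complex.I_ne_zero h1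
    have h3 : (1 : ℝ) = m * (2 * Real.pi) := by exact_mod_cast h2
    have hm0 : 0 < m := by
      by_contra hm0
      have : (m : ℝ) ≤ 0 := by exact_mod_cast not_lt.1 hm0
      nlinarith [Real.pi_pos]
    have : (1 : ℝ) ≤ m := by exact_mod_cast hm0
    nlinarith [Real.pi_gt_three]
  have h4 : ((((Circle.exp (1 / k) : Circle) : ℂ) ^ k) - 1) • gaugeMean a = 0 := by
    rw [sub_smul, one_smul, hz, sub_self]
  exact (smul_eq_zero.1 h4).resolve_left (sub_ne_zero.2 hne)

theorem gaugeMean_mul_left {b : Alg n} (hb : b ∈ fixedAlg n) (a : Alg n) :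
    gaugeMean (b * a) = b * gaugeMean a := by
  unfold gaugeMean
  rw [mul_smul_comm]
  congr 1
  have h := ContinuousLinearMap.intervalIntegral_comp_comm (ContinuousLinearMap.mul ℝ (Alg n) b)
    ((continuous_gauge_exp a).intervalIntegrable (μ := volume) 0 (2 * Real.pi))
  rw [ContinuousLinearMap.mul_apply'] at h
  rw [← h]
  congr 1
  funext θ
  rw [map_mul, hb]
  rfl

theorem gaugeMean_mul_right {b : Alg n} (hb : b ∈ fixedAlg n) (a : Alg n) :
    gaugeMean (a * b) = gaugeMean a * b := by
  unfold gaugeMean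
  rw [smul_mul_assoc]
  congr 1
  have h := ContinuousLinearMap.intervalIntegral_comp_comm
    ((ContinuousLinearMap.mul ℝ (Alg n)).flip b)
    ((continuous_gauge_exp a).intervalIntegrable (μ := volume) 0 (2 * Real.pi))
  rw [ContinuousLinearMap.flip_apply, ContinuousLinearMap.mul_apply'] at h
  rw [← h]
  congr 1
  funext θ
  rw [map_mul, hb]
  rfl

theorem norm_gaugeMean_le (a : Alg n) : ‖gaugeMean a‖ ≤ ‖a‖ := by
  unfold gaugeMean
  have h := intervalIntegral.norm_integral_le_of_norm_le_const (a := 0) (b := 2 * Real.pi)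
    (C := ‖a‖) (f := fun θ : ℝ => gauge (Circle.exp θ) a) fun θ _ => norm_gauge_le _ a
  rw [sub_zero, abs_of_pos Real.two_pi_pos] at h
  rw [norm_smul, norm_inv, Real.norm_of_nonneg Real.two_pi_pos.le,
    inv_mul_le_iff₀ Real.two_pi_pos, mul_comm _ ‖a‖]
  exact h

theorem expect_coe (a : Alg n) : (expect n a : Alg n) = gaugeMean a := rfl

theorem gaugeMean_mem_core {a : Alg n} (ha : a ∈ core n) : gaugeMean a ∈ core n := by
  rw [← expect_coe]
  induction ha using Submodule.span_induction with
  | mem x h =>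
    obtain ⟨⟨μ, ν⟩, rfl⟩ := h
    change gaugeMean (word μ * star (word ν)) ∈ core n
    by_cases hl : (μ.length : ℤ) - ν.length = 0
    · rw [gaugeMean_of_mem_fixedAlg]
      · exact word_mul_star_word_mem_core _ _
      · rw [← mem_homogeneous_zero_iff, ← hl]
        exact word_mul_star_word_mem_homogeneous μ ν
    · rw [gaugeMean_of_mem_homogeneous hl (word_mul_star_word_mem_homogeneous μ ν)]
      exact zero_mem _
  | zero => rw [map_zero]; exact zero_mem _
  | add x y _ _ hx hy => rw [map_add]; exact add_mem hx hy
  | smul a x _ hx => rw [map_smul]; exact Submodule.smul_mem _ _ hx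

/-- Gauge-invariant elements are limits of gauge-invariant elements of the core. -/
theorem exists_core_fixedAlg_near {a : Alg n} (ha : a ∈ fixedAlg n) {ε : ℝ} (hε : 0 < ε) :
    ∃ b ∈ core n, b ∈ fixedAlg n ∧ ‖a - b‖ < ε := by
  obtain ⟨b, hb, hab⟩ := Metric.mem_closure_iff.1 (dense_core a) ε hε
  refine ⟨gaugeMean b, gaugeMean_mem_core hb, gaugeMean_mem b, ?_⟩
  -- The averaging is a contraction that fixes `a`, so it does not spoil the approximation.
  have h : a - gaugeMean b = gaugeMean (a - b) := by
    rw [← expect_coe (a - b), map_sub]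
    change _ = gaugeMean a - gaugeMean b
    rw [gaugeMean_of_mem_fixedAlg ha]
  rw [h]
  exact (norm_gaugeMean_le _).trans_lt (by rwa [← dist_eq_norm])

end Homogeneous

end Cuntz

/-! ### The KMS state and the graded Hilbert space -/

namespace Cuntz

open OperatorTheory

variable {n : ℕ} (τ : TracialState n)

theorem kmsState_apply (a : Alg n) : kmsState τ a = τ.toLinearMap (expect n a) := rfl

theorem kmsState_star (a : Alg n) : kmsState τ (star a) = star (kmsState τ a) :=
  map_star (kmsState τ) a

theorem kmsState_coe (f : fixedAlg n) : kmsState τ (f : Alg n) = τ.toLinearMap f := by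
  rw [kmsState_apply]
  congr 1
  exact Subtype.ext (gaugeMean_of_mem_fixedAlg f.2)

theorem kmsState_one : kmsState τ 1 = 1 := by
  have h := kmsState_coe τ 1
  rw [τ.map_one] at h
  exact h

theorem kmsState_of_mem_homogeneous {k : ℤ} (hk : k ≠ 0) {a : Alg n}
    (ha : a ∈ homogeneous n k) : kmsState τ a = 0 := by
  have h : expect n a = 0 := Subtype.ext (gaugeMean_of_mem_homogeneous hk ha)
  rw [kmsState_apply, h, map_zero]

/-- `Φ` is an `F`-bimodule map, so the trace property on `F` passes to products with one factor in
`F`. -/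
theorem kmsState_mul_comm_of_mem_fixedAlg {b : Alg n} (hb : b ∈ fixedAlg n) (a : Alg n) :
    kmsState τ (a * b) = kmsState τ (b * a) := by
  have h1 : expect n (a * b) = expect n a * ⟨b, hb⟩ := Subtype.ext (gaugeMean_mul_right hb a)
  have h2 : expect n (b * a) = ⟨b, hb⟩ * expect n a := Subtype.ext (gaugeMean_mul_left hb a)
  rw [kmsState_apply, kmsState_apply, h1, h2, τ.map_mul_comm]

/-! #### The Hilbert space -/

/-- The canonical map `O_n → ℋ`, as a linear map. -/
def toHilbₗ : Alg n →ₗ[ℂ] Hilb τ where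
  toFun := toHilb τ
  map_add' a b := by
    simp only [toHilb, map_add]
    exact UniformSpace.Completion.coe_add _ _
  map_smul' c a := by
    simp only [toHilb, map_smul]
    exact UniformSpace.Completion.coe_smul _ _

theorem toHilbₗ_apply (a : Alg n) : toHilbₗ τ a = toHilb τ a := rfl

theorem toHilb_add (a b : Alg n) : toHilb τ (a + b) = toHilb τ a + toHilb τ b :=
  (toHilbₗ τ).map_add a b

theorem toHilb_smul (c : ℂ) (a : Alg n) : toHilb τ (c • a) = c • toHilb τ a :=
  (toHilbₗ τ).map_smul c a

theorem toHilb_zero : toHilb τ 0 = 0 := (toHilbₗ τ).map_zero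

theorem toHilb_sum {ι : Type*} (s : Finset ι) (a : ι → Alg n) :
    toHilb τ (∑ i ∈ s, a i) = ∑ i ∈ s, toHilb τ (a i) :=
  map_sum (toHilbₗ τ) a s

theorem inner_toHilb (a b : Alg n) :
    ⟪toHilb τ a, toHilb τ b⟫_ℂ = kmsState τ (star a * b) := by
  unfold toHilb
  rw [UniformSpace.Completion.inner_coe]
  rfl

theorem rep_toHilb (a b : Alg n) : rep τ a (toHilb τ b) = toHilb τ (a * b) :=
  PositiveLinearMap.gnsNonUnitalStarAlgHom_apply_coe (kmsState τ)

theorem norm_rep_le (a : Alg n) : ‖rep τ a‖ ≤ ‖a‖ :=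
  NonUnitalStarAlgHom.norm_apply_le (rep τ) a

theorem norm_toHilb_one : ‖toHilb τ 1‖ = 1 := by
  have h : ((‖toHilb τ 1‖ ^ 2 : ℝ) : ℂ) = 1 := by
    rw [ofReal_norm_sq, inner_toHilb, star_one, one_mul, kmsState_one]
  have h2 : ‖toHilb τ 1‖ ^ 2 = 1 := by exact_mod_cast h
  exact (pow_eq_one_iff_of_nonneg (norm_nonneg _) two_ne_zero).1 h2

theorem norm_toHilb_le (a : Alg n) : ‖toHilb τ a‖ ≤ ‖a‖ := by
  have h := (rep τ a).le_opNorm (toHilb τ 1)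
  rw [rep_toHilb, mul_one, norm_toHilb_one, mul_one] at h
  exact h.trans (norm_rep_le τ a)

theorem norm_kmsState_le (a : Alg n) : ‖kmsState τ a‖ ≤ ‖a‖ := by
  have h := inner_toHilb τ 1 a
  rw [star_one, one_mul] at h
  rw [← h]
  refine (norm_inner_le_norm _ _).trans ?_
  rw [norm_toHilb_one, one_mul]
  exact norm_toHilb_le τ a

theorem continuous_toHilb : Continuous (toHilb τ) :=
  AddMonoidHomClass.continuous_of_bound (toHilbₗ τ) 1 fun a => by
    rw [one_mul]
    exact norm_toHilb_le τ a

theorem continuous_kmsState : Continuous (kmsState τ) :=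
  AddMonoidHomClass.continuous_of_bound (kmsState τ) 1 fun a => by
    simpa using norm_kmsState_le τ a

theorem denseRange_toHilb : DenseRange (toHilb τ) :=
  UniformSpace.Completion.denseRange_coe.comp (kmsState τ).toPreGNS.surjective.denseRange
    (UniformSpace.Completion.continuous_coe _)

/-- The vectors coming from words span a dense subspace. -/
theorem dense_span_words : Dense ((Submodule.span ℂ
    (Set.range fun p : List (Fin n) × List (Fin n) => toHilb τ (word p.1 * star (word p.2))) :
      Submodule ℂ (Hilb τ)) : Set (Hilb τ)) := by
  have h : Dense (toHilb τ '' (core n : Set (Alg n))) :=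
    (denseRange_toHilb τ).dense_image (continuous_toHilb τ) dense_core
  refine h.mono ?_
  rintro _ ⟨a, ha, rfl⟩
  have h2 := Submodule.mem_map_of_mem (f := toHilbₗ τ) ha
  rw [core, Submodule.map_span, ← Set.range_comp] at h2
  exact h2

theorem dense_toHilb_core : Dense (toHilb τ '' (core n : Set (Alg n))) :=
  (denseRange_toHilb τ).dense_image (continuous_toHilb τ) dense_core

/-- The closure-free subspace of vectors of degree `k`. -/
def component (k : ℤ) : Submodule ℂ (Hilb τ) := (homogeneous n k).map (toHilbₗ τ)

theorem toHilb_mem_component {k : ℤ} {a : Alg n} (ha : a ∈ homogeneous n k) :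
    toHilb τ a ∈ component τ k := Submodule.mem_map_of_mem ha

theorem inner_toHilb_of_ne {k l : ℤ} (h : k ≠ l) {a b : Alg n} (ha : a ∈ homogeneous n k)
    (hb : b ∈ homogeneous n l) : ⟪toHilb τ a, toHilb τ b⟫_ℂ = 0 := by
  rw [inner_toHilb]
  exact kmsState_of_mem_homogeneous τ (k := -k + l) (by omega)
    (mul_mem_homogeneous (star_mem_homogeneous ha) hb)

theorem isOrthogonalDecomposition_component : IsOrthogonalDecomposition (component τ) where
  orthogonal := by
    rintro k l hkl ⟨_, a, ha, rfl⟩ ⟨_, b, hb, rfl⟩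
    exact inner_toHilb_of_ne τ hkl ha hb
  dense := by
    refine (dense_span_words τ).mono ?_
    change Submodule.span ℂ _ ≤ _
    rw [Submodule.span_le]
    rintro _ ⟨⟨μ, ν⟩, rfl⟩
    exact Submodule.mem_iSup_of_mem _
      (toHilb_mem_component τ (word_mul_star_word_mem_homogeneous μ ν))

/-! #### Values of the state and the KMS condition -/

variable {τ}

/-- The matrix units of the gauge-invariant algebra. -/
def matrixUnit {μ ν : List (Fin n)} (h : μ.length = ν.length) : fixedAlg n :=
  ⟨word μ * star (word ν), by
    rw [← mem_homogeneous_zero_iff]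
    have := word_mul_star_word_mem_homogeneous μ ν
    rwa [h, sub_self] at this⟩

variable (τ)

/-- For equal lengths `e_{μμ} e_{μν} = e_{μν}` while `e_{μν} e_{μμ} = 0`, and a trace cannot tell
the two orders apart. For unequal lengths the degree is nonzero. -/
theorem kmsState_word_mul_star_word_of_ne {μ ν : List (Fin n)} (h : μ ≠ ν) :
    kmsState τ (word μ * star (word ν)) = 0 := by
  by_cases hl : μ.length = ν.length
  · have h1 := τ.map_mul_comm (matrixUnit (rfl : μ.length = μ.length)) (matrixUnit hl)
    have h2 : matrixUnit (rfl : μ.length = μ.length) * matrixUnit hl = matrixUnit hl := by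
      apply Subtype.ext
      change word μ * star (word μ) * (word μ * star (word ν)) = word μ * star (word ν)
      rw [mul_assoc, ← mul_assoc (star (word μ)), star_word_mul_word, one_mul]
    have h3 : matrixUnit hl * matrixUnit (rfl : μ.length = μ.length) = 0 := by
      apply Subtype.ext
      change word μ * star (word ν) * (word μ * star (word μ)) = 0
      rw [mul_assoc, ← mul_assoc (star (word ν)), star_word_mul_word_of_length_eq hl.symm,
        if_neg h.symm, zero_mul, mul_zero]
    rw [h2, h3, map_zero] at h1
    rw [← h1, ← kmsState_coe]
    rfl
  · exact kmsState_of_mem_homogeneous τ (by omega) (word_mul_star_word_mem_homogeneous μ ν)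

/-- The `n^k` diagonal matrix units of length `k` are equivalent in `F`, hence have equal trace, and
they sum to one. -/
theorem kmsState_word_mul_star_word_self (μ : List (Fin n)) :
    kmsState τ (word μ * star (word μ)) = ((n : ℂ) ^ μ.length)⁻¹ := by
  have heq : ∀ ν ∈ words n μ.length,
      kmsState τ (word ν * star (word ν)) = kmsState τ (word μ * star (word μ)) := by
    intro ν hν
    have hl : ν.length = μ.length := by simpa using hν
    have h1 := τ.map_mul_comm (matrixUnit hl) (matrixUnit hl.symm)
    have h2 : ∀ {α β : List (Fin n)} (h : α.length = β.length),
        τ.toLinearMap (matrixUnit h * matrixUnit h.symm) = kmsState τ (word α * star (word α)) := by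
      intro α β h
      rw [← kmsState_coe]
      congr 1
      change word α * star (word β) * (word β * star (word α)) = word α * star (word α)
      rw [mul_assoc, ← mul_assoc (star (word β)), star_word_mul_word, one_mul]
    rwa [h2 hl, h2 hl.symm] at h1
  have hsum : ∑ ν ∈ words n μ.length, kmsState τ (word ν * star (word ν)) = 1 := by
    rw [← map_sum, sum_word_mul_star_word, kmsState_one]
  rw [Finset.sum_congr rfl heq, Finset.sum_const, card_words, nsmul_eq_mul, Nat.cast_pow] at hsum
  exact eq_inv_of_mul_eq_one_right hsum

/-- On the core both sides vanish except on `x = S_μ S_{iμ}*`, where the two values of the state are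
`n^{-|μ|}` and `n^{-|μ|-1}`. Continuity does the rest. -/
theorem kmsState_mul_S (hn : n ≠ 0) (i : Fin n) (x : Alg n) :
    kmsState τ (x * S i) = n * kmsState τ (S i * x) := by
  have hn' : (n : ℂ) ≠ 0 := by exact_mod_cast hn
  have hcore : ∀ x ∈ core n, kmsState τ (x * S i) = n * kmsState τ (S i * x) := by
    intro x hx
    induction hx using Submodule.span_induction with
    | mem x h =>
      obtain ⟨⟨μ, ν⟩, rfl⟩ := h
      change kmsState τ (word μ * star (word ν) * S i)
        = n * kmsState τ (S i * (word μ * star (word ν)))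
      rw [← mul_assoc (S i), ← word_cons]
      cases ν with
      | nil =>
        rw [word_nil, star_one, mul_one, mul_one]
        have h1 : word μ * S i ∈ homogeneous n (μ.length + 1) :=
          mul_mem_homogeneous (word_mem_homogeneous μ) fun z => by rw [gauge_S, zpow_one]
        rw [kmsState_of_mem_homogeneous τ (by omega) h1,
          kmsState_of_mem_homogeneous τ _ (word_mem_homogeneous _), mul_zero]
        simp only [List.length_cons]
        omega
      | cons j ν =>
        rw [word_cons j ν, star_mul, mul_assoc, mul_assoc, star_S_mul_S, ← star_mul, ← word_cons]
        by_cases hij : j = i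
        · subst hij
          rw [if_pos rfl, mul_one]
          by_cases hμν : μ = ν
          · subst hμν
            rw [kmsState_word_mul_star_word_self τ, kmsState_word_mul_star_word_self τ,
              List.length_cons, pow_succ]
            field_simp
          · rw [kmsState_word_mul_star_word_of_ne τ hμν,
              kmsState_word_mul_star_word_of_ne τ (by simpa using hμν), mul_zero]
        · rw [if_neg hij, mul_zero, mul_zero, map_zero,
            kmsState_word_mul_star_word_of_ne τ (by simp [Ne.symm hij]), mul_zero]
    | zero => simp
    | add x y _ _ hx hy => rw [add_mul, mul_add, map_add, map_add, hx, hy, mul_add]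
    | smul a x _ hx =>
      rw [smul_mul_assoc, mul_smul_comm, map_smul, map_smul, hx, smul_eq_mul, smul_eq_mul]
      ring
  have hφ := continuous_kmsState τ
  have hcl : IsClosed {x : Alg n | kmsState τ (x * S i) = n * kmsState τ (S i * x)} :=
    isClosed_eq (hφ.comp (by fun_prop)) (continuous_const.mul (hφ.comp (by fun_prop)))
  exact hcl.closure_subset_iff.2 hcore (dense_core x)

theorem kmsState_mul_word (hn : n ≠ 0) (μ : List (Fin n)) (x : Alg n) :
    kmsState τ (x * word μ) = (n : ℂ) ^ μ.length * kmsState τ (word μ * x) := by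
  induction μ generalizing x with
  | nil => simp
  | cons i μ ih =>
    rw [word_cons, ← mul_assoc, ih, ← mul_assoc, kmsState_mul_S τ hn, List.length_cons, pow_succ,
      ← mul_assoc, ← mul_assoc]

theorem kmsState_star_word_mul (hn : n ≠ 0) (μ : List (Fin n)) (x : Alg n) :
    kmsState τ (star (word μ) * x) = (n : ℂ) ^ μ.length * kmsState τ (x * star (word μ)) := by
  have h := congrArg star (kmsState_mul_word τ hn μ (star x))
  rw [star_mul', ← kmsState_star, ← kmsState_star, star_mul, star_mul, star_star] at h
  simpa using h

/-- The KMS condition: `φ(b a) = n^{|μ| - |ν|} φ(a b)` for `a = S_μ S_ν*`. -/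
theorem kmsState_mul_comm_word (hn : n ≠ 0) (μ ν : List (Fin n)) (b : Alg n) :
    kmsState τ (b * (word μ * star (word ν)))
      = (n : ℂ) ^ ((μ.length : ℤ) - ν.length) * kmsState τ (word μ * star (word ν) * b) := by
  have hn' : (n : ℂ) ≠ 0 := by exact_mod_cast hn
  have h1 := kmsState_star_word_mul τ hn ν (b * word μ)
  have h2 := kmsState_mul_word τ hn μ (star (word ν) * b)
  rw [← mul_assoc (star (word ν))] at h1
  rw [mul_assoc (star (word ν)), ← mul_assoc (word μ)] at h2
  rw [mul_assoc (star (word ν))] at h1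
  rw [h1, mul_assoc b] at h2
  rw [zpow_sub₀ hn', zpow_natCast, zpow_natCast, div_mul_eq_mul_div, ← h2,
    mul_div_cancel_left₀ _ (pow_ne_zero _ hn')]

end Cuntz

/-! ### Uniqueness of the operators attached to graphs -/

namespace OperatorTheory

section Graph

variable {H : Type*} [NormedAddCommGroup H] [InnerProductSpace ℂ H] [CompleteSpace H]

/-- If `d` is the difference of two candidates for `(1 + D²)⁻¹ ξ`, then `D² d = -d`, and symmetry
gives `‖D d‖² = -‖d‖²`. So the squares agree, and positive square roots are unique. -/
theorem invSqrtOneAddSq_eq {D : Submodule ℂ (H × H)}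
    (hD : ∀ p ∈ D, ∀ q ∈ D, ⟪p.1, q.2⟫_ℂ = ⟪p.2, q.1⟫_ℂ) {R : H →L[ℂ] H}
    (hR : IsInvSqrtOneAddSq (D : Set (H × H)) R) : invSqrtOneAddSq (D : Set (H × H)) = R := by
  have hex : ∃ R, IsInvSqrtOneAddSq (D : Set (H × H)) R := ⟨R, hR⟩
  unfold invSqrtOneAddSq
  rw [dif_pos hex]
  obtain ⟨h0, h⟩ := hex.choose_spec
  obtain ⟨h0', h'⟩ := hR
  set R' := hex.choose
  have hsq : R' * R' = R * R := by
    ext ξ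
    obtain ⟨η, ζ, h1, h2, h3⟩ := h ξ
    obtain ⟨η', ζ', h1', h2', h3'⟩ := h' ξ
    have hd1 := D.sub_mem h1 h1'
    have hd2 := D.sub_mem h2 h2'
    rw [Prod.mk_sub_mk] at hd1 hd2
    have hs := hD _ hd1 _ hd2
    have hζ : ζ - ζ' = -(R' (R' ξ) - R (R ξ)) := by
      rw [eq_sub_of_add_eq' h3, eq_sub_of_add_eq' h3']
      abel
    simp only [hζ, inner_neg_right, ← ofReal_norm_sq] at hs
    have hs' : -(‖R' (R' ξ) - R (R ξ)‖ ^ 2) = ‖η - η'‖ ^ 2 := by exact_mod_cast hs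
    have : ‖R' (R' ξ) - R (R ξ)‖ ^ 2 = 0 := by
      nlinarith [sq_nonneg ‖R' (R' ξ) - R (R ξ)‖, sq_nonneg ‖η - η'‖]
    exact sub_eq_zero.1 (norm_eq_zero.1 (pow_eq_zero_iff two_ne_zero |>.1 this))
  rw [← CFC.sqrt_unique hsq h0, CFC.sqrt_mul_self R h0']

/-- For two candidates, `d = A' ξ - A ξ` satisfies `S*S(-ε d) = d`; pairing with `-ε d` gives `-ε
‖d‖² ≥ 0`. -/
theorem boundedApprox_antilinearStarMulSelf_eq {S : Set (H × H)}
    (hS : ∀ p ∈ S, ∀ q ∈ S, p - q ∈ S) {ε : ℝ} (hε : 0 < ε) {A : H →L[ℂ] H}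
    (hA : IsBoundedApprox (antilinearStarMulSelf S) ε A) :
    boundedApprox (antilinearStarMulSelf S) ε = A := by
  have hex : ∃ A, IsBoundedApprox (antilinearStarMulSelf S) ε A := ⟨A, hA⟩
  unfold boundedApprox
  rw [dif_pos hex]
  have h := hex.choose_spec
  set A' := hex.choose
  ext ξ
  obtain ⟨η, h1, h2⟩ := h ξ
  obtain ⟨η', h1', h2'⟩ := hA ξ
  have hd := hS _ h1 _ h1'
  rw [Prod.mk_sub_mk] at hd
  have hd1 := h2 _ hd
  have hd2 := h2' _ hd
  have e := congrArg₂ (· - ·) hd1 hd2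
  simp only [← inner_sub_left, ← inner_sub_right] at e
  have e1 : ξ - (ε : ℂ) • A' ξ - (ξ - (ε : ℂ) • A ξ) = -((ε : ℂ) • (A' ξ - A ξ)) := by
    rw [smul_sub]; abel
  rw [e1, inner_neg_left, inner_smul_left, Complex.conj_ofReal, ← ofReal_norm_sq,
    ← ofReal_norm_sq] at e
  have e2 : -(ε * ‖A' ξ - A ξ‖ ^ 2) = ‖η - η'‖ ^ 2 := by exact_mod_cast e
  have e3 : ‖A' ξ - A ξ‖ ^ 2 = 0 := by
    nlinarith [mul_nonneg hε.le (sq_nonneg ‖A' ξ - A ξ‖), sq_nonneg ‖η - η'‖,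
      sq_nonneg ‖A' ξ - A ξ‖]
  exact sub_eq_zero.1 (norm_eq_zero.1 (pow_eq_zero_iff two_ne_zero |>.1 e3))

/-- A closed additive relation that is bounded and densely defined is defined everywhere. -/
theorem exists_mem_of_dense_of_norm_le {Z : Set (H × H)} (hcl : IsClosed Z)
    (hsub : ∀ p ∈ Z, ∀ q ∈ Z, p - q ∈ Z) {C : ℝ} (hC : ∀ p ∈ Z, ‖p.2‖ ≤ C * ‖p.1‖)
    (hdense : Dense (Prod.fst '' Z)) (ξ : H) : ∃ η, (ξ, η) ∈ Z := by
  obtain ⟨x, hx, hlim⟩ := mem_closure_iff_seq_limit.1 (hdense ξ)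
  choose p hp hpx using hx
  obtain rfl : (fun m => (p m).1) = x := funext hpx
  have hcauchy : CauchySeq fun m => (p m).2 := by
    have h1 := hlim.cauchySeq
    rw [Metric.cauchySeq_iff] at h1 ⊢
    intro ε hε
    obtain ⟨M, hM⟩ := h1 (ε / (|C| + 1)) (by positivity)
    refine ⟨M, fun a ha b hb => ?_⟩
    have h2 := hC _ (hsub _ (hp a) _ (hp b))
    have h3 := hM a ha b hb
    rw [dist_eq_norm, lt_div_iff₀ (by positivity)] at h3
    rw [dist_eq_norm]
    rw [Prod.snd_sub, Prod.fst_sub] at h2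
    nlinarith [le_abs_self C, norm_nonneg ((p a).1 - (p b).1)]
  obtain ⟨η, hη⟩ := cauchySeq_tendsto_of_complete hcauchy
  exact ⟨η, hcl.mem_of_tendsto (hlim.prodMk_nhds hη) (.of_forall hp)⟩

end Graph

end OperatorTheory

/-! ### The operators `(1 + 𝒟²)^{-1/2}` and `Δ_ε` -/

namespace Cuntz

open OperatorTheory

variable {n : ℕ} (τ : TracialState n)

/-- The operator that acts as `c k` on the vectors of degree `k`. -/
abbrev gradedDiag (c : ℤ → ℂ) : Hilb τ →L[ℂ] Hilb τ := diag (component τ) c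

theorem gradedDiag_toHilb {c : ℤ → ℂ} (hc : ∃ C, ∀ i, ‖c i‖ ≤ C) {k : ℤ} {a : Alg n}
    (ha : a ∈ homogeneous n k) : gradedDiag τ c (toHilb τ a) = c k • toHilb τ a :=
  (isOrthogonalDecomposition_component τ).diag_apply hc (toHilb_mem_component τ ha)

theorem exists_norm_le_of_nonneg_of_le {ι : Type*} {c : ι → ℝ} {C : ℝ} (h0 : ∀ i, 0 ≤ c i)
    (hC : ∀ i, c i ≤ C) : ∃ C, ∀ i, ‖((c i : ℝ) : ℂ)‖ ≤ C :=
  ⟨C, fun i => by rw [Complex.norm_real, Real.norm_of_nonneg (h0 i)]; exact hC i⟩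

/-! ### The operator `(1 + 𝒟²)^{-1/2}` by degree -/

section Resolvent

/-- The eigenvalue `(1 + k²)^{-1/2}`. -/
def invSqrtWeight (k : ℤ) : ℝ := (√(1 + (k : ℝ) ^ 2))⁻¹

theorem invSqrtWeight_pos (k : ℤ) : 0 < invSqrtWeight k := by
  unfold invSqrtWeight
  positivity

theorem invSqrtWeight_le_one (k : ℤ) : invSqrtWeight k ≤ 1 := by
  unfold invSqrtWeight
  refine inv_le_one_of_one_le₀ (Real.one_le_sqrt.2 ?_)
  nlinarith [sq_nonneg (k : ℝ)]

theorem exists_norm_invSqrtWeight_le : ∃ C, ∀ k, ‖((invSqrtWeight k : ℝ) : ℂ)‖ ≤ C :=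
  exists_norm_le_of_nonneg_of_le (fun k => (invSqrtWeight_pos k).le) invSqrtWeight_le_one

/-- Degrees are real and different degrees are orthogonal; the relation is closed in each variable.
-/
theorem dirac_symmetric : ∀ p ∈ dirac τ, ∀ q ∈ dirac τ, ⟪p.1, q.2⟫_ℂ = ⟪p.2, q.1⟫_ℂ := by
  set X := Submodule.span ℂ (Set.range fun p : List (Fin n) × List (Fin n) =>
    (toHilb τ (word p.1 * star (word p.2)),
      ((p.1.length : ℂ) - (p.2.length : ℂ)) • toHilb τ (word p.1 * star (word p.2)))) with hX
  have hcl : ∀ q : Hilb τ × Hilb τ,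
      IsClosed {p : Hilb τ × Hilb τ | ⟪p.1, q.2⟫_ℂ = ⟪p.2, q.1⟫_ℂ} :=
    fun q => isClosed_eq (by fun_prop) (by fun_prop)
  have hcl' : ∀ p : Hilb τ × Hilb τ,
      IsClosed {q : Hilb τ × Hilb τ | ⟪p.1, q.2⟫_ℂ = ⟪p.2, q.1⟫_ℂ} :=
    fun q => isClosed_eq (by fun_prop) (by fun_prop)
  have h1 : ∀ p ∈ X, ∀ q ∈ X, ⟪p.1, q.2⟫_ℂ = ⟪p.2, q.1⟫_ℂ := by
    intro p hp q hq
    induction hp using Submodule.span_induction with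
    | mem p hp =>
      obtain ⟨⟨μ, ν⟩, rfl⟩ := hp
      induction hq using Submodule.span_induction with
      | mem q hq =>
        obtain ⟨⟨α, β⟩, rfl⟩ := hq
        simp only [inner_smul_left, inner_smul_right, map_sub, Complex.conj_natCast]
        by_cases h : (μ.length : ℤ) - ν.length = α.length - β.length
        · have : (μ.length : ℂ) - ν.length = α.length - β.length := by exact_mod_cast h
          rw [this]
        · rw [inner_toHilb_of_ne τ h (word_mul_star_word_mem_homogeneous μ ν)
            (word_mul_star_word_mem_homogeneous α β), mul_zero, mul_zero]
      | zero => simp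
      | add x y _ _ hx hy =>
        simp only [Prod.fst_add, Prod.snd_add, inner_add_right] at hx hy ⊢
        rw [hx, hy]
      | smul a x _ hx =>
        simp only [Prod.smul_fst, Prod.smul_snd, inner_smul_right] at hx ⊢
        rw [hx]
    | zero => simp
    | add x y _ _ hx hy =>
      simp only [Prod.fst_add, Prod.snd_add, inner_add_left] at hx hy ⊢
      rw [hx, hy]
    | smul a x _ hx =>
      simp only [Prod.smul_fst, Prod.smul_snd, inner_smul_left] at hx ⊢
      rw [hx]
  have h2 : ∀ p ∈ dirac τ, ∀ q ∈ X, ⟪p.1, q.2⟫_ℂ = ⟪p.2, q.1⟫_ℂ :=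
    fun p hp q hq => (hcl q).closure_subset_iff.2 (fun p hp => h1 p hp q hq) hp
  exact fun p hp q hq => (hcl' p).closure_subset_iff.2 (fun q hq => h2 p hp q hq) hq

/-- `(diag c ξ, diag (k c) ξ)` lies in the graph of `𝒟`. -/
theorem gradedDiag_mem_dirac {c d : ℤ → ℂ} (hc : ∃ C, ∀ i, ‖c i‖ ≤ C)
    (hd : ∃ C, ∀ i, ‖d i‖ ≤ C) (h : ∀ k, d k = k * c k) (ξ : Hilb τ) :
    (gradedDiag τ c ξ, gradedDiag τ d ξ) ∈ dirac τ := by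
  have hcl : IsClosed {ξ : Hilb τ | (gradedDiag τ c ξ, gradedDiag τ d ξ) ∈ dirac τ} :=
    (Submodule.isClosed_topologicalClosure _).preimage (by fun_prop)
  refine hcl.closure_subset_iff.2 (fun ξ hξ => ?_) (dense_span_words τ ξ)
  let L : Hilb τ →ₗ[ℂ] Hilb τ × Hilb τ :=
    (gradedDiag τ c).toLinearMap.prod (gradedDiag τ d).toLinearMap
  have hle : Submodule.span ℂ (Set.range fun p : List (Fin n) × List (Fin n) =>
      toHilb τ (word p.1 * star (word p.2))) ≤ (dirac τ).comap L := by
    rw [Submodule.span_le]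
    rintro _ ⟨⟨μ, ν⟩, rfl⟩
    change (gradedDiag τ c (toHilb τ (word μ * star (word ν))),
      gradedDiag τ d (toHilb τ (word μ * star (word ν)))) ∈ dirac τ
    rw [gradedDiag_toHilb τ hc (word_mul_star_word_mem_homogeneous μ ν),
      gradedDiag_toHilb τ hd (word_mul_star_word_mem_homogeneous μ ν), h, mul_comm, mul_smul,
      ← Prod.smul_mk]
    refine Submodule.smul_mem _ _ (Submodule.le_topologicalClosure _
      (Submodule.subset_span ⟨(μ, ν), ?_⟩))
    simp
  exact hle hξ

theorem resolventRoot_eq :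
    resolventRoot τ = gradedDiag τ fun k => ((invSqrtWeight k : ℝ) : ℂ) := by
  have hV := isOrthogonalDecomposition_component τ
  refine invSqrtOneAddSq_eq (dirac_symmetric τ)
    ⟨hV.diag_nonneg ⟨1, invSqrtWeight_le_one⟩ fun k => (invSqrtWeight_pos k).le, fun ξ => ?_⟩
  have hb0 := exists_norm_invSqrtWeight_le
  -- The eigenvalues of `R²`, `𝒟 R²` and `𝒟² R²`. All three are bounded, so the vectors required by
  -- the graph description are values of bounded operators.
  let c₀ : ℤ → ℂ := fun k => (invSqrtWeight k : ℂ) * invSqrtWeight k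
  let c₁ : ℤ → ℂ := fun k => k * c₀ k
  let c₂ : ℤ → ℂ := fun k => k * c₁ k
  have hsq : ∀ k, c₀ k = ((1 + (k : ℝ) ^ 2)⁻¹ : ℝ) := by
    intro k
    simp only [c₀, invSqrtWeight]
    rw [← Complex.ofReal_mul, ← mul_inv, Real.mul_self_sqrt (by positivity)]
  have hn0 : ∀ k, ‖c₀ k‖ = (1 + (k : ℝ) ^ 2)⁻¹ := fun k => by
    rw [hsq, Complex.norm_real, Real.norm_of_nonneg (by positivity)]
  have h0 : ∀ k, ‖c₀ k‖ ≤ 1 := fun k => by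
    rw [hn0]
    exact inv_le_one_of_one_le₀ (by nlinarith [sq_nonneg (k : ℝ)])
  have h1 : ∀ k, ‖c₁ k‖ ≤ 1 := fun k => by
    simp only [c₁]
    rw [norm_mul, hn0, Complex.norm_intCast, ← div_eq_mul_inv, div_le_one (by positivity)]
    nlinarith [sq_nonneg (|(k : ℝ)| - 1), sq_abs (k : ℝ), abs_nonneg (k : ℝ)]
  have h2 : ∀ k, ‖c₂ k‖ ≤ 1 := fun k => by
    simp only [c₂, c₁]
    rw [norm_mul, norm_mul, hn0, Complex.norm_intCast, ← mul_assoc, ← div_eq_mul_inv,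
      div_le_one (by positivity), abs_mul_abs_self]
    nlinarith
  refine ⟨gradedDiag τ c₁ ξ, gradedDiag τ c₂ ξ, ?_,
    gradedDiag_mem_dirac τ ⟨1, h1⟩ ⟨1, h2⟩ (fun _ => rfl) ξ, ?_⟩
  · rw [← mul_apply_eq_comp, hV.diag_mul hb0 hb0]
    exact gradedDiag_mem_dirac τ ⟨1, h0⟩ ⟨1, h1⟩ (fun _ => rfl) ξ
  · rw [← mul_apply_eq_comp, hV.diag_mul hb0 hb0, ← add_apply]
    have h3 : gradedDiag τ c₀ + gradedDiag τ c₂ = 1 := by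
      refine hV.ext_clm fun k v hv => ?_
      rw [add_apply, hV.diag_apply ⟨1, h0⟩ hv, hV.diag_apply ⟨1, h2⟩ hv, ← add_smul,
        one_apply_eq_self]
      have : c₀ k + c₂ k = 1 := by
        simp only [c₂, c₁]
        rw [hsq]
        have : (1 + (k : ℂ) ^ 2) ≠ 0 := by
          have : (1 + (k : ℝ) ^ 2) ≠ 0 := by positivity
          exact_mod_cast this
        push_cast
        field_simp
      rw [this, one_smul]
    change (gradedDiag τ c₀ + gradedDiag τ c₂) ξ = ξ
    rw [h3, one_apply_eq_self]

end Resolvent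

/-! ### The modular operator by degree -/

section Modular

theorem tomita_sub_mem : ∀ p ∈ tomita τ, ∀ q ∈ tomita τ, p - q ∈ tomita τ := by
  let G : AddSubgroup (Hilb τ × Hilb τ) :=
    { carrier := {p | ∃ a ∈ core n, p = (toHilb τ a, toHilb τ (star a))}
      add_mem' := by
        rintro _ _ ⟨a, ha, rfl⟩ ⟨b, hb, rfl⟩
        exact ⟨a + b, add_mem ha hb, by rw [star_add, toHilb_add, toHilb_add]; rfl⟩
      zero_mem' := ⟨0, zero_mem _, by rw [star_zero, toHilb_zero]; rfl⟩
      neg_mem' := by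
        rintro _ ⟨a, ha, rfl⟩
        refine ⟨-a, neg_mem ha, ?_⟩
        have h : ∀ b : Alg n, toHilb τ (-b) = -toHilb τ b := (toHilbₗ τ).map_neg
        rw [star_neg, h, h]
        rfl }
  exact fun p hp q hq => G.topologicalClosure.sub_mem hp hq

/-- The eigenvalue of `(1 + ε Δ)⁻¹` on the vectors of degree `k`. -/
def cutoff (n : ℕ) (ε : ℝ) (k : ℤ) : ℝ := (1 + ε * (n : ℝ) ^ (-k))⁻¹

variable {ε : ℝ} (hε : 0 < ε)

include hε

theorem cutoff_pos (k : ℤ) : 0 < cutoff n ε k := by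
  unfold cutoff
  positivity

theorem cutoff_le_one (k : ℤ) : cutoff n ε k ≤ 1 := by
  unfold cutoff
  exact inv_le_one_of_one_le₀ (by linarith [(by positivity : 0 ≤ ε * (n : ℝ) ^ (-k))])

theorem zpow_mul_cutoff_le (k : ℤ) : (n : ℝ) ^ (-k) * cutoff n ε k ≤ ε⁻¹ := by
  unfold cutoff
  have h : 0 ≤ (n : ℝ) ^ (-k) := by positivity
  rw [← div_eq_mul_inv, div_le_iff₀ (by positivity), inv_mul_eq_div, le_div_iff₀ hε]
  linarith [mul_comm ((n : ℝ) ^ (-k)) ε]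

/-- The KMS condition says that `Δ` is multiplication by `n^{-k}` in degree `k`. Since `Δ` is given
as `S*S` through graphs, the image of `(1 + ε Δ)⁻¹` has to be shown to lie in the domain of the
closure `S`. -/
theorem boundedApprox_modularOperator (hn : n ≠ 0) :
    boundedApprox (modularOperator τ) ε
      = gradedDiag τ fun k => (((n : ℝ) ^ (-k) * cutoff n ε k : ℝ) : ℂ) := by
  have hV := isOrthogonalDecomposition_component τ
  have hnpos : (0 : ℝ) < n := by exact_mod_cast Nat.pos_of_ne_zero hn
  have hbb : ∃ C, ∀ k, ‖((cutoff n ε k : ℝ) : ℂ)‖ ≤ C :=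
    exists_norm_le_of_nonneg_of_le (fun k => (cutoff_pos hε k).le) (cutoff_le_one hε)
  have hcb : ∃ C, ∀ k, ‖(((n : ℝ) ^ (-k) * cutoff n ε k : ℝ) : ℂ)‖ ≤ C :=
    exists_norm_le_of_nonneg_of_le
      (fun k => mul_nonneg (by positivity) (cutoff_pos hε k).le) (zpow_mul_cutoff_le hε)
  refine boundedApprox_antilinearStarMulSelf_eq (tomita_sub_mem τ) hε fun ξ => ?_
  set A := gradedDiag τ fun k => (((n : ℝ) ^ (-k) * cutoff n ε k : ℝ) : ℂ) with hA
  set B := gradedDiag τ fun k => ((cutoff n ε k : ℝ) : ℂ) with hB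
  have hAB : 1 - (ε : ℂ) • A = B := by
    refine hV.ext_clm fun k v hv => ?_
    rw [sub_apply, smul_apply, hV.diag_apply hbb hv, hV.diag_apply hcb hv, one_apply_eq_self,
      smul_smul]
    nth_rewrite 1 [← one_smul ℂ v]
    rw [← sub_smul]
    congr 1
    have hne : 1 + ε * (n : ℝ) ^ (-k) ≠ 0 := by positivity
    have : 1 - ε * ((n : ℝ) ^ (-k) * cutoff n ε k) = cutoff n ε k := by
      unfold cutoff
      generalize (n : ℝ) ^ (-k) = x at hne ⊢
      field_simp
      ring
    exact_mod_cast this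
  have hABξ : ξ - (ε : ℂ) • A ξ = B ξ := by
    rw [← hAB, sub_apply, smul_apply, one_apply_eq_self]
  -- The pairs `(ξ, η)` for which `η = S B ξ` witnesses `S*S (B ξ) = A ξ`. It must be shown that
  -- every `ξ` occurs; this relation is closed, bounded and defined on the core.
  let Z : Set (Hilb τ × Hilb τ) :=
    {p | (B p.1, p.2) ∈ tomita τ ∧ ∀ q ∈ tomita τ, ⟪q.1, A p.1⟫_ℂ = ⟪p.2, q.2⟫_ℂ}
  have hZcl : IsClosed Z := by
    refine IsClosed.inter (isClosed_closure.preimage (by fun_prop)) ?_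
    have : {p : Hilb τ × Hilb τ | ∀ q ∈ tomita τ, ⟪q.1, A p.1⟫_ℂ = ⟪p.2, q.2⟫_ℂ}
        = ⋂ q ∈ tomita τ, {p | ⟪q.1, A p.1⟫_ℂ = ⟪p.2, q.2⟫_ℂ} := by
      ext p
      simp
    change IsClosed {p : Hilb τ × Hilb τ | ∀ q ∈ tomita τ, ⟪q.1, A p.1⟫_ℂ = ⟪p.2, q.2⟫_ℂ}
    rw [this]
    exact isClosed_biInter fun q _ => isClosed_eq (by fun_prop) (by fun_prop)
  have hZsub : ∀ p ∈ Z, ∀ q ∈ Z, p - q ∈ Z := by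
    rintro p ⟨hp1, hp2⟩ q ⟨hq1, hq2⟩
    refine ⟨?_, fun r hr => ?_⟩
    · have := tomita_sub_mem τ _ hp1 _ hq1
      rwa [Prod.mk_sub_mk, ← map_sub] at this
    · rw [Prod.fst_sub, Prod.snd_sub, map_sub, inner_sub_left, inner_sub_right, hp2 r hr, hq2 r hr]
  -- Testing the defining identity on `(B ξ, η)` itself gives `‖η‖² = ⟨B ξ, A ξ⟩`.
  have hZb : ∀ p ∈ Z, ‖p.2‖ ≤ √(‖B‖ * ‖A‖) * ‖p.1‖ := by
    rintro p ⟨hp1, hp2⟩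
    have h := hp2 _ hp1
    have h1 : ‖p.2‖ ^ 2 ≤ (√(‖B‖ * ‖A‖) * ‖p.1‖) ^ 2 := by
      have h2 : ‖(⟪B p.1, A p.1⟫_ℂ)‖ = ‖p.2‖ ^ 2 := by
        rw [h]
        change ‖(⟪p.2, p.2⟫_ℂ)‖ = _
        rw [← ofReal_norm_sq, Complex.norm_real, Real.norm_of_nonneg (sq_nonneg _)]
      rw [← h2, mul_pow, Real.sq_sqrt (by positivity)]
      calc ‖(⟪B p.1, A p.1⟫_ℂ)‖ ≤ ‖B p.1‖ * ‖A p.1‖ := norm_inner_le_norm _ _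
        _ ≤ (‖B‖ * ‖p.1‖) * (‖A‖ * ‖p.1‖) := by
          gcongr
          · exact B.le_opNorm _
          · exact A.le_opNorm _
        _ = _ := by ring
    exact (sq_le_sq₀ (norm_nonneg _) (by positivity)).1 h1
  -- In degree `k`, `A a = n^{-k} B a`, and the KMS condition cancels `n^{-k}` against the `n^k`
  -- from exchanging the two factors.
  have hcore : ∀ a ∈ core n, ∃ a' ∈ core n, toHilb τ a' = B (toHilb τ a) ∧
      ∀ y : Alg n, kmsState τ (a' * y) = ⟪toHilb τ (star y), A (toHilb τ a)⟫_ℂ := by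
    intro a ha
    induction ha using Submodule.span_induction with
    | mem x h =>
      obtain ⟨⟨μ, ν⟩, rfl⟩ := h
      have hmem := word_mul_star_word_mem_homogeneous μ ν
      refine ⟨(cutoff n ε (μ.length - ν.length) : ℂ) • (word μ * star (word ν)),
        Submodule.smul_mem _ _ (word_mul_star_word_mem_core μ ν), ?_, fun y => ?_⟩
      · rw [toHilb_smul]
        exact (gradedDiag_toHilb τ hbb hmem).symm
      · rw [hA]
        change _ = ⟪toHilb τ (star y), gradedDiag τ _ (toHilb τ (word μ * star (word ν)))⟫_ℂ
        rw [gradedDiag_toHilb τ hcb hmem, inner_smul_right, inner_toHilb, star_star,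
          kmsState_mul_comm_word τ hn, smul_mul_assoc, map_smul, smul_eq_mul, ← mul_assoc]
        congr 1
        have hn' : (n : ℂ) ≠ 0 := by exact_mod_cast hn
        push_cast
        rw [mul_right_comm, zpow_neg, inv_mul_cancel₀ (zpow_ne_zero _ hn'), one_mul]
    | zero => exact ⟨0, zero_mem _, by simp [toHilb_zero], fun y => by simp [toHilb_zero]⟩
    | add x y _ _ hx hy =>
      obtain ⟨x', hx0, hx1, hx2⟩ := hx
      obtain ⟨y', hy0, hy1, hy2⟩ := hy
      refine ⟨x' + y', add_mem hx0 hy0, ?_, fun z => ?_⟩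
      · rw [toHilb_add, toHilb_add, map_add, hx1, hy1]
      · rw [add_mul, map_add, hx2, hy2, toHilb_add, map_add, inner_add_right]
    | smul c x _ hx =>
      obtain ⟨x', hx0, hx1, hx2⟩ := hx
      refine ⟨c • x', Submodule.smul_mem _ _ hx0, ?_, fun z => ?_⟩
      · rw [toHilb_smul, toHilb_smul, map_smul, hx1]
      · rw [smul_mul_assoc, map_smul, hx2, toHilb_smul, map_smul, inner_smul_right, smul_eq_mul]
  have hZdense : Dense (Prod.fst '' Z) := by
    refine (dense_toHilb_core τ).mono ?_
    rintro _ ⟨a, ha, rfl⟩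
    obtain ⟨a', ha'0, ha'1, ha'2⟩ := hcore a ha
    refine ⟨(toHilb τ a, toHilb τ (star a')), ⟨?_, fun q hq => ?_⟩, rfl⟩
    · refine subset_closure ⟨a', ha'0, ?_⟩
      rw [← ha'1]
    · have hcl : IsClosed {q : Hilb τ × Hilb τ |
          ⟪q.1, A (toHilb τ a)⟫_ℂ = ⟪toHilb τ (star a'), q.2⟫_ℂ} :=
        isClosed_eq (by fun_prop) (by fun_prop)
      refine hcl.closure_subset_iff.2 ?_ hq
      rintro _ ⟨x, -, rfl⟩
      change ⟪toHilb τ x, A (toHilb τ a)⟫_ℂ = ⟪toHilb τ (star a'), toHilb τ (star x)⟫_ℂ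
      rw [inner_toHilb, star_star, ha'2, star_star]
  obtain ⟨η, hη1, hη2⟩ := exists_mem_of_dense_of_norm_le hZcl hZsub hZb hZdense ξ
  exact ⟨η, by rw [hABξ]; exact hη1, hη2⟩

end Modular

end Cuntz

namespace Cuntz

open OperatorTheory

variable {n : ℕ} (τ : TracialState n)

/-! ### The weight `τ_Δ` as a sum of vector functionals -/

variable (n) in
/-- The elements of `O_n` whose vector functionals sum up to `τ_Δ`. -/
def weightElt : List (Fin n) × Bool → Alg n
  | (μ, false) => ((√((n : ℝ) ^ μ.length)⁻¹ : ℝ) : ℂ) • word μ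
  | (μ, true) => if μ = [] then 0 else star (word μ)

/-- The degree of `weightElt`. -/
def weightDeg : List (Fin n) × Bool → ℤ
  | (μ, false) => μ.length
  | (μ, true) => -μ.length

theorem weightElt_mem_homogeneous (i : List (Fin n) × Bool) :
    weightElt n i ∈ homogeneous n (weightDeg i) := by
  obtain ⟨μ, _ | _⟩ := i
  · exact Submodule.smul_mem _ _ (word_mem_homogeneous μ)
  · change (if μ = [] then 0 else star (word μ)) ∈ homogeneous n (-μ.length)
    split_ifs
    · exact zero_mem _
    · exact star_word_mem_homogeneous μ

/-- The vectors whose vector functionals sum up to `τ_Δ`. -/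
def weightVector (i : List (Fin n) × Bool) : Hilb τ := toHilb τ (weightElt n i)

theorem vectorWeight_smul (r : ℝ) (v : Hilb τ) (T : Hilb τ →L[ℂ] Hilb τ) :
    vectorWeight τ ((r : ℂ) • v) T = ENNReal.ofReal (r ^ 2) * vectorWeight τ v T := by
  unfold vectorWeight
  rw [map_smul, inner_smul_left, inner_smul_right, Complex.conj_ofReal, ← mul_assoc,
    ← Complex.ofReal_mul, Complex.re_ofReal_mul, ENNReal.ofReal_mul (mul_self_nonneg r), sq]

theorem vectorWeight_conj {S T : Hilb τ →L[ℂ] Hilb τ} (hS : star S = S) {r : ℝ} {v : Hilb τ}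
    (hv : S v = (r : ℂ) • v) :
    vectorWeight τ v (S * T * S) = ENNReal.ofReal (r ^ 2) * vectorWeight τ v T := by
  rw [← vectorWeight_smul, ← hv]
  unfold vectorWeight
  rw [mul_apply_eq_comp, mul_apply_eq_comp, ← ContinuousLinearMap.adjoint_inner_left,
    ← ContinuousLinearMap.star_eq_adjoint, hS]

/-- `Δ_ε^{1/2}` scales the squared norm in degree `k` by `n^{-k}` times the cutoff. This puts a
factor `n^{-|μ|}` on `S_μ` and cancels the factor `n^{-|μ|}` that `τ̃` attaches to `S_μ*`. -/
theorem tildeTrace_sqrt_boundedApprox (hn : n ≠ 0) {ε : ℝ} (hε : 0 < ε)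
    (T : Hilb τ →L[ℂ] Hilb τ) :
    tildeTrace τ (CFC.sqrt (boundedApprox (modularOperator τ) ε) * T *
        CFC.sqrt (boundedApprox (modularOperator τ) ε))
      = ∑' i : List (Fin n) × Bool,
        ENNReal.ofReal (cutoff n ε (weightDeg i)) * vectorWeight τ (weightVector τ i) T := by
  have hV := isOrthogonalDecomposition_component τ
  have hnpos : (0 : ℝ) < n := by exact_mod_cast Nat.pos_of_ne_zero hn
  have h0 : ∀ k : ℤ, 0 ≤ (n : ℝ) ^ (-k) * cutoff n ε k :=
    fun k => mul_nonneg (by positivity) (cutoff_pos hε k).le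
  rw [boundedApprox_modularOperator τ hε hn, hV.sqrt_diag ⟨_, zpow_mul_cutoff_le hε⟩ h0]
  have hb : ∃ C, ∀ k : ℤ, ‖((√((n : ℝ) ^ (-k) * cutoff n ε k) : ℝ) : ℂ)‖ ≤ C :=
    exists_norm_le_of_nonneg_of_le (fun k => Real.sqrt_nonneg _)
      fun k => Real.sqrt_le_sqrt (zpow_mul_cutoff_le hε k)
  set S := diag (component τ) fun k => ((√((n : ℝ) ^ (-k) * cutoff n ε k) : ℝ) : ℂ) with hS
  have hSstar : star S = S := by
    rw [hS, hV.star_diag hb]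
    congr 1
    funext k
    rw [Complex.star_def, Complex.conj_ofReal]
  have key : ∀ {k : ℤ} {a : Alg n}, a ∈ homogeneous n k →
      vectorWeight τ (toHilb τ a) (S * T * S)
        = ENNReal.ofReal ((n : ℝ) ^ (-k) * cutoff n ε k) * vectorWeight τ (toHilb τ a) T := by
    intro k a ha
    rw [vectorWeight_conj τ hSstar (gradedDiag_toHilb τ hb ha), Real.sq_sqrt (h0 k)]
  rw [ENNReal.tsum_prod (f := fun μ b => ENNReal.ofReal (cutoff n ε (weightDeg (μ, b))) *
    vectorWeight τ (weightVector τ (μ, b)) T)]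
  unfold tildeTrace
  refine tsum_congr fun μ => ?_
  rw [tsum_bool]
  have hfalse : ENNReal.ofReal (cutoff n ε (weightDeg (μ, false))) *
      vectorWeight τ (weightVector τ (μ, false)) T
      = vectorWeight τ (toHilb τ (word μ)) (S * T * S) := by
    change ENNReal.ofReal (cutoff n ε μ.length) * vectorWeight τ
      (toHilb τ (((√((n : ℝ) ^ μ.length)⁻¹ : ℝ) : ℂ) • word μ)) T = _
    rw [key (word_mem_homogeneous μ), toHilb_smul, vectorWeight_smul,
      Real.sq_sqrt (by positivity), ← mul_assoc, ← ENNReal.ofReal_mul (cutoff_pos hε _).le,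
      zpow_neg, zpow_natCast, mul_comm (cutoff n ε _)]
  rw [hfalse]
  split_ifs with hμ
  -- The empty word contributes a single functional; its second index carries the zero vector.
  · subst hμ
    have htrue : weightVector τ (([] : List (Fin n)), true) = 0 := by
      change toHilb τ (if ([] : List (Fin n)) = [] then 0 else star (word [])) = 0
      rw [if_pos rfl, toHilb_zero]
    rw [htrue, word_nil]
    simp [vectorWeight]
  · have htrue : weightVector τ (μ, true) = toHilb τ (star (word μ)) := by
      change toHilb τ (if μ = [] then 0 else star (word μ)) = _
      rw [if_neg hμ]
    rw [htrue, key (star_word_mem_homogeneous μ), ← mul_assoc]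
    congr 2
    change _ = ENNReal.ofReal (cutoff n ε (-μ.length))
    have hn2 : ((n : ℝ≥0∞) ^ μ.length)⁻¹ = ENNReal.ofReal (((n : ℝ) ^ μ.length)⁻¹) := by
      rw [ENNReal.ofReal_inv_of_pos (by positivity), ENNReal.ofReal_pow (by positivity),
        ENNReal.ofReal_natCast]
    rw [hn2, ← ENNReal.ofReal_mul (by positivity), neg_neg, zpow_natCast, ← mul_assoc,
      inv_mul_cancel₀ (by positivity), one_mul]

/-- The cutoffs are at most one and tend to one as `ε ↓ 0`. One inequality is termwise, the other
holds for finite partial sums. -/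
theorem tauDelta_eq (hn : n ≠ 0) : tauDelta τ = vectorSumWeight (weightVector τ) := by
  funext T
  unfold tauDelta weightOfTrace vectorSumWeight
  apply le_antisymm
  · refine iSup₂_le fun ε hε => ?_
    rw [tildeTrace_sqrt_boundedApprox τ hn hε]
    refine ENNReal.tsum_le_tsum fun i => ?_
    calc _ ≤ 1 * vectorWeight τ (weightVector τ i) T := by
          gcongr
          exact ENNReal.ofReal_le_one.2 (cutoff_le_one hε _)
      _ = _ := one_mul _
  · rw [ENNReal.tsum_eq_iSup_sum]
    refine iSup_le fun s => ?_
    have hlim : Filter.Tendsto (fun ε : ℝ => ∑ i ∈ s,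
        ENNReal.ofReal (cutoff n ε (weightDeg i)) * vectorWeight τ (weightVector τ i) T)
        (nhdsWithin 0 (Set.Ioi 0)) (nhds (∑ i ∈ s, vectorWeight τ (weightVector τ i) T)) := by
      refine tendsto_finsetSum s fun i _ => ?_
      have h1 : Filter.Tendsto (fun ε : ℝ => cutoff n ε (weightDeg i)) (nhds 0) (nhds 1) := by
        have : ContinuousAt (fun ε : ℝ => (1 + ε * (n : ℝ) ^ (-(weightDeg i)))⁻¹) 0 :=
          ContinuousAt.inv₀ (by fun_prop) (by simp)
        simpa [ContinuousAt, cutoff] using this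
      have h2 := ENNReal.tendsto_ofReal 
        (h1.mono_left (nhdsWithin_le_nhds (s := Set.Ioi 0)))
      have h3 := ENNReal.Tendsto.mul_const (b := vectorWeight τ (weightVector τ i) T) h2
        (Or.inl (by simp))
      simpa using h3
    refine le_of_tendsto hlim ?_
    filter_upwards [self_mem_nhdsWithin] with ε hε
    refine le_trans ?_ (le_iSup₂ ε hε)
    rw [tildeTrace_sqrt_boundedApprox τ hn hε]
    exact ENNReal.sum_le_tsum s

/-! ### Right multiplication by gauge-invariant elements -/

theorem gauge_nonneg (z : Circle) {a : Alg n} (ha : 0 ≤ a) : 0 ≤ gauge z a :=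
  map_nonneg (gauge z) ha

theorem sqrt_mem_fixedAlg {a : Alg n} (ha : a ∈ fixedAlg n) (h0 : 0 ≤ a) :
    CFC.sqrt a ∈ fixedAlg n := fun z => by
  refine (CFC.sqrt_unique ?_ (gauge_nonneg z (CFC.sqrt_nonneg a))).symm
  rw [← map_mul, CFC.sqrt_mul_sqrt_self a h0, ha z]

/-- With `X = Φ(a* a)`, traciality on `F` turns `φ(b* a* a b) = τ(b* X b)` into `τ(X^{1/2} b b*
X^{1/2})`, which is at most `‖b‖² τ(X)`. -/
theorem norm_toHilb_mul_le {b : Alg n} (hb : b ∈ fixedAlg n) (a : Alg n) :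
    ‖toHilb τ (a * b)‖ ≤ ‖b‖ * ‖toHilb τ a‖ := by
  set X := gaugeMean (star a * a) with hX
  have hX0 : 0 ≤ X := gaugeMean_nonneg (star_mul_self_nonneg a)
  have hXF : X ∈ fixedAlg n := gaugeMean_mem _
  set s := CFC.sqrt X with hs
  have hsF : s ∈ fixedAlg n := sqrt_mem_fixedAlg hXF hX0
  have hss : s * s = X := CFC.sqrt_mul_sqrt_self X hX0
  have hsstar : star s = s := (IsSelfAdjoint.of_nonneg (CFC.sqrt_nonneg X)).star_eq
  have hφ : ∀ y : Alg n, kmsState τ (gaugeMean y) = kmsState τ y := fun y => by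
    rw [← expect_coe, kmsState_coe, kmsState_apply]
  have h1 : kmsState τ (star (a * b) * (a * b)) = kmsState τ (star s * (b * star b) * s) := by
    rw [← hφ (star (a * b) * (a * b)), star_mul]
    have e : star b * star a * (a * b) = star b * (star a * a) * b := by simp only [mul_assoc]
    rw [e, gaugeMean_mul_right hb, gaugeMean_mul_left (star_mem hb), ← hX, ← hss, hsstar]
    have e2 : star b * (s * s) * b = (star b * s) * (s * b) := by simp only [mul_assoc]
    rw [e2, kmsState_mul_comm_of_mem_fixedAlg τ (mul_mem hsF hb)]
    simp only [mul_assoc]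
  have h2 : star s * (b * star b) * s ≤ ‖b * star b‖ • (star s * s) :=
    CStarAlgebra.star_left_conjugate_le_norm_smul (.mul_star_self b)
  have h3 : kmsState τ (star s * (b * star b) * s) ≤ kmsState τ (‖b * star b‖ • (star s * s)) :=
    OrderHomClass.mono (kmsState τ) h2
  have h4 : kmsState τ (‖b * star b‖ • (star s * s))
      = ((‖b‖ ^ 2 : ℝ) : ℂ) * kmsState τ (star a * a) := by
    rw [CStarRing.norm_self_mul_star, hsstar, hss, ← sq, ← Complex.coe_smul, map_smul, hX, hφ,
      smul_eq_mul]
  rw [← h1, h4, ← inner_toHilb, ← inner_toHilb, ← ofReal_norm_sq, ← ofReal_norm_sq,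
    ← Complex.ofReal_mul, Complex.real_le_real, ← mul_pow] at h3
  exact (sq_le_sq₀ (norm_nonneg _) (by positivity)).1 h3

/-- Right multiplication by a gauge-invariant element, as a bounded operator. -/
def rightMul (b : fixedAlg n) : Hilb τ →L[ℂ] Hilb τ :=
  (toHilbₗ τ ∘ₗ LinearMap.mulRight ℂ (b : Alg n)).extendOfNorm (toHilbₗ τ)

theorem rightMul_toHilb (b : fixedAlg n) (a : Alg n) :
    rightMul τ b (toHilb τ a) = toHilb τ (a * b) :=
  LinearMap.extendOfNorm_eq (f := toHilbₗ τ ∘ₗ LinearMap.mulRight ℂ (b : Alg n))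
    (e := toHilbₗ τ) (denseRange_toHilb τ) ⟨_, norm_toHilb_mul_le τ b.2⟩ a

theorem ext_toHilb {A B : Hilb τ →L[ℂ] Hilb τ} (h : ∀ a, A (toHilb τ a) = B (toHilb τ a)) :
    A = B :=
  ContinuousLinearMap.coeFn_injective
    ((denseRange_toHilb τ).equalizer A.continuous B.continuous (funext h))

/-- Elements of `F` commute with everything under `φ`; for factors outside `F` the modular scaling
would intervene. -/
theorem star_rightMul (b : fixedAlg n) : star (rightMul τ b) = rightMul τ (star b) := by
  rw [ContinuousLinearMap.star_eq_adjoint]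
  symm
  rw [ContinuousLinearMap.eq_adjoint_iff]
  intro x y
  refine (denseRange_toHilb τ).induction_on₂ (p := fun x y =>
    ⟪rightMul τ (star b) x, y⟫_ℂ = ⟪x, rightMul τ b y⟫_ℂ)
    (isClosed_eq (by fun_prop) (by fun_prop)) (fun a c => ?_) x y
  rw [rightMul_toHilb, rightMul_toHilb, inner_toHilb, inner_toHilb, star_mul, ← mul_assoc,
    kmsState_mul_comm_of_mem_fixedAlg τ b.2, ← mul_assoc]
  congr 3
  exact star_star (b : Alg n)

/-- `Φ` is right `F`-linear, hence so is `z ↦ x Φ(y* z)`. -/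
theorem rightMul_commute_of_isRankOne {x y : Alg n} {T : Hilb τ →L[ℂ] Hilb τ}
    (hT : IsRankOne τ x y T) (b : fixedAlg n) : T * rightMul τ b = rightMul τ b * T := by
  have hmean : Continuous (gaugeMean : Alg n → Alg n) :=
    AddMonoidHomClass.continuous_of_bound ((fixedAlg n).subtype.toLinearMap ∘ₗ expect n) 1
      fun a => by rw [one_mul]; exact norm_gaugeMean_le a
  -- The defining formula is given on the core only and extends by continuity of `Φ`.
  have hall : ∀ z : Alg n, T (toHilb τ z) = toHilb τ (x * gaugeMean (star y * z)) := by
    intro z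
    have hcl : IsClosed {z : Alg n | T (toHilb τ z) = toHilb τ (x * gaugeMean (star y * z))} :=
      isClosed_eq (T.continuous.comp (continuous_toHilb τ))
        ((continuous_toHilb τ).comp
          (continuous_const.mul (hmean.comp (continuous_const.mul continuous_id))))
    exact hcl.closure_subset_iff.2 (fun z hz => hT z hz) (dense_core z)
  refine ext_toHilb τ fun a => ?_
  rw [mul_apply_eq_comp, mul_apply_eq_comp, rightMul_toHilb, hall, hall, rightMul_toHilb,
    ← mul_assoc, gaugeMean_mul_right b.2, mul_assoc]

theorem rightMul_mem_centralizer (b : fixedAlg n) :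
    rightMul τ b ∈ StarSubalgebra.centralizer ℂ (finiteRank τ : Set (Hilb τ →L[ℂ] Hilb τ)) := by
  rw [StarSubalgebra.mem_centralizer_iff]
  have h1 : ∀ (b : fixedAlg n), ∀ T ∈ finiteRank τ, T * rightMul τ b = rightMul τ b * T := by
    intro b T hT
    induction hT using Submodule.span_induction with
    | mem T h =>
      obtain ⟨x, -, y, -, hxy⟩ := h
      exact rightMul_commute_of_isRankOne τ hxy b
    | zero => rw [zero_mul, mul_zero]
    | add x y _ _ hx hy => rw [add_mul, mul_add, hx, hy]
    | smul c x _ hx => rw [smul_mul_assoc, mul_smul_comm, hx]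
  refine fun T hT => ⟨h1 b T hT, ?_⟩
  have h := congrArg star (h1 (star b) T hT)
  rw [star_mul, star_mul, star_rightMul, star_star] at h
  exact h.symm

/-! ### The von Neumann algebra `𝒩` -/

theorem mem_vN_iff {x : Hilb τ →L[ℂ] Hilb τ} : x ∈ (vN τ).toStarSubalgebra ↔
    ∀ z ∈ StarSubalgebra.centralizer ℂ (finiteRank τ : Set (Hilb τ →L[ℂ] Hilb τ)),
      z * x = x * z := by
  change x ∈ StarSubalgebra.centralizer ℂ
    (StarSubalgebra.centralizer ℂ (finiteRank τ : Set (Hilb τ →L[ℂ] Hilb τ)) :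
      Set (Hilb τ →L[ℂ] Hilb τ)) ↔ _
  rw [StarSubalgebra.mem_centralizer_iff]
  exact ⟨fun h z hz => (h z hz).1, fun h z hz => ⟨h z hz, h _ (star_mem hz)⟩⟩

theorem rightMul_commute_of_mem_vN {x : Hilb τ →L[ℂ] Hilb τ}
    (hx : x ∈ (vN τ).toStarSubalgebra) (b : fixedAlg n) :
    rightMul τ b * x = x * rightMul τ b :=
  (mem_vN_iff τ).1 hx _ (rightMul_mem_centralizer τ b)

/-- Moves a right factor from `F` across an element of `𝒩` to the other side of the inner product;
this drives the centralizer computation. -/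
theorem inner_toHilb_mul_of_mem_vN {x : Hilb τ →L[ℂ] Hilb τ}
    (hx : x ∈ (vN τ).toStarSubalgebra) {b : Alg n} (hb : b ∈ fixedAlg n) (u w : Alg n) :
    ⟪toHilb τ u, x (toHilb τ (w * b))⟫_ℂ = ⟪toHilb τ (u * star b), x (toHilb τ w)⟫_ℂ := by
  have h1 := rightMul_toHilb τ ⟨b, hb⟩ w
  have h2 := rightMul_toHilb τ (star ⟨b, hb⟩) u
  have h3 := congrArg (fun T : Hilb τ →L[ℂ] Hilb τ => T (toHilb τ w))
    (rightMul_commute_of_mem_vN τ hx ⟨b, hb⟩)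
  simp only [mul_apply_eq_comp] at h3
  change rightMul τ ⟨b, hb⟩ (toHilb τ w) = toHilb τ (w * b) at h1
  change rightMul τ (star ⟨b, hb⟩) (toHilb τ u) = toHilb τ (u * star b) at h2
  rw [← h1, ← h2, ← h3, ← star_rightMul, ContinuousLinearMap.star_eq_adjoint,
    ContinuousLinearMap.adjoint_inner_left]

/-- The projection onto the vectors of degree `k`. -/
def degreeProj (k : ℤ) : Hilb τ →L[ℂ] Hilb τ := gradedDiag τ fun l => if l = k then 1 else 0

theorem degreeProj_bound (k : ℤ) : ∃ C, ∀ l : ℤ, ‖(if l = k then 1 else 0 : ℂ)‖ ≤ C :=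
  ⟨1, fun l => by split_ifs <;> simp⟩

theorem degreeProj_toHilb_self {k : ℤ} {a : Alg n} (ha : a ∈ homogeneous n k) :
    degreeProj τ k (toHilb τ a) = toHilb τ a := by
  rw [degreeProj, gradedDiag_toHilb τ (degreeProj_bound k) ha, if_pos rfl, one_smul]

theorem degreeProj_toHilb_of_ne {k l : ℤ} (h : l ≠ k) {a : Alg n} (ha : a ∈ homogeneous n l) :
    degreeProj τ k (toHilb τ a) = 0 := by
  rw [degreeProj, gradedDiag_toHilb τ (degreeProj_bound k) ha, if_neg h, zero_smul]

theorem star_degreeProj (k : ℤ) : star (degreeProj τ k) = degreeProj τ k := by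
  rw [degreeProj, (isOrthogonalDecomposition_component τ).star_diag (degreeProj_bound k)]
  congr 1
  funext l
  split_ifs <;> simp

/-- Operators are determined by their restrictions to the vectors of fixed degree. -/
theorem ext_mul_degreeProj {A B : Hilb τ →L[ℂ] Hilb τ}
    (h : ∀ k, A * degreeProj τ k = B * degreeProj τ k) : A = B := by
  refine (isOrthogonalDecomposition_component τ).ext_clm ?_
  rintro k _ ⟨a, ha, rfl⟩
  have := congrArg (fun T : Hilb τ →L[ℂ] Hilb τ => T (toHilb τ a)) (h k)
  simp only [mul_apply_eq_comp, degreeProj_toHilb_self τ ha] at this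
  exact this

theorem gradedDiag_mul_degreeProj {c : ℤ → ℂ} (hc : ∃ C, ∀ i, ‖c i‖ ≤ C) (k : ℤ) :
    gradedDiag τ c * degreeProj τ k = c k • degreeProj τ k := by
  refine (isOrthogonalDecomposition_component τ).ext_clm ?_
  rintro l _ ⟨a, ha, rfl⟩
  rw [toHilbₗ_apply, mul_apply_eq_comp, smul_apply]
  rcases eq_or_ne l k with rfl | h
  · rw [degreeProj_toHilb_self τ ha, gradedDiag_toHilb τ hc ha]
  · rw [degreeProj_toHilb_of_ne τ h ha, map_zero, smul_zero]

theorem rep_commute_gradedDiag {c : ℤ → ℂ} (hc : ∃ C, ∀ i, ‖c i‖ ≤ C) {f : Alg n}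
    (hf : f ∈ fixedAlg n) : rep τ f * gradedDiag τ c = gradedDiag τ c * rep τ f := by
  refine (isOrthogonalDecomposition_component τ).ext_clm ?_
  rintro l _ ⟨a, ha, rfl⟩
  have hfa : f * a ∈ homogeneous n l := by
    have := mul_mem_homogeneous (mem_homogeneous_zero_iff.2 hf) ha
    rwa [zero_add] at this
  rw [toHilbₗ_apply, mul_apply_eq_comp, mul_apply_eq_comp, gradedDiag_toHilb τ hc ha, map_smul,
    rep_toHilb, gradedDiag_toHilb τ hc hfa]

/-- When `y` has degree `k`, `Φ(y* z)` is `y*` times the degree `k` part of `z`, so `Θ_{x,y} = x y*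
Φ_k`. -/
theorem rep_mul_degreeProj_mem_finiteRank {k : ℤ} {x y : Alg n} (hx : x ∈ core n)
    (hy : y ∈ core n) (hyk : y ∈ homogeneous n k) :
    rep τ (x * star y) * degreeProj τ k ∈ finiteRank τ := by
  refine Submodule.subset_span ⟨x, hx, y, hy, fun z hz => ?_⟩
  induction hz using Submodule.span_induction with
  | mem z h =>
    obtain ⟨⟨μ, ν⟩, rfl⟩ := h
    change _ = toHilb τ (x * gaugeMean (star y * (word μ * star (word ν))))
    have hm := word_mul_star_word_mem_homogeneous μ ν
    have hm2 := mul_mem_homogeneous (star_mem_homogeneous hyk) hm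
    rw [mul_apply_eq_comp]
    by_cases h : (μ.length : ℤ) - ν.length = k
    · rw [h] at hm hm2
      rw [neg_add_cancel] at hm2
      rw [degreeProj_toHilb_self τ hm, rep_toHilb,
        gaugeMean_of_mem_fixedAlg (mem_homogeneous_zero_iff.1 hm2), mul_assoc]
    · rw [degreeProj_toHilb_of_ne τ h hm, map_zero, gaugeMean_of_mem_homogeneous _ hm2, mul_zero,
        toHilb_zero]
      omega
  | zero => simp [toHilb_zero]
  | add a b _ _ ha hb =>
    rw [toHilb_add, map_add, ha, hb, mul_add (star y), map_add, ← toHilb_add, ← mul_add]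
    rfl
  | smul c a _ ha =>
    rw [toHilb_smul, map_smul, ha, mul_smul_comm, map_smul, ← toHilb_smul, ← mul_smul_comm]
    rfl

/-- The unit is a finite sum of products `y y*` with `y` in the core of the prescribed degree: the
sum of `S_μ S_μ*` over words of length `j` in degree `j ≥ 0`, and `S_μ* S_μ` for a single word in
degree `-j`. -/
theorem rep_mul_degreeProj_mem_finiteRank_of_mem_core (hn : n ≠ 0) (k : ℤ) {a : Alg n}
    (ha : a ∈ core n) : rep τ a * degreeProj τ k ∈ finiteRank τ := by
  obtain ⟨j, rfl | rfl⟩ := k.eq_nat_or_neg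
  · have h : rep τ a * degreeProj τ j
        = ∑ μ ∈ words n j, rep τ (a * word μ * star (word μ)) * degreeProj τ j := by
      rw [← Finset.sum_mul, ← map_sum]
      simp_rw [mul_assoc a]
      rw [← Finset.mul_sum, sum_word_mul_star_word, mul_one]
    rw [h]
    refine Submodule.sum_mem _ fun μ hμ => ?_
    refine rep_mul_degreeProj_mem_finiteRank τ (mul_mem_core ha (word_mem_core μ))
      (word_mem_core μ) ?_
    rw [mem_words] at hμ
    rw [← hμ]
    exact word_mem_homogeneous μ
  · let μ : List (Fin n) := List.replicate j ⟨0, Nat.pos_of_ne_zero hn⟩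
    have hμ : μ.length = j := by simp [μ]
    have h : a = a * star (word μ) * star (star (word μ)) := by
      rw [star_star, mul_assoc, star_word_mul_word, mul_one]
    rw [h]
    refine rep_mul_degreeProj_mem_finiteRank τ (mul_mem_core ha (star_word_mem_core μ))
      (star_word_mem_core μ) ?_
    rw [← hμ]
    exact star_word_mem_homogeneous μ

theorem rep_mul_degreeProj_mem_vN (hn : n ≠ 0) (k : ℤ) (a : Alg n) :
    rep τ a * degreeProj τ k ∈ (vN τ).toStarSubalgebra := by
  rw [mem_vN_iff]
  intro z hz
  have hrep : Continuous (rep τ) :=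
    AddMonoidHomClass.continuous_of_bound (rep τ) 1 fun a => by
      rw [one_mul]; exact norm_rep_le τ a
  have hcl : IsClosed {a : Alg n | z * (rep τ a * degreeProj τ k)
      = rep τ a * degreeProj τ k * z} :=
    isClosed_eq (continuous_const.mul (hrep.mul continuous_const))
      ((hrep.mul continuous_const).mul continuous_const)
  refine hcl.closure_subset_iff.2 (fun a ha => ?_) (dense_core a)
  rw [StarSubalgebra.mem_centralizer_iff] at hz
  exact (hz _ (rep_mul_degreeProj_mem_finiteRank_of_mem_core τ hn k ha)).1.symm

theorem degreeProj_mem_vN (hn : n ≠ 0) (k : ℤ) :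
    degreeProj τ k ∈ (vN τ).toStarSubalgebra := by
  have h := rep_mul_degreeProj_mem_vN τ hn k 1
  rwa [map_one, one_mul] at h

/-- Commutation with the commutant can be tested after multiplying by each `Φ_k`, because the `Φ_k`
themselves lie in `𝒩`. No strong limit is taken. -/
theorem mem_vN_of_mul_degreeProj (hn : n ≠ 0) {T : Hilb τ →L[ℂ] Hilb τ}
    (h : ∀ k, T * degreeProj τ k ∈ (vN τ).toStarSubalgebra) : T ∈ (vN τ).toStarSubalgebra := by
  rw [mem_vN_iff]
  intro z hz
  refine ext_mul_degreeProj τ fun k => ?_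
  have h1 := (mem_vN_iff τ).1 (h k) z hz
  have h2 := (mem_vN_iff τ).1 (degreeProj_mem_vN τ hn k) z hz
  rw [mul_assoc, h1, mul_assoc T z, h2, ← mul_assoc]

end Cuntz

namespace Cuntz

open OperatorTheory

variable {n : ℕ} (τ : TracialState n)

/-! ### The weight on the operators `f Φ_k` and the centralizer -/

theorem weightVector_false (μ : List (Fin n)) : weightVector τ (μ, false)
    = ((√((n : ℝ) ^ μ.length)⁻¹ : ℝ) : ℂ) • toHilb τ (word μ) := toHilb_smul τ _ _

theorem weightVector_true {μ : List (Fin n)} (h : μ ≠ []) :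
    weightVector τ (μ, true) = toHilb τ (star (word μ)) := by
  change toHilb τ (if μ = [] then 0 else star (word μ)) = _
  rw [if_neg h]

theorem weightVector_nil_true : weightVector τ (([] : List (Fin n)), true) = 0 := by
  change toHilb τ (if ([] : List (Fin n)) = [] then 0 else star (word [])) = 0
  rw [if_pos rfl, toHilb_zero]

/-- The index `([], true)` also has degree `0`; `hnil` removes it so that degree zero is not counted
twice. -/
theorem hasSum_of_weightDeg_nat {g : List (Fin n) × Bool → ℂ} {j : ℕ}
    (h0 : ∀ i, weightDeg i ≠ j → g i = 0) (hnil : g ([], true) = 0) :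
    HasSum g (∑ μ ∈ words n j, g (μ, false)) := by
  have h : HasSum g (∑ i ∈ words n j ×ˢ {false}, g i) := by
    refine hasSum_sum_of_ne_finset_zero fun i hi => ?_
    obtain ⟨μ, _ | _⟩ := i
    · refine h0 _ fun he => hi ?_
      have : (μ.length : ℤ) = j := he
      simp only [Finset.mem_product, mem_words, Finset.mem_singleton, and_true]
      omega
    · by_cases hμ : μ = []
      · rw [hμ, hnil]
      · refine h0 _ fun he => hμ ?_
        have : (-μ.length : ℤ) = j := he
        exact List.length_eq_zero_iff.1 (by omega)
  rwa [Finset.sum_product, Finset.sum_congr rfl fun μ _ => Finset.sum_singleton _ _] at h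

theorem hasSum_of_weightDeg_neg {g : List (Fin n) × Bool → ℂ} {j : ℕ} (hj : j ≠ 0)
    (h0 : ∀ i, weightDeg i ≠ -(j : ℤ) → g i = 0) :
    HasSum g (∑ μ ∈ words n j, g (μ, true)) := by
  have h : HasSum g (∑ i ∈ words n j ×ˢ {true}, g i) := by
    refine hasSum_sum_of_ne_finset_zero fun i hi => ?_
    obtain ⟨μ, _ | _⟩ := i
    · refine h0 _ fun he => ?_
      have : (μ.length : ℤ) = -j := he
      omega
    · refine h0 _ fun he => hi ?_
      have : (-μ.length : ℤ) = -j := he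
      simp only [Finset.mem_product, mem_words, Finset.mem_singleton, and_true]
      omega
  rwa [Finset.sum_product, Finset.sum_congr rfl fun μ _ => Finset.sum_singleton _ _] at h

theorem rep_mul_degreeProj_weightVector_of_ne (f : Alg n) {k : ℤ} {i : List (Fin n) × Bool}
    (h : weightDeg i ≠ k) : (rep τ f * degreeProj τ k) (weightVector τ i) = 0 := by
  rw [mul_apply_eq_comp, weightVector,
    degreeProj_toHilb_of_ne τ h (weightElt_mem_homogeneous i), map_zero]

theorem star_rep_mul_degreeProj {f : Alg n} (hf : f ∈ fixedAlg n) (k : ℤ) :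
    star (rep τ f * degreeProj τ k) = rep τ (star f) * degreeProj τ k := by
  rw [star_mul, star_degreeProj, ← map_star, degreeProj,
    rep_commute_gradedDiag τ (degreeProj_bound k) (star_mem hf)]

/-- Only the finitely many weight vectors of degree `k` contribute. -/
theorem sqIntegrable_rep_mul_degreeProj (f : Alg n) (k : ℤ) :
    SqIntegrable (weightVector τ) (rep τ f * degreeProj τ k) := by
  refine summable_of_ne_finset_zero (s := words n k.natAbs ×ˢ Finset.univ) fun i hi => ?_
  rw [rep_mul_degreeProj_weightVector_of_ne, norm_zero]
  · simp
  · rintro rfl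
    apply hi
    obtain ⟨μ, _ | _⟩ := i <;> simp [weightDeg]

theorem inner_weightVector_false {μ : List (Fin n)} (A B : Hilb τ →L[ℂ] Hilb τ) :
    ⟪A (weightVector τ (μ, false)), B (weightVector τ (μ, false))⟫_ℂ
      = ((n : ℂ) ^ μ.length)⁻¹ * ⟪A (toHilb τ (word μ)), B (toHilb τ (word μ))⟫_ℂ := by
  rw [weightVector_false, map_smul, map_smul, inner_smul_left, inner_smul_right, ← mul_assoc,
    Complex.conj_ofReal, ← Complex.ofReal_mul, Real.mul_self_sqrt (by positivity)]
  push_cast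
  rfl

/-- `∑ᵢ ⟨ξᵢ, f Φ_k ξᵢ⟩ = τ(f)`. -/
theorem hasSum_inner_rep_mul_degreeProj (hn : n ≠ 0) (f : Alg n) (k : ℤ) :
    HasSum (fun i => ⟪weightVector τ i, (rep τ f * degreeProj τ k) (weightVector τ i)⟫_ℂ)
      (kmsState τ f) := by
  have hn' : (n : ℂ) ≠ 0 := by exact_mod_cast hn
  have h0 : ∀ i, weightDeg i ≠ k →
      ⟪weightVector τ i, (rep τ f * degreeProj τ k) (weightVector τ i)⟫_ℂ = 0 := fun i hi => by
    rw [rep_mul_degreeProj_weightVector_of_ne τ f hi, inner_zero_right]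
  have hfin : ∀ j : ℕ, kmsState τ f
      = ∑ μ ∈ words n j, kmsState τ (f * (word μ * star (word μ))) := fun j => by
    rw [← map_sum, ← Finset.mul_sum, sum_word_mul_star_word, mul_one]
  have hcase : (∃ j : ℕ, k = j) ∨ ∃ j : ℕ, j ≠ 0 ∧ k = -(j : ℤ) := by
    rcases le_or_gt 0 k with h | h
    · exact Or.inl ⟨k.toNat, by omega⟩
    · exact Or.inr ⟨(-k).toNat, by omega, by omega⟩
  obtain ⟨j, rfl⟩ | ⟨j, hj, rfl⟩ := hcase
  · convert hasSum_of_weightDeg_nat h0 (by rw [weightVector_nil_true, inner_zero_left]) using 1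
    rw [hfin j]
    refine Finset.sum_congr rfl fun μ hμ => ?_
    have hμ' : μ.length = j := mem_words.1 hμ
    have h1 := inner_weightVector_false τ (μ := μ) 1 (rep τ f * degreeProj τ j)
    simp only [one_apply_eq_self] at h1
    have h2 := word_mem_homogeneous μ
    rw [hμ'] at h2
    -- The factor `n^j` from moving `S_μ*` past the state cancels the normalisation `n^{-j}`, and
    -- the `S_μ S_μ*` then sum to one.
    rw [h1, mul_apply_eq_comp, degreeProj_toHilb_self τ h2, rep_toHilb, inner_toHilb,
      kmsState_star_word_mul τ hn, inv_mul_cancel_left₀ (pow_ne_zero _ hn'), mul_assoc]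
  · convert hasSum_of_weightDeg_neg hj h0 using 1
    -- In negative degree each of the `n^j` words contributes the same amount `n^{-j} φ(f)`.
    have hcard : kmsState τ f = ∑ μ ∈ words n j, ((n : ℂ) ^ j)⁻¹ * kmsState τ f := by
      rw [Finset.sum_const, card_words, nsmul_eq_mul, ← mul_assoc, Nat.cast_pow,
        mul_inv_cancel₀ (pow_ne_zero _ hn'), one_mul]
    rw [hcard]
    refine Finset.sum_congr rfl fun μ hμ => ?_
    have hμ' : μ.length = j := mem_words.1 hμ
    have hne : μ ≠ [] := by rintro rfl; exact hj (by simpa using hμ'.symm)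
    have h2 := star_word_mem_homogeneous μ
    rw [hμ'] at h2
    rw [weightVector_true τ hne, mul_apply_eq_comp, degreeProj_toHilb_self τ h2, rep_toHilb,
      inner_toHilb, star_star]
    have h3 := kmsState_mul_word τ hn μ (f * star (word μ))
    rw [mul_assoc, star_word_mul_word, mul_one, hμ'] at h3
    rw [h3, ← mul_assoc, inv_mul_cancel₀ (pow_ne_zero _ hn'), one_mul]

/-- The weight vectors generate a dense right `F`-submodule: `a = ∑ S_μ (S_μ* a)` in degree `j` and
`a = S_μ* (S_μ a)` in degree `-j`, with second factors in `F`. Elements of `𝒩` commute with right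
multiplication by `F`. -/
theorem vN_eq_zero_of_weightVector (hn : n ≠ 0) {x : Hilb τ →L[ℂ] Hilb τ}
    (hx : x ∈ (vN τ).toStarSubalgebra) (h : ∀ i, x (weightVector τ i) = 0) : x = 0 := by
  have hn' : (0 : ℝ) < n := by exact_mod_cast Nat.pos_of_ne_zero hn
  have hword : ∀ μ : List (Fin n), x (toHilb τ (word μ)) = 0 := by
    intro μ
    have h1 := h (μ, false)
    rw [weightVector_false, map_smul] at h1
    refine (smul_eq_zero.1 h1).resolve_left ?_
    have : √((n : ℝ) ^ μ.length)⁻¹ ≠ 0 := (Real.sqrt_pos.2 (by positivity)).ne'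
    exact_mod_cast this
  have hstar : ∀ μ : List (Fin n), x (toHilb τ (star (word μ))) = 0 := by
    intro μ
    by_cases hμ : μ = []
    · subst hμ
      rw [word_nil, star_one]
      exact hword []
    · rw [← weightVector_true τ hμ]
      exact h _
  have hmul : ∀ (w b : Alg n), b ∈ fixedAlg n → x (toHilb τ w) = 0 →
      x (toHilb τ (w * b)) = 0 := by
    intro w b hb hw
    have h1 := rightMul_toHilb τ ⟨b, hb⟩ w
    change rightMul τ ⟨b, hb⟩ (toHilb τ w) = toHilb τ (w * b) at h1
    rw [← h1, ← mul_apply_eq_comp, ← rightMul_commute_of_mem_vN τ hx, mul_apply_eq_comp, hw,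
      map_zero]
  refine (isOrthogonalDecomposition_component τ).ext_clm ?_
  rintro k _ ⟨a, ha, rfl⟩
  rw [toHilbₗ_apply, zero_apply]
  obtain ⟨j, rfl | rfl⟩ := k.eq_nat_or_neg
  · have h1 : a = ∑ μ ∈ words n j, word μ * (star (word μ) * a) := by
      simp_rw [← mul_assoc]
      rw [← Finset.sum_mul, sum_word_mul_star_word, one_mul]
    rw [h1, toHilb_sum, map_sum]
    refine Finset.sum_eq_zero fun μ hμ => hmul _ _ ?_ (hword μ)
    have h2 := mul_mem_homogeneous (star_word_mem_homogeneous μ) ha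
    rw [mem_words.1 hμ, neg_add_cancel] at h2
    exact mem_homogeneous_zero_iff.1 h2
  · let μ : List (Fin n) := List.replicate j ⟨0, Nat.pos_of_ne_zero hn⟩
    have hμ : μ.length = j := by simp [μ]
    have h1 : a = star (word μ) * (word μ * a) := by
      rw [← mul_assoc, star_word_mul_word, one_mul]
    rw [h1]
    refine hmul _ _ ?_ (hstar μ)
    have h2 := mul_mem_homogeneous (word_mem_homogeneous μ) ha
    rw [hμ, add_neg_cancel] at h2
    exact mem_homogeneous_zero_iff.1 h2

/-- The operators `f Φ_k` belong to the centralizer of `τ_Δ`. -/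
theorem weightForm_rep_mul_degreeProj_comm {f : Alg n} (hf : f ∈ fixedAlg n) (k : ℤ)
    {z : Hilb τ →L[ℂ] Hilb τ} (hz : z ∈ (vN τ).toStarSubalgebra)
    (hzs : SqIntegrable (weightVector τ) z) (hzs' : SqIntegrable (weightVector τ) (star z)) :
    weightForm (vectorSumWeight (weightVector τ)) (star (rep τ f * degreeProj τ k)) z
      = weightForm (vectorSumWeight (weightVector τ)) (star z) (rep τ f * degreeProj τ k) := by
  have hL := hasSum_weightForm hzs (y := star (rep τ f * degreeProj τ k))
    (by rw [star_rep_mul_degreeProj τ hf]; exact sqIntegrable_rep_mul_degreeProj τ _ k)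
  have hR := hasSum_weightForm (sqIntegrable_rep_mul_degreeProj τ f k) hzs'
  rw [star_rep_mul_degreeProj τ hf] at hL ⊢
  have hL0 : ∀ i, weightDeg i ≠ k → ⟪(rep τ (star f) * degreeProj τ k) (weightVector τ i),
      z (weightVector τ i)⟫_ℂ = 0 := fun i hi => by
    rw [rep_mul_degreeProj_weightVector_of_ne τ _ hi, inner_zero_left]
  have hR0 : ∀ i, weightDeg i ≠ k → ⟪(star z) (weightVector τ i),
      (rep τ f * degreeProj τ k) (weightVector τ i)⟫_ℂ = 0 := fun i hi => by
    rw [rep_mul_degreeProj_weightVector_of_ne τ _ hi, inner_zero_right]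
  have hcase : (∃ j : ℕ, k = j) ∨ ∃ j : ℕ, j ≠ 0 ∧ k = -(j : ℤ) := by
    rcases le_or_gt 0 k with h | h
    · exact Or.inl ⟨k.toNat, by omega⟩
    · exact Or.inr ⟨(-k).toNat, by omega, by omega⟩
  have hzadj : ∀ v w : Hilb τ, ⟪(star z) v, w⟫_ℂ = ⟪v, z w⟫_ℂ := fun v w => by
    rw [ContinuousLinearMap.star_eq_adjoint, ContinuousLinearMap.adjoint_inner_left]
  obtain ⟨j, rfl⟩ | ⟨j, hj, rfl⟩ := hcase
  · have hnil : weightVector τ (([] : List (Fin n)), true) = 0 := weightVector_nil_true τ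
    rw [hL.unique (hasSum_of_weightDeg_nat hL0 (by rw [hnil, map_zero, map_zero, inner_zero_left])),
      hR.unique (hasSum_of_weightDeg_nat hR0 (by rw [hnil, map_zero, map_zero, inner_zero_left]))]
    have hdeg : ∀ μ ∈ words n j, (word μ : Alg n) ∈ homogeneous n j := fun μ hμ => by
      have h2 := word_mem_homogeneous μ
      rwa [mem_words.1 hμ] at h2
    have hl : ∀ μ ∈ words n j, ⟪(rep τ (star f) * degreeProj τ j) (weightVector τ (μ, false)),
        z (weightVector τ (μ, false))⟫_ℂ
        = ((n : ℂ) ^ j)⁻¹ * ⟪toHilb τ (star f * word μ), z (toHilb τ (word μ))⟫_ℂ := by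
      intro μ hμ
      rw [inner_weightVector_false, mem_words.1 hμ, mul_apply_eq_comp,
        degreeProj_toHilb_self τ (hdeg μ hμ), rep_toHilb]
    -- Expanding `f S_μ = ∑_ν S_ν (S_ν* f S_μ)` gives right factors in `F`, which move across `z`.
    -- Summed over `μ`, the projections `S_μ S_μ*` disappear and the other side remains.
    have hr : ∀ μ ∈ words n j, ⟪(star z) (weightVector τ (μ, false)),
        (rep τ f * degreeProj τ j) (weightVector τ (μ, false))⟫_ℂ
        = ((n : ℂ) ^ j)⁻¹ * ∑ ν ∈ words n j,
          ⟪toHilb τ (word μ * star (word μ) * (star f * word ν)), z (toHilb τ (word ν))⟫_ℂ := by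
      intro μ hμ
      rw [inner_weightVector_false, mem_words.1 hμ, mul_apply_eq_comp,
        degreeProj_toHilb_self τ (hdeg μ hμ), rep_toHilb, hzadj]
      congr 1
      have h1 : f * word μ = ∑ ν ∈ words n j, word ν * (star (word ν) * f * word μ) := by
        simp_rw [mul_assoc (star (word _)), ← mul_assoc (word _) (star (word _))]
        rw [← Finset.sum_mul, sum_word_mul_star_word, one_mul]
      rw [h1, toHilb_sum, map_sum, inner_sum]
      refine Finset.sum_congr rfl fun ν hν => ?_
      have hb : star (word ν) * f * word μ ∈ fixedAlg n := by
        rw [← mem_homogeneous_zero_iff]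
        have h2 := mul_mem_homogeneous (mul_mem_homogeneous (star_mem_homogeneous (hdeg ν hν))
          (mem_homogeneous_zero_iff.2 hf)) (hdeg μ hμ)
        rwa [add_zero, neg_add_cancel] at h2
      rw [inner_toHilb_mul_of_mem_vN τ hz hb, star_mul, star_mul, star_star]
      simp only [mul_assoc]
    rw [Finset.sum_congr rfl hl, Finset.sum_congr rfl hr, ← Finset.mul_sum, ← Finset.mul_sum,
      Finset.sum_comm]
    congr 1
    refine Finset.sum_congr rfl fun ν _ => ?_
    rw [← sum_inner, ← toHilb_sum, ← Finset.sum_mul, sum_word_mul_star_word, one_mul]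
  · rw [hL.unique (hasSum_of_weightDeg_neg hj hL0), hR.unique (hasSum_of_weightDeg_neg hj hR0)]
    refine Finset.sum_congr rfl fun μ hμ => ?_
    have hμ' : μ.length = j := mem_words.1 hμ
    have hne : μ ≠ [] := by rintro rfl; exact hj (by simpa using hμ'.symm)
    have h2 := star_word_mem_homogeneous μ
    rw [hμ'] at h2
    have hb : word μ * (f * star (word μ)) ∈ fixedAlg n := by
      rw [← mem_homogeneous_zero_iff]
      have h3 := mul_mem_homogeneous (word_mem_homogeneous μ)
        (mul_mem_homogeneous (mem_homogeneous_zero_iff.2 hf) (star_word_mem_homogeneous μ))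
      rwa [zero_add, add_neg_cancel] at h3
    -- In negative degree the identity already holds word by word, since `S_μ f S_μ*` lies in `F`.
    have h1 : f * star (word μ) = star (word μ) * (word μ * (f * star (word μ))) := by
      rw [← mul_assoc, star_word_mul_word, one_mul]
    rw [weightVector_true τ hne, mul_apply_eq_comp, mul_apply_eq_comp,
      degreeProj_toHilb_self τ h2, rep_toHilb, rep_toHilb, hzadj, h1,
      inner_toHilb_mul_of_mem_vN τ hz hb, star_mul, star_mul, star_star, ← mul_assoc,
      ← mul_assoc, star_word_mul_word, one_mul]

/-! ### The fixed-point algebra -/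

section Fixed

variable {σ : ℝ → ((vN τ).toStarSubalgebra ≃⋆ₐ[ℂ] (vN τ).toStarSubalgebra)}
  (hσ : IsModularGroup (vN τ).toStarSubalgebra (vectorSumWeight (weightVector τ)) σ)
  (hn : n ≠ 0)

include hσ hn

theorem rep_mul_degreeProj_mem_fixedPoints {f : Alg n} (hf : f ∈ fixedAlg n) (k : ℤ) :
    rep τ f * degreeProj τ k ∈ fixedPoints (vN τ).toStarSubalgebra σ := by
  refine mem_fixedPoints.2 ⟨rep_mul_degreeProj_mem_vN τ hn k f, fun t => ?_⟩
  have hstar : SqIntegrable (weightVector τ) (star (rep τ f * degreeProj τ k)) := by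
    rw [star_rep_mul_degreeProj τ hf]
    exact sqIntegrable_rep_mul_degreeProj τ _ k
  refine hσ.apply_eq_self_of_centralizer (fun x hx h => vN_eq_zero_of_weightVector τ hn hx h)
    (a := ⟨rep τ f * degreeProj τ k, rep_mul_degreeProj_mem_vN τ hn k f⟩)
    (sqIntegrable_rep_mul_degreeProj τ f k) hstar (fun z hz hz' => ?_) t
  have h := weightForm_rep_mul_degreeProj_comm τ hf k z.2 hz hz'
  simp only [StarMemClass.coe_star]
  exact h

/-- Since `σ_t` fixes `Φ_k`, one has `σ_t(T) Φ_k = σ_t(T Φ_k) = T Φ_k`. Thus no normality of `σ_t`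
is needed. -/
theorem mem_fixedPoints_of_mul_degreeProj {T : Hilb τ →L[ℂ] Hilb τ}
    (h : ∀ k, T * degreeProj τ k ∈ fixedPoints (vN τ).toStarSubalgebra σ) :
    T ∈ fixedPoints (vN τ).toStarSubalgebra σ := by
  have hT : T ∈ (vN τ).toStarSubalgebra :=
    mem_vN_of_mul_degreeProj τ hn fun k => (mem_fixedPoints.1 (h k)).1
  refine mem_fixedPoints.2 ⟨hT, fun t => Subtype.ext (ext_mul_degreeProj τ fun k => ?_)⟩
  obtain ⟨h1, h2⟩ := mem_fixedPoints.1 (h k)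
  have h3 := rep_mul_degreeProj_mem_fixedPoints τ hσ hn (one_mem (fixedAlg n)) k
  rw [map_one, one_mul] at h3
  obtain ⟨h4, h5⟩ := mem_fixedPoints.1 h3
  have h6 : (⟨T * degreeProj τ k, h1⟩ : (vN τ).toStarSubalgebra)
      = ⟨T, hT⟩ * ⟨degreeProj τ k, h4⟩ := rfl
  have h7 := h2 t
  rw [h6, map_mul, h5 t] at h7
  exact congrArg Subtype.val h7

/-- Operators `f · diag c` with `f` gauge-invariant belong to the fixed-point algebra. -/
theorem rep_mul_gradedDiag_mem_fixedPoints {f : Alg n} (hf : f ∈ fixedAlg n) {c : ℤ → ℂ}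
    (hc : ∃ C, ∀ i, ‖c i‖ ≤ C) :
    rep τ f * gradedDiag τ c ∈ fixedPoints (vN τ).toStarSubalgebra σ := by
  refine mem_fixedPoints_of_mul_degreeProj τ hσ hn fun k => ?_
  rw [mul_assoc, gradedDiag_mul_degreeProj τ hc, mul_smul_comm]
  exact SMulMemClass.smul_mem _ (rep_mul_degreeProj_mem_fixedPoints τ hσ hn hf k)

end Fixed

end Cuntz

/-! ### Spectral approximation of gauge-invariant elements -/

namespace Cuntz

section Matrices

variable {n : ℕ}

/-- A family of isometries with orthogonal ranges that sum to one. -/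
structure IsIsometryPartition {ι : Type*} [Fintype ι] [DecidableEq ι] (w : ι → Alg n) : Prop where
  star_mul : ∀ i j, star (w i) * w j = if i = j then 1 else 0
  sum_mul_star : ∑ i, w i * star (w i) = 1

theorem isIsometryPartition_word (m : ℕ) :
    IsIsometryPartition fun v : Fin m → Fin n => (word (List.ofFn v) : Alg n) where
  star_mul v v' := by
    rw [star_word_mul_word_of_length_eq (by simp)]
    simp only [List.ofFn_injective.eq_iff]
  sum_mul_star := by
    rw [← sum_word_mul_star_word m, words, Finset.sum_image List.ofFn_injective.injOn]

namespace IsIsometryPartition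

variable {ι : Type*} [Fintype ι] [DecidableEq ι] {w : ι → Alg n}

theorem rotate (hw : IsIsometryPartition w) {U : Matrix ι ι ℂ}
    (hU : U ∈ Matrix.unitaryGroup ι ℂ) :
    IsIsometryPartition fun j => ∑ i, U i j • w i where
  star_mul j k := by
    have h := congrFun (congrFun (Matrix.mem_unitaryGroup_iff'.1 hU) j) k
    rw [Matrix.mul_apply] at h
    simp only [Matrix.star_apply, Matrix.one_apply] at h
    simp only [star_sum, star_smul, Finset.sum_mul_sum, smul_mul_smul_comm, hw.star_mul, smul_ite,
      smul_zero, Finset.sum_ite_eq, Finset.mem_univ, if_true, ← Finset.sum_smul, h]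
    split_ifs <;> simp
  sum_mul_star := by
    have h : ∀ i i', ∑ j, U i j * star (U i' j) = if i = i' then 1 else 0 := fun i i' => by
      have h := congrFun (congrFun (Matrix.mem_unitaryGroup_iff.1 hU) i) i'
      rwa [Matrix.mul_apply, Matrix.one_apply] at h
    simp only [star_sum, star_smul, Finset.sum_mul_sum, smul_mul_smul_comm]
    rw [Finset.sum_comm, ← hw.sum_mul_star]
    refine Finset.sum_congr rfl fun i _ => ?_
    rw [Finset.sum_comm]
    simp only [← Finset.sum_smul, h, ite_smul, one_smul, zero_smul, Finset.sum_ite_eq,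
      Finset.mem_univ, if_true]

theorem eq_sum (hw : IsIsometryPartition w) {b : Alg n} {A : Matrix ι ι ℂ}
    (hb : ∀ i j, star (w i) * b * w j = A i j • 1) :
    b = ∑ i, ∑ j, A i j • (w i * star (w j)) := by
  calc b = (∑ i, w i * star (w i)) * b * ∑ j, w j * star (w j) := by
        rw [hw.sum_mul_star, one_mul, mul_one]
    _ = ∑ i, ∑ j, w i * (star (w i) * b * w j) * star (w j) := by
        simp only [Finset.sum_mul, Finset.mul_sum, mul_assoc]
        exact Finset.sum_comm
    _ = _ := by simp only [hb, mul_smul_comm, smul_mul_assoc, mul_one]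

/-- A self-adjoint element that is a matrix over a partition is diagonal over another one. -/
theorem exists_diagonal (hw : IsIsometryPartition w) [Nontrivial (Alg n)] {b : Alg n}
    (hbs : star b = b) {A : Matrix ι ι ℂ} (hb : ∀ i j, star (w i) * b * w j = A i j • 1) :
    ∃ (U : Matrix ι ι ℂ) (α : ι → ℝ), U ∈ Matrix.unitaryGroup ι ℂ ∧
      b = ∑ k, (α k : ℂ) • ((∑ i, U i k • w i) * star (∑ i, U i k • w i)) := by
  have hA : A.IsHermitian := by
    ext i j
    have h : star (star (w j) * b * w i) = star (w i) * b * w j := by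
      simp only [StarMul.star_mul, star_star, hbs, mul_assoc]
    rw [hb, hb, star_smul, star_one] at h
    exact smul_left_injective ℂ (one_ne_zero (α := Alg n)) h
  refine ⟨hA.eigenvectorUnitary, hA.eigenvalues, hA.eigenvectorUnitary.2, ?_⟩
  have hsp : ∀ i j, A i j = ∑ k, (hA.eigenvectorUnitary : Matrix ι ι ℂ) i k * hA.eigenvalues k
      * star ((hA.eigenvectorUnitary : Matrix ι ι ℂ) j k) := fun i j => by
    have h := congrFun (congrFun hA.spectral_theorem i) j
    rw [Unitary.conjStarAlgAut_apply, Matrix.mul_apply] at h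
    simpa [Matrix.mul_diagonal] using h
  rw [hw.eq_sum hb]
  simp only [hsp, star_sum, star_smul, Finset.sum_mul_sum, smul_mul_smul_comm, Finset.smul_sum,
    smul_smul, Finset.sum_smul]
  conv_rhs => rw [Finset.sum_comm]
  refine Finset.sum_congr rfl fun i _ => ?_
  rw [Finset.sum_comm]
  refine Finset.sum_congr rfl fun k _ => Finset.sum_congr rfl fun j _ => ?_
  congr 1
  ring

end IsIsometryPartition

/-- For words at least as long as `α` and `β`, `S_μ* S_α S_β* S_ν` with `|α| = |β|` reduces to zero
or to a product `S_{μ'}* S_{ν'}` of equally long tails, which is a scalar. The expectation removes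
the terms with `|α| ≠ |β|`, so that the claim is linear in `b` and passes through the span. -/
theorem exists_gaugeMean_star_word_mul_eq_smul {b : Alg n} (hb : b ∈ core n) :
    ∃ m₀ : ℕ, ∀ m, m₀ ≤ m → ∀ μ ν : List (Fin n), μ.length = m → ν.length = m →
      ∃ c : ℂ, (expect n (star (word μ) * b * word ν) : Alg n) = c • 1 := by
  induction hb using Submodule.span_induction with
  | mem x h =>
    obtain ⟨⟨α, β⟩, rfl⟩ := h
    refine ⟨α.length, fun m hm μ ν hμ hν => ?_⟩
    have hx : star (word μ) * (word α * star (word β)) * word ν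
        = star (word μ) * word α * (star (word β) * word ν) := by simp only [mul_assoc]
    simp only [hx]
    by_cases hl : α.length = β.length
    · have hsplit : ∀ {κ α : List (Fin n)}, α.length ≤ κ.length →
          star (word α) * word κ
            = (if α = κ.take α.length then 1 else 0) * word (κ.drop α.length) := by
        intro κ α h
        conv_lhs => rw [← List.take_append_drop α.length κ, word_append, ← mul_assoc,
          star_word_mul_word_of_length_eq (by rw [List.length_take]; omega)]
      have h1 : star (word μ) * word α = star (star (word α) * word μ) := by simp
      rw [h1, hsplit (by omega), hsplit (by omega)]
      split_ifs with h2 h3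
      · refine ⟨if μ.drop α.length = ν.drop β.length then 1 else 0, ?_⟩
        rw [one_mul, one_mul, star_word_mul_word_of_length_eq
          (by rw [List.length_drop, List.length_drop]; omega)]
        split_ifs
        · rw [one_smul, expect_coe, gaugeMean_of_mem_fixedAlg (one_mem _)]
        · rw [map_zero, zero_smul]; rfl
      all_goals exact ⟨0, by simp⟩
    · refine ⟨0, ?_⟩
      rw [zero_smul, expect_coe]
      refine gaugeMean_of_mem_homogeneous (k := (α.length : ℤ) - β.length) (by omega) ?_
      have h := mul_mem_homogeneous
        (mul_mem_homogeneous (star_word_mem_homogeneous μ) (word_mem_homogeneous α))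
        (mul_mem_homogeneous (star_word_mem_homogeneous β) (word_mem_homogeneous ν))
      convert h using 2
      omega
  | zero => exact ⟨0, fun m _ μ ν _ _ => ⟨0, by simp⟩⟩
  | add x y _ _ hx hy =>
    obtain ⟨m₁, h₁⟩ := hx
    obtain ⟨m₂, h₂⟩ := hy
    refine ⟨max m₁ m₂, fun m hm μ ν hμ hν => ?_⟩
    obtain ⟨c, hc⟩ := h₁ m (le_of_max_le_left hm) μ ν hμ hν
    obtain ⟨d, hd⟩ := h₂ m (le_of_max_le_right hm) μ ν hμ hν
    refine ⟨c + d, ?_⟩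
    rw [mul_add, add_mul, map_add, add_smul, ← hc, ← hd]
    rfl
  | smul a x _ hx =>
    obtain ⟨m₁, h₁⟩ := hx
    refine ⟨m₁, fun m hm μ ν hμ hν => ?_⟩
    obtain ⟨c, hc⟩ := h₁ m hm μ ν hμ hν
    refine ⟨a * c, ?_⟩
    rw [mul_smul_comm, smul_mul_assoc, map_smul, mul_smul, ← hc]
    rfl

end Matrices

/-- A finite partition of unity by projections of `F`. -/
structure IsProjPartition {n : ℕ} {ι : Type*} [Fintype ι] [DecidableEq ι] (p : ι → Alg n) :
    Prop where
  mem : ∀ i, p i ∈ fixedAlg n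
  star_eq : ∀ i, star (p i) = p i
  mul : ∀ i j, p i * p j = if i = j then p i else 0
  sum : ∑ i, p i = 1

variable {n : ℕ} (τ : TracialState n)

include τ in
theorem nontrivial_alg : Nontrivial (Alg n) := by
  refine ⟨1, 0, fun h => ?_⟩
  have h1 := kmsState_one τ
  rw [h, map_zero] at h1
  exact zero_ne_one h1

include τ in
/-- Positive gauge-invariant elements are limits of positive combinations of projections. -/
theorem exists_projPartition_near {f : Alg n} (hf : f ∈ fixedAlg n) (h0 : 0 ≤ f) {ε : ℝ}
    (hε : 0 < ε) :
    ∃ (m : ℕ) (p : (Fin m → Fin n) → Alg n) (l : (Fin m → Fin n) → ℝ), IsProjPartition p ∧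
      (∀ i, 0 ≤ l i) ∧ ‖f - ∑ i, (l i : ℂ) • p i‖ ≤ ε := by
  have := nontrivial_alg τ
  -- Half of `ε` pays for the approximation; the other half is kept for a shift that makes the
  -- coefficients nonnegative.
  obtain ⟨b₀, hb₀, hbF₀, hd₀⟩ := exists_core_fixedAlg_near hf (half_pos hε)
  obtain ⟨m, hm⟩ := exists_gaugeMean_star_word_mul_eq_smul hb₀
  choose c hc using fun v v' : Fin m → Fin n =>
    hm m le_rfl (List.ofFn v) (List.ofFn v') (by simp) (by simp)
  have hword : ∀ v v' : Fin m → Fin n, ∀ a ∈ fixedAlg n,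
      star (word (List.ofFn v)) * a * word (List.ofFn v') ∈ fixedAlg n := by
    intro v v' a ha
    rw [← mem_homogeneous_zero_iff] at ha ⊢
    have h := mul_mem_homogeneous (mul_mem_homogeneous (star_word_mem_homogeneous (List.ofFn v)) ha)
      (word_mem_homogeneous (List.ofFn v'))
    simpa using h
  have hc' : ∀ v v' : Fin m → Fin n,
      star (word (List.ofFn v)) * b₀ * word (List.ofFn v') = c v v' • (1 : Alg n) := by
    intro v v'
    rw [← hc, expect_coe, gaugeMean_of_mem_fixedAlg (hword v v' b₀ hbF₀)]
  set b : Alg n := (1 / 2 : ℂ) • (b₀ + star b₀) with hb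
  have hbs : star b = b := by
    rw [hb, star_smul, star_add, star_star, add_comm]
    simp
  have hfs : star f = f := (IsSelfAdjoint.of_nonneg h0).star_eq
  have hd : ‖f - b‖ ≤ ε / 2 := by
    have h : f - b = (1 / 2 : ℂ) • ((f - b₀) + star (f - b₀)) := by
      rw [hb, star_sub, hfs, ← sub_eq_zero]
      module
    rw [h, norm_smul]
    have h1 := norm_add_le (f - b₀) (star (f - b₀))
    rw [norm_star] at h1
    have h2 : ‖(1 / 2 : ℂ)‖ = 1 / 2 := by norm_num
    rw [h2]
    linarith
  have hpart := isIsometryPartition_word (n := n) m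
  -- Over words of length `m`, `b` is a Hermitian scalar matrix; its unitary diagonalisation
  -- replaces the words by isometries `t_k` with `b = ∑ α_k t_k t_k*`.
  obtain ⟨U, α, hU, hbU⟩ := hpart.exists_diagonal (b := b)
    (A := fun v v' => (1 / 2 : ℂ) * (c v v' + star (c v' v))) hbs (fun v v' => by
      have h : star (word (List.ofFn v)) * star b₀ * word (List.ofFn v')
          = star (c v' v) • (1 : Alg n) := by
        have h := congrArg star (hc' v' v)
        rw [star_smul, star_one] at h
        rw [← h]
        simp only [star_mul, star_star, mul_assoc]
      rw [hb, mul_smul_comm, smul_mul_assoc, mul_add, add_mul, hc', h, ← add_smul, smul_smul])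
  have ht := hpart.rotate hU
  set t : (Fin m → Fin n) → Alg n := fun k => ∑ v, U v k • word (List.ofFn v)
  change b = ∑ k, (α k : ℂ) • (t k * star (t k)) at hbU
  have hth : ∀ k, t k ∈ homogeneous n m := fun k =>
    sum_mem fun v _ => Submodule.smul_mem _ _ (by
      simpa using word_mem_homogeneous (List.ofFn v))
  clear_value t
  have hp : IsProjPartition fun k => t k * star (t k) :=
    { mem := fun k => by
        rw [← mem_homogeneous_zero_iff]
        simpa using mul_mem_homogeneous (hth k) (star_mem_homogeneous (hth k))
      star_eq := fun k => by simp
      mul := fun j k => by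
        have h : t j * star (t j) * (t k * star (t k)) = t j * (star (t j) * t k) * star (t k) := by
          simp only [mul_assoc]
        rw [h, ht.star_mul]
        split_ifs with hjk
        · rw [mul_one, hjk]
        · rw [mul_zero, zero_mul]
      sum := ht.sum_mul_star }
  -- The eigenvalue is `α_k = φ(t_k* b t_k)`, within `ε/2` of `φ(t_k* f t_k) ≥ 0`; hence `α_k + ε/2
  -- ≥ 0`.
  refine ⟨m, fun k => t k * star (t k), fun k => α k + ε / 2, hp, fun k => ?_, ?_⟩
  · have htb : star (t k) * b * t k = (α k : ℂ) • 1 := by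
      have h : ∀ j, star (t k) * (t j * star (t j)) * t k
          = (star (t k) * t j) * (star (t j) * t k) := fun j => by simp only [mul_assoc]
      rw [hbU, Finset.mul_sum, Finset.sum_mul]
      simp only [mul_smul_comm, smul_mul_assoc, h, ht.star_mul, ite_mul, one_mul, zero_mul,
        smul_ite, smul_zero, Finset.sum_ite_eq, Finset.mem_univ, if_true]
    have hnt : ‖t k‖ ≤ 1 := by
      have h := CStarRing.norm_star_mul_self (x := t k)
      rw [ht.star_mul, if_pos rfl, norm_one] at h
      nlinarith [norm_nonneg (t k)]
    have h1 : 0 ≤ kmsState τ (star (t k) * f * t k) :=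
      map_nonneg (kmsState τ) (star_left_conjugate_nonneg h0 (t k))
    have h2 : ‖kmsState τ (star (t k) * (f - b) * t k)‖ ≤ ε / 2 := by
      refine (norm_kmsState_le τ _).trans (((norm_mul_le _ _).trans
        (mul_le_mul_of_nonneg_right (norm_mul_le _ _) (norm_nonneg _))).trans ?_)
      rw [norm_star]
      have := norm_nonneg (t k)
      have := norm_nonneg (f - b)
      calc ‖t k‖ * ‖f - b‖ * ‖t k‖ ≤ 1 * ‖f - b‖ * 1 := by gcongr
        _ ≤ ε / 2 := by linarith
    have h3 : kmsState τ (star (t k) * f * t k)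
        = kmsState τ (star (t k) * (f - b) * t k) + α k := by
      rw [mul_sub, sub_mul, htb, map_sub, map_smul, kmsState_one, smul_eq_mul, mul_one]
      ring
    have h4 := (Complex.nonneg_iff.1 h1).1
    rw [h3, Complex.add_re, Complex.ofReal_re] at h4
    linarith [(Complex.re_le_norm _).trans h2]
  · have h : f - ∑ k, ((α k + ε / 2 : ℝ) : ℂ) • (t k * star (t k))
        = (f - b) - ((ε / 2 : ℝ) : ℂ) • 1 := by
      simp only [Complex.ofReal_add, add_smul, Finset.sum_add_distrib, ← Finset.smul_sum]
      rw [ht.sum_mul_star, ← hbU]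
      abel
    rw [h]
    refine (norm_sub_le _ _).trans ?_
    rw [norm_smul, norm_one, Complex.norm_real, Real.norm_of_nonneg (half_pos hε).le]
    linarith

end Cuntz

/-! ### Singular values of `f (1 + 𝒟²)^{-1/2}` -/

namespace Cuntz

open OperatorTheory

section Fine

variable {n : ℕ} (τ : TracialState n) {ι : Type*} [Fintype ι] [DecidableEq ι] {p : ι → Alg n}

variable (p) in
/-- The vectors of degree `k` in the range of `p i`. -/
def fineComponent (j : ι × ℤ) : Submodule ℂ (Hilb τ) :=
  (homogeneous n j.2).map (toHilbₗ τ ∘ₗ LinearMap.mulLeft ℂ (p j.1))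

theorem toHilb_mem_fineComponent (i : ι) {k : ℤ} {a : Alg n} (ha : a ∈ homogeneous n k) :
    toHilb τ (p i * a) ∈ fineComponent τ p (i, k) :=
  ⟨a, ha, rfl⟩

namespace IsProjPartition

theorem mul_mem_homogeneous (hp : IsProjPartition p) (i : ι) {k : ℤ} {a : Alg n}
    (ha : a ∈ homogeneous n k) : p i * a ∈ homogeneous n k := by
  have h := Cuntz.mul_mem_homogeneous (mem_homogeneous_zero_iff.2 (hp.mem i)) ha
  rwa [zero_add] at h

theorem isOrthogonalDecomposition (hp : IsProjPartition p) :
    IsOrthogonalDecomposition (fineComponent τ p) where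
  orthogonal := by
    rintro ⟨i, k⟩ ⟨j, l⟩ hne ⟨_, a, ha, rfl⟩ ⟨_, b, hb, rfl⟩
    change ⟪toHilb τ (p i * a), toHilb τ (p j * b)⟫_ℂ = 0
    by_cases hkl : k = l
    · have hij : i ≠ j := by rintro rfl; exact hne (by rw [hkl])
      rw [inner_toHilb, star_mul, hp.star_eq, mul_assoc, ← mul_assoc (p i), hp.mul, if_neg hij,
        zero_mul, mul_zero, map_zero]
    · exact inner_toHilb_of_ne τ hkl (hp.mul_mem_homogeneous i ha) (hp.mul_mem_homogeneous j hb)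
  dense := by
    refine (isOrthogonalDecomposition_component τ).dense.mono ?_
    refine SetLike.coe_subset_coe.2 (iSup_le fun k => ?_)
    rintro _ ⟨a, ha, rfl⟩
    have h : toHilbₗ τ a = ∑ i, toHilb τ (p i * a) := by
      rw [← toHilb_sum, ← Finset.sum_mul, hp.sum, one_mul, toHilbₗ_apply]
    rw [h]
    exact sum_mem fun i _ => Submodule.mem_iSup_of_mem (i, k) (toHilb_mem_fineComponent τ i ha)

end IsProjPartition

variable (p) in
/-- The operator that is multiplication by `c (i, k)` on the vectors of degree `k` in the range of
`p i`. -/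
def fineDiag (c : ι × ℤ → ℝ) : Hilb τ →L[ℂ] Hilb τ := diag (fineComponent τ p) fun j => (c j : ℂ)

theorem exists_norm_ofReal_le {κ : Type*} {c : κ → ℝ} (hc : ∃ C, ∀ j, |c j| ≤ C) :
    ∃ C, ∀ j, ‖(c j : ℂ)‖ ≤ C := by simpa using hc

theorem exists_abs_le_mul_invSqrtWeight (l : ι → ℝ) :
    ∃ C, ∀ j : ι × ℤ, |l j.1 * invSqrtWeight j.2| ≤ C := by
  refine ⟨∑ i, |l i|, fun j => ?_⟩
  rw [abs_mul, abs_of_pos (invSqrtWeight_pos _)]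
  refine (mul_le_of_le_one_right (abs_nonneg _) (invSqrtWeight_le_one _)).trans ?_
  exact Finset.single_le_sum (f := fun i => |l i|) (fun _ _ => abs_nonneg _) (Finset.mem_univ j.1)

variable (p) in
/-- The projection onto the vectors of degree at most `x i` in the range of `p i`. -/
def regionProj (x : ι → ℝ) : Hilb τ →L[ℂ] Hilb τ :=
  ∑ i, ∑ k ∈ Finset.Icc (-⌊x i⌋) ⌊x i⌋, rep τ (p i) * degreeProj τ k

/-- Valid for `x < 0` as well, where the interval is empty; this case occurs in the lower bound. -/
theorem mem_Icc_floor {x : ℝ} {k : ℤ} : k ∈ Finset.Icc (-⌊x⌋) ⌊x⌋ ↔ |(k : ℝ)| ≤ x := by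
  rw [Finset.mem_Icc, ← abs_le, Int.le_floor, Int.cast_abs]

theorem regionProj_toHilb (hp : IsProjPartition p) (x : ι → ℝ) (i : ι) {k : ℤ} {a : Alg n}
    (ha : a ∈ homogeneous n k) :
    regionProj τ p x (toHilb τ (p i * a))
      = ((if |(k : ℝ)| ≤ x i then 1 else 0 : ℝ) : ℂ) • toHilb τ (p i * a) := by
  have hpa := hp.mul_mem_homogeneous i ha
  have h1 : ∀ j l, (rep τ (p j) * degreeProj τ l) (toHilb τ (p i * a))
      = if k = l then (if j = i then toHilb τ (p i * a) else 0) else 0 := by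
    intro j l
    rw [mul_apply_eq_comp]
    split_ifs with hkl hji
    · subst hkl hji
      rw [degreeProj_toHilb_self τ hpa, rep_toHilb, ← mul_assoc, hp.mul, if_pos rfl]
    · subst hkl
      rw [degreeProj_toHilb_self τ hpa, rep_toHilb, ← mul_assoc, hp.mul, if_neg hji, zero_mul,
        toHilb_zero]
    · rw [degreeProj_toHilb_of_ne τ hkl hpa, map_zero]
  rw [regionProj]
  simp only [sum_apply, h1, Finset.sum_ite_eq, mem_Icc_floor]
  rw [Finset.sum_eq_single i (fun j _ hj => by simp [hj]) (by simp), if_pos (rfl : i = i)]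
  split_ifs <;> simp

variable (hp : IsProjPartition p)

include hp

theorem norm_fineDiag_le {c : ι × ℤ → ℝ} {C : ℝ} (hC : 0 ≤ C) (hc : ∀ j, |c j| ≤ C) :
    ‖fineDiag τ p c‖ ≤ C :=
  (hp.isOrthogonalDecomposition τ).norm_diag_le hC (by simpa using hc)

theorem fineDiag_mul {c d : ι × ℤ → ℝ} (hc : ∃ C, ∀ j, |c j| ≤ C) (hd : ∃ C, ∀ j, |d j| ≤ C) :
    fineDiag τ p c * fineDiag τ p d = fineDiag τ p fun j => c j * d j := by
  rw [fineDiag, fineDiag, (hp.isOrthogonalDecomposition τ).diag_mul (exists_norm_ofReal_le hc)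
    (exists_norm_ofReal_le hd), fineDiag]
  simp only [Complex.ofReal_mul]

theorem fineDiag_eq {c : ι × ℤ → ℝ} (hc : ∃ C, ∀ j, |c j| ≤ C) {A : Hilb τ →L[ℂ] Hilb τ}
    (h : ∀ i k, ∀ a ∈ homogeneous n k,
      A (toHilb τ (p i * a)) = (c (i, k) : ℂ) • toHilb τ (p i * a)) :
    A = fineDiag τ p c := by
  refine ((hp.isOrthogonalDecomposition τ).diag_eq (exists_norm_ofReal_le hc) ?_).symm
  rintro ⟨i, k⟩ _ ⟨a, ha, rfl⟩
  exact h i k a ha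

theorem isStarProjection_fineDiag {c : ι × ℤ → ℝ} (hc : ∀ j, c j = 0 ∨ c j = 1) :
    IsStarProjection (fineDiag τ p c) := by
  have hb : ∃ C, ∀ j, |c j| ≤ C := ⟨1, fun j => by rcases hc j with h | h <;> simp [h]⟩
  refine ⟨?_, ?_⟩
  · rw [IsIdempotentElem, fineDiag_mul τ hp hb hb]
    congr 1
    funext j
    rcases hc j with h | h <;> simp [h]
  · rw [isSelfAdjoint_iff, fineDiag,
      (hp.isOrthogonalDecomposition τ).star_diag (exists_norm_ofReal_le hb)]
    simp

theorem sum_smul_mul (l : ι → ℝ) (i : ι) : (∑ j, (l j : ℂ) • p j) * p i = (l i : ℂ) • p i := by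
  rw [Finset.sum_mul]
  simp [hp.mul]

theorem rep_mul_resolventRoot (l : ι → ℝ) :
    rep τ (∑ i, (l i : ℂ) • p i) * resolventRoot τ
      = fineDiag τ p fun j => l j.1 * invSqrtWeight j.2 := by
  refine fineDiag_eq τ hp (exists_abs_le_mul_invSqrtWeight l) fun i k a ha => ?_
  rw [mul_apply_eq_comp, resolventRoot_eq, gradedDiag_toHilb τ exists_norm_invSqrtWeight_le
    (hp.mul_mem_homogeneous i ha), map_smul, rep_toHilb, ← mul_assoc, sum_smul_mul hp,
    smul_mul_assoc, toHilb_smul, smul_smul, mul_comm, Complex.ofReal_mul]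

theorem resolventRoot_eq_fineDiag :
    resolventRoot τ = fineDiag τ p fun j => invSqrtWeight j.2 := by
  have h := rep_mul_resolventRoot τ hp fun _ => 1
  simpa [hp.sum] using h

theorem regionProj_eq (x : ι → ℝ) :
    regionProj τ p x = fineDiag τ p fun j => if |(j.2 : ℝ)| ≤ x j.1 then 1 else 0 :=
  fineDiag_eq τ hp ⟨1, fun j => by split_ifs <;> simp⟩ fun i _ _ ha =>
    regionProj_toHilb τ hp x i ha

theorem one_sub_regionProj_eq (x : ι → ℝ) :
    1 - regionProj τ p x = fineDiag τ p fun j => if |(j.2 : ℝ)| ≤ x j.1 then 0 else 1 :=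
  fineDiag_eq τ hp ⟨1, fun j => by split_ifs <;> simp⟩ fun i _ _ ha => by
    rw [sub_apply, one_apply_eq_self, regionProj_toHilb τ hp x i ha]
    split_ifs <;> simp

theorem isStarProjection_regionProj (x : ι → ℝ) : IsStarProjection (regionProj τ p x) := by
  rw [regionProj_eq τ hp]
  exact isStarProjection_fineDiag τ hp fun j => by split_ifs <;> simp

/-- Every degree carries the mass `τ(p_i)`, so the weight is a count of degrees. -/
theorem vectorSumWeight_regionProj (hn : n ≠ 0) (x : ι → ℝ) :
    vectorSumWeight (weightVector τ) (regionProj τ p x) = ENNReal.ofReal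
      (∑ i, (Finset.Icc (-⌊x i⌋) ⌊x i⌋).card * (kmsState τ (p i)).re) := by
  have h1 : HasSum (fun i => ⟪weightVector τ i, regionProj τ p x (weightVector τ i)⟫_ℂ)
      (∑ i, ∑ k ∈ Finset.Icc (-⌊x i⌋) ⌊x i⌋, kmsState τ (p i)) := by
    have h : ∀ v, ⟪v, regionProj τ p x v⟫_ℂ = ∑ i, ∑ k ∈ Finset.Icc (-⌊x i⌋) ⌊x i⌋,
        ⟪v, (rep τ (p i) * degreeProj τ k) v⟫_ℂ := fun v => by
      simp only [regionProj, sum_apply, inner_sum]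
    simp only [h]
    exact hasSum_sum fun i _ => hasSum_sum fun k _ =>
      hasSum_inner_rep_mul_degreeProj τ hn (p i) k
  have h2 := Complex.hasSum_re h1
  have h3 : (∑ i, ∑ k ∈ Finset.Icc (-⌊x i⌋) ⌊x i⌋, kmsState τ (p i)).re
      = ∑ i, (Finset.Icc (-⌊x i⌋) ⌊x i⌋).card * (kmsState τ (p i)).re := by
    simp only [Finset.sum_const, Complex.re_sum, nsmul_eq_mul, Complex.mul_re, Complex.natCast_re,
      Complex.natCast_im, zero_mul, sub_zero]
  rw [h3] at h2
  rw [vectorSumWeight, ← h2.tsum_eq, ENNReal.ofReal_tsum_of_nonneg _ h2.summable]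
  intro i
  rw [inner_apply_of_isStarProjection (isStarProjection_regionProj τ hp x), Complex.ofReal_re]
  positivity

theorem kmsState_re_nonneg (i : ι) : 0 ≤ (kmsState τ (p i)).re := by
  have h : 0 ≤ p i := by
    have h := star_mul_self_nonneg (p i)
    rwa [hp.star_eq, hp.mul, if_pos rfl] at h
  exact (Complex.nonneg_iff.1 (map_nonneg (kmsState τ) h)).1

theorem sum_kmsState_re : ∑ i, (kmsState τ (p i)).re = 1 := by
  rw [← Complex.re_sum, ← map_sum, hp.sum, kmsState_one, Complex.one_re]

theorem sum_mul_kmsState_re (l : ι → ℝ) :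
    ∑ i, l i * (kmsState τ (p i)).re = (kmsState τ (∑ i, (l i : ℂ) • p i)).re := by
  simp only [map_sum, map_smul, Complex.re_sum, smul_eq_mul, Complex.re_ofReal_mul]

end Fine

theorem invSqrtWeight_mul_abs_le (k : ℤ) : invSqrtWeight k * |(k : ℝ)| ≤ 1 := by
  have h : |(k : ℝ)| ≤ √(1 + (k : ℝ) ^ 2) := Real.abs_le_sqrt (by linarith)
  have h0 : 0 < √(1 + (k : ℝ) ^ 2) := Real.sqrt_pos.2 (by positivity)
  rw [invSqrtWeight, inv_mul_le_iff₀ h0, mul_one]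
  exact h

theorem one_le_invSqrtWeight_mul (k : ℤ) : 1 ≤ invSqrtWeight k * (1 + |(k : ℝ)|) := by
  have h0 : 0 < √(1 + (k : ℝ) ^ 2) := Real.sqrt_pos.2 (by positivity)
  rw [invSqrtWeight, le_inv_mul_iff₀ h0, mul_one]
  refine Real.sqrt_le_iff.2 ⟨by positivity, ?_⟩
  nlinarith [sq_abs (k : ℝ), abs_nonneg (k : ℝ)]

theorem card_Icc_floor_le {x : ℝ} (hx : 0 ≤ x) : ((Finset.Icc (-⌊x⌋) ⌊x⌋).card : ℝ) ≤ 2 * x + 1 := by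
  have h0 : 0 ≤ ⌊x⌋ := Int.floor_nonneg.2 hx
  have h : ((Finset.Icc (-⌊x⌋) ⌊x⌋).card : ℤ) = 2 * ⌊x⌋ + 1 := by
    rw [Int.card_Icc]
    omega
  have h' : ((Finset.Icc (-⌊x⌋) ⌊x⌋).card : ℝ) = 2 * ⌊x⌋ + 1 := by exact_mod_cast h
  rw [h']
  linarith [Int.floor_le x]

/-- No sign condition is needed, unlike for the upper bound: if `x < 0`, the left side is negative.
-/
theorem le_card_Icc_floor (x : ℝ) : 2 * x - 1 ≤ ((Finset.Icc (-⌊x⌋) ⌊x⌋).card : ℝ) := by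
  have h : (2 * ⌊x⌋ + 1 : ℤ) ≤ ((Finset.Icc (-⌊x⌋) ⌊x⌋).card : ℤ) := by
    rw [Int.card_Icc]
    omega
  have h' : (2 * ⌊x⌋ + 1 : ℝ) ≤ ((Finset.Icc (-⌊x⌋) ⌊x⌋).card : ℝ) := by exact_mod_cast h
  linarith [Int.lt_floor_add_one x]

/-! ### Two-sided bounds for the singular values by counting degrees -/

section Bounds

variable {n : ℕ} (τ : TracialState n)
  {σ : ℝ → ((vN τ).toStarSubalgebra ≃⋆ₐ[ℂ] (vN τ).toStarSubalgebra)}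
  (hσ : IsModularGroup (vN τ).toStarSubalgebra (vectorSumWeight (weightVector τ)) σ)
  (hn : n ≠ 0)
  {ι : Type*} [Fintype ι] [DecidableEq ι] {p : ι → Alg n} (hp : IsProjPartition p)
  {l : ι → ℝ} (hl : ∀ i, 0 ≤ l i) {f : Alg n} {η a : ℝ} (hη : 0 < η) (ha : 0 < a)
  (hf : ‖f - ∑ i, (l i : ℂ) • p i‖ ≤ η ^ 2)

include hσ hn hp in
theorem regionProj_mem_fixedPoints (x : ι → ℝ) :
    regionProj τ p x ∈ fixedPoints (vN τ).toStarSubalgebra σ :=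
  sum_mem fun i _ => sum_mem fun k _ =>
    rep_mul_degreeProj_mem_fixedPoints τ hσ hn (hp.mem i) k

include hσ hn hp hl hη ha hf

theorem singularValue_le_of_near {s : ℝ}
    (hs : 2 * ((kmsState τ (∑ i, (l i : ℂ) • p i)).re + η) / a + 1 ≤ s) :
    singularValue (fixedPoints (vN τ).toStarSubalgebra σ) (vectorSumWeight (weightVector τ))
      (rep τ f * resolventRoot τ) s ≤ (1 + η) * a := by
  -- For `|k| > x_i` one has `(l_i + η)(1 + k²)^{-1/2} ≤ a`, which bounds both the eigenvalue of `g
  -- R` by `a` and that of `R` by `a / η`.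
  set x : ι → ℝ := fun i => (l i + η) / a with hx
  set g := ∑ i, (l i : ℂ) • p i with hg
  set E := 1 - regionProj τ p x with hE
  have hx0 : ∀ i, 0 ≤ x i := fun i => div_nonneg (by linarith [hl i]) ha.le
  have hQ := isStarProjection_regionProj τ hp x
  have hwt : vectorSumWeight (weightVector τ) (1 - E) ≤ ENNReal.ofReal s := by
    rw [hE, sub_sub_cancel, vectorSumWeight_regionProj τ hp hn]
    refine ENNReal.ofReal_le_ofReal (le_trans ?_ hs)
    calc ∑ i, ((Finset.Icc (-⌊x i⌋) ⌊x i⌋).card : ℝ) * (kmsState τ (p i)).re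
        ≤ ∑ i, (2 * x i + 1) * (kmsState τ (p i)).re :=
          Finset.sum_le_sum fun i _ => mul_le_mul_of_nonneg_right (card_Icc_floor_le (hx0 i))
            (kmsState_re_nonneg τ hp i)
      _ = 2 / a * ∑ i, l i * (kmsState τ (p i)).re
          + (2 * η / a + 1) * ∑ i, (kmsState τ (p i)).re := by
          rw [Finset.mul_sum, Finset.mul_sum, ← Finset.sum_add_distrib]
          refine Finset.sum_congr rfl fun i _ => ?_
          rw [hx]
          ring
      _ = _ := by
          rw [sum_mul_kmsState_re τ hp, sum_kmsState_re τ hp]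
          ring
  refine (singularValue_le (sub_mem (one_mem _) (regionProj_mem_fixedPoints τ hσ hn hp x))
    hQ.one_sub hwt).trans ?_
  have hbd : ∀ j : ι × ℤ, x j.1 < |(j.2 : ℝ)| → (l j.1 + η) * invSqrtWeight j.2 ≤ a := by
    intro j hj
    rw [hx, div_lt_iff₀ ha] at hj
    have h1 := invSqrtWeight_mul_abs_le j.2
    have h2 := invSqrtWeight_pos j.2
    nlinarith
  have hEb : ∃ C, ∀ j : ι × ℤ, |(if |(j.2 : ℝ)| ≤ x j.1 then 0 else 1 : ℝ)| ≤ C :=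
    ⟨1, fun j => by split_ifs <;> simp⟩
  have hRE : ‖resolventRoot τ * E‖ ≤ a / η := by
    rw [hE, one_sub_regionProj_eq τ hp, resolventRoot_eq_fineDiag τ hp, fineDiag_mul τ hp
      ⟨1, fun j => by
        rw [abs_of_pos (invSqrtWeight_pos _)]; exact invSqrtWeight_le_one _⟩ hEb]
    refine norm_fineDiag_le τ hp (by positivity) fun j => ?_
    split_ifs with h
    · rw [mul_zero, abs_zero]; positivity
    · rw [mul_one, abs_of_pos (invSqrtWeight_pos _), le_div_iff₀ hη]
      have h1 := hbd j (not_le.1 h)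
      nlinarith [hl j.1, invSqrtWeight_pos j.2]
  have hgRE : ‖rep τ g * resolventRoot τ * E‖ ≤ a := by
    rw [hE, one_sub_regionProj_eq τ hp, rep_mul_resolventRoot τ hp, fineDiag_mul τ hp
      (exists_abs_le_mul_invSqrtWeight l) hEb]
    refine norm_fineDiag_le τ hp ha.le fun j => ?_
    split_ifs with h
    · rw [mul_zero, abs_zero]; exact ha.le
    · rw [mul_one, abs_of_nonneg (mul_nonneg (hl _) (invSqrtWeight_pos _).le)]
      have h1 := hbd j (not_le.1 h)
      nlinarith [invSqrtWeight_pos j.2]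
  have hsplit : rep τ f * resolventRoot τ * E
      = rep τ (f - g) * (resolventRoot τ * E) + rep τ g * resolventRoot τ * E := by
    rw [map_sub, sub_mul, mul_assoc, mul_assoc, sub_add_cancel]
  -- The perturbation costs `η² · a / η = η a`; this is why the approximation is required to order
  -- `η²`.
  rw [hsplit]
  calc _ ≤ ‖rep τ (f - g)‖ * ‖resolventRoot τ * E‖ + ‖rep τ g * resolventRoot τ * E‖ :=
        (norm_add_le _ _).trans (add_le_add_left (norm_mul_le _ _) _)
    _ ≤ η ^ 2 * (a / η) + a := by
        gcongr
        exact (norm_rep_le τ _).trans hf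
    _ = (1 + η) * a := by
        field_simp
        ring

theorem le_singularValue_of_near (hη1 : η ≤ 1) {s : ℝ} (hs0 : 0 ≤ s)
    (hs : s < 2 * ((kmsState τ (∑ i, (l i : ℂ) • p i)).re - η) / a - 3) :
    (1 - η) * a ≤ singularValue (fixedPoints (vN τ).toStarSubalgebra σ)
      (vectorSumWeight (weightVector τ)) (rep τ f * resolventRoot τ) s := by
  -- For `|k| ≤ x_i` one has `l_i ≥ a (1 + |k|) + η`. The first summand makes the eigenvalue of `g
  -- R` at least `a`, the second gives `l_i ≥ η` for the control of the perturbation.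
  set x : ι → ℝ := fun i => (l i - η) / a - 1 with hx
  set g := ∑ i, (l i : ℂ) • p i with hg
  set P := regionProj τ p x with hP
  have hPp := isStarProjection_regionProj τ hp x
  have hwt : ENNReal.ofReal s < vectorSumWeight (weightVector τ) P := by
    rw [hP, vectorSumWeight_regionProj τ hp hn]
    have h : 2 * ((kmsState τ g).re - η) / a - 3
        ≤ ∑ i, ((Finset.Icc (-⌊x i⌋) ⌊x i⌋).card : ℝ) * (kmsState τ (p i)).re := by
      calc 2 * ((kmsState τ g).re - η) / a - 3
          = 2 / a * ∑ i, l i * (kmsState τ (p i)).re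
            - (2 * η / a + 3) * ∑ i, (kmsState τ (p i)).re := by
            rw [sum_mul_kmsState_re τ hp, sum_kmsState_re τ hp]
            ring
        _ = ∑ i, (2 * x i - 1) * (kmsState τ (p i)).re := by
            rw [Finset.mul_sum, Finset.mul_sum, ← Finset.sum_sub_distrib]
            refine Finset.sum_congr rfl fun i _ => ?_
            rw [hx]
            ring
        _ ≤ _ := Finset.sum_le_sum fun i _ => mul_le_mul_of_nonneg_right (le_card_Icc_floor _)
            (kmsState_re_nonneg τ hp i)
    have h' := hs.trans_le h
    exact (ENNReal.ofReal_lt_ofReal_iff (hs0.trans_lt h')).2 h'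
  have hbd : ∀ j : ι × ℤ, |(j.2 : ℝ)| ≤ x j.1 →
      η ≤ l j.1 ∧ a ≤ l j.1 * invSqrtWeight j.2 := by
    intro j hj
    rw [hx, le_sub_iff_add_le, le_div_iff₀ ha] at hj
    have h1 := one_le_invSqrtWeight_mul j.2
    have h2 := invSqrtWeight_pos j.2
    have h3 := abs_nonneg (j.2 : ℝ)
    constructor <;> nlinarith
  have hPb : ∃ C, ∀ j : ι × ℤ, |(if |(j.2 : ℝ)| ≤ x j.1 then 1 else 0 : ℝ)| ≤ C :=
    ⟨1, fun j => by split_ifs <;> simp⟩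
  have hgP : rep τ g * resolventRoot τ * P = fineDiag τ p fun j =>
      l j.1 * invSqrtWeight j.2 * if |(j.2 : ℝ)| ≤ x j.1 then 1 else 0 := by
    rw [hP, regionProj_eq τ hp, rep_mul_resolventRoot τ hp, fineDiag_mul τ hp
      (exists_abs_le_mul_invSqrtWeight l) hPb]
  have hgPb : ∃ C, ∀ j : ι × ℤ,
      |l j.1 * invSqrtWeight j.2 * if |(j.2 : ℝ)| ≤ x j.1 then 1 else 0| ≤ C := by
    obtain ⟨C, hC⟩ := exists_abs_le_mul_invSqrtWeight l
    refine ⟨C, fun j => ?_⟩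
    split_ifs
    · rw [mul_one]; exact hC j
    · rw [mul_zero, abs_zero]; exact (abs_nonneg _).trans (hC j)
  -- A lower bound for a diagonal operator, obtained by exhibiting a diagonal contraction that maps
  -- `g R P` to `a P`.
  have hlow : ∀ v, a * ‖P v‖ ≤ ‖(rep τ g * resolventRoot τ * P) v‖ := by
    intro v
    have hd : ∀ j : ι × ℤ, |(if |(j.2 : ℝ)| ≤ x j.1 then a / (l j.1 * invSqrtWeight j.2)
        else 0 : ℝ)| ≤ 1 := fun j => by
      split_ifs with h
      · obtain ⟨-, h2⟩ := hbd j h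
        have h3 := ha.trans_le h2
        rw [abs_of_pos (by positivity)]
        exact (div_le_one h3).2 h2
      · simp
    have h1 : (fineDiag τ p fun j => if |(j.2 : ℝ)| ≤ x j.1 then a / (l j.1 * invSqrtWeight j.2)
        else 0) * (rep τ g * resolventRoot τ * P) = (a : ℂ) • P := by
      rw [hgP, fineDiag_mul τ hp ⟨1, hd⟩ hgPb]
      symm
      refine fineDiag_eq τ hp ⟨a, fun j => ?_⟩ fun i k b hb => ?_
      · split_ifs with h
        · obtain ⟨-, h2⟩ := hbd j h
          have h3 := ha.trans_le h2
          rw [mul_one, div_mul_cancel₀ _ h3.ne', abs_of_pos ha]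
        · simp [ha.le]
      · rw [smul_apply, regionProj_toHilb τ hp x i hb, smul_smul]
        congr 1
        dsimp only
        split_ifs with h
        · have h3 := ha.trans_le (hbd (i, k) h).2
          dsimp only at h3
          rw [mul_one, div_mul_cancel₀ _ h3.ne']
          simp
        · simp
    have h2 := congrArg (fun T : Hilb τ →L[ℂ] Hilb τ => ‖T v‖) h1
    simp only [smul_apply, norm_smul, Complex.norm_real, Real.norm_of_nonneg ha.le] at h2
    rw [← h2, mul_apply_eq_comp]
    refine (ContinuousLinearMap.le_opNorm _ _).trans ?_
    exact mul_le_of_le_one_left (norm_nonneg _) (norm_fineDiag_le τ hp zero_le_one hd)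
  -- On the region `R` is dominated by `η⁻¹ g R`, so the perturbation, at most `η² ‖R P v‖`, is at
  -- most `η ‖g R P v‖`.
  have hRP : ∀ v, η * ‖resolventRoot τ (P v)‖ ≤ ‖(rep τ g * resolventRoot τ * P) v‖ := by
    intro v
    have hd : ∀ j : ι × ℤ, |(if |(j.2 : ℝ)| ≤ x j.1 then η / l j.1 else 0 : ℝ)| ≤ 1 := fun j => by
      split_ifs with h
      · obtain ⟨h2, -⟩ := hbd j h
        have h3 := hη.trans_le h2
        rw [abs_of_pos (by positivity)]
        exact (div_le_one h3).2 h2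
      · simp
    have h1 : (fineDiag τ p fun j => if |(j.2 : ℝ)| ≤ x j.1 then η / l j.1 else 0)
        * (rep τ g * resolventRoot τ * P) = (η : ℂ) • (resolventRoot τ * P) := by
      rw [hgP, fineDiag_mul τ hp ⟨1, hd⟩ hgPb]
      symm
      refine fineDiag_eq τ hp ⟨η, fun j => ?_⟩ fun i k b hb => ?_
      · split_ifs with h
        · have h3 := hη.trans_le (hbd j h).1
          rw [mul_one, ← mul_assoc, div_mul_cancel₀ _ h3.ne',
            abs_of_pos (mul_pos hη (invSqrtWeight_pos _))]
          exact mul_le_of_le_one_right hη.le (invSqrtWeight_le_one _)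
        · simp [hη.le]
      · rw [smul_apply, mul_apply_eq_comp, regionProj_toHilb τ hp x i hb, map_smul,
          resolventRoot_eq, gradedDiag_toHilb τ exists_norm_invSqrtWeight_le
          (hp.mul_mem_homogeneous i hb), smul_smul, smul_smul]
        congr 1
        dsimp only
        split_ifs with h
        · have h3 := hη.trans_le (hbd (i, k) h).1
          dsimp only at h3
          rw [mul_one, ← mul_assoc, div_mul_cancel₀ _ h3.ne']
          simp
        · simp
    have h2 := congrArg (fun T : Hilb τ →L[ℂ] Hilb τ => ‖T v‖) h1
    simp only [smul_apply, norm_smul, Complex.norm_real, Real.norm_of_nonneg hη.le] at h2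
    change η * ‖(resolventRoot τ * P) v‖ ≤ _
    rw [← h2, mul_apply_eq_comp]
    refine (ContinuousLinearMap.le_opNorm _ _).trans ?_
    exact mul_le_of_le_one_left (norm_nonneg _) (norm_fineDiag_le τ hp zero_le_one hd)
  have hT : ∀ v, (1 - η) * a * ‖P v‖ ≤ ‖(rep τ f * resolventRoot τ) (P v)‖ := by
    intro v
    set w := resolventRoot τ (P v) with hw
    have h1 : (rep τ f * resolventRoot τ) (P v)
        = (rep τ g * resolventRoot τ * P) v + rep τ (f - g) w := by
      rw [map_sub, sub_apply, mul_apply_eq_comp, mul_apply_eq_comp, mul_apply_eq_comp,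
        add_sub_cancel]
    have h2 : ‖rep τ (f - g) w‖ ≤ η ^ 2 * ‖w‖ :=
      (ContinuousLinearMap.le_opNorm _ _).trans
        (mul_le_mul_of_nonneg_right ((norm_rep_le τ _).trans hf) (norm_nonneg _))
    have h3 := hRP v
    have h4 := hlow v
    have h5 := norm_sub_le ((rep τ f * resolventRoot τ) (P v)) (rep τ (f - g) w)
    rw [h1, add_sub_cancel_right, ← h1] at h5
    nlinarith
  refine le_singularValue (by simp [vectorSumWeight]) fun E hEM hE hEs => ?_
  -- Otherwise `P` would be equivalent to a subprojection of `1 - E`, whose weight is at most `s`,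
  -- while `P` has weight greater than `s`.
  by_contra hlt
  have h := hσ.weight_le_of_norm_lt hPp (regionProj_mem_fixedPoints τ hσ hn hp x)
    (by rw [vectorSumWeight_regionProj τ hp hn]; exact ENNReal.ofReal_lt_top) hE hEM
    (hEs.trans_lt ENNReal.ofReal_lt_top) hT (not_le.1 hlt)
  exact absurd (h.trans hEs) (not_le.2 hwt)

end Bounds

end Cuntz

/-! ### The Dixmier trace of `f (1 + 𝒟²)^{-1/2}` -/

namespace OperatorTheory

open Filter Topology

variable {H : Type*} [NormedAddCommGroup H] [InnerProductSpace ℂ H] [CompleteSpace H]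
  {M : StarSubalgebra ℂ (H →L[ℂ] H)} {φ : (H →L[ℂ] H) → ℝ≥0∞} {T : H →L[ℂ] H}

theorem measurable_logMean (h0 : φ 0 = 0) : Measurable (logMean M φ T) := by
  have h : Continuous fun t : ℝ => ∫ s in (0 : ℝ)..t, singularValue M φ T s :=
    intervalIntegral.continuous_primitive
      (fun a b => (antitone_singularValue h0).intervalIntegrable) 0
  unfold logMean
  exact (Real.measurable_log.comp (measurable_const.add measurable_id)).inv.mul h.measurable

theorem exists_norm_logMean_le (h0 : φ 0 = 0) {c : ℝ}
    (hlim : Tendsto (fun s => s * singularValue M φ T s) atTop (𝓝 c)) :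
    ∃ C, ∀ t : ℝ, 0 < t → ‖logMean M φ T t‖ ≤ C :=
  exists_norm_inv_log_mul_integral_le (B := ‖T‖) (fun s => by
    rw [Real.norm_of_nonneg (singularValue_nonneg s)]
    exact singularValue_le_norm h0 s)
    (tendsto_inv_log_mul_integral (antitone_singularValue h0) hlim)

/-- The logarithmic mean converges, so every extended limit takes the same value. Its measurability
and boundedness rule out the default value `0` in `dixmierPos`. -/
theorem dixmierPos_eq (h0 : φ 0 = 0) {c : ℝ}
    (hlim : Tendsto (fun s => s * singularValue M φ T s) atTop (𝓝 c)) (ω : ExtendedLimit) :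
    dixmierPos ω M φ T = c := by
  obtain ⟨C, hC⟩ := exists_norm_logMean_le h0 hlim
  have hmem : MemLp (logMean M φ T) ∞ (volume.restrict (Set.Ioi (0 : ℝ))) :=
    memLp_top_of_bound (measurable_logMean h0).aestronglyMeasurable C
      (ae_restrict_of_forall_mem measurableSet_Ioi hC)
  rw [dixmierPos, dif_pos hmem]
  exact ω.eq_of_tendsto _ _ c hmem.coeFn_toLp
    (tendsto_inv_log_mul_integral (antitone_singularValue h0) hlim)

theorem logMean_mul_le (h0 : φ 0 = 0) (A : H →L[ℂ] H) {t : ℝ} (ht : 0 < t) :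
    logMean M φ (A * T) t ≤ ‖A‖ * logMean M φ T t := by
  have hL : 0 < Real.log (1 + t) := Real.log_pos (by linarith)
  have h : ∫ s in (0 : ℝ)..t, singularValue M φ (A * T) s
      ≤ ∫ s in (0 : ℝ)..t, ‖A‖ * singularValue M φ T s :=
    intervalIntegral.integral_mono_on ht.le (antitone_singularValue h0).intervalIntegrable
      ((antitone_singularValue h0).intervalIntegrable.const_mul _)
      fun s _ => singularValue_mul_le h0 A s
  rw [intervalIntegral.integral_const_mul] at h
  unfold logMean
  calc _ ≤ (Real.log (1 + t))⁻¹ * (‖A‖ * ∫ s in (0 : ℝ)..t, singularValue M φ T s) := by gcongr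
    _ = _ := by ring

theorem mul_mem_L1Infty (h0 : φ 0 = 0) (hT : T ∈ L1Infty M φ) {A : H →L[ℂ] H}
    (hAT : A * T ∈ M) : A * T ∈ L1Infty M φ := by
  obtain ⟨-, C, hC⟩ := hT
  exact ⟨hAT, ‖A‖ * C, fun t ht => (logMean_mul_le h0 A ht).trans
    (mul_le_mul_of_nonneg_left (hC t ht) (norm_nonneg A))⟩

/-- The Dixmier trace in terms of any orthogonal decomposition of the real and imaginary parts. -/
theorem dixmierTrace_eq {ω : ExtendedLimit} {a b c d : H →L[ℂ] H}
    (hre : (realPart T : H →L[ℂ] H) = a - b) (hab : a * b = 0) (ha : 0 ≤ a) (hb : 0 ≤ b)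
    (him : (imaginaryPart T : H →L[ℂ] H) = c - d) (hcd : c * d = 0) (hc : 0 ≤ c) (hd : 0 ≤ d) :
    dixmierTrace ω M φ T = ((dixmierPos ω M φ a - dixmierPos ω M φ b : ℝ) : ℂ)
      + Complex.I * ((dixmierPos ω M φ c - dixmierPos ω M φ d : ℝ) : ℂ) := by
  obtain ⟨h1, h2⟩ := CFC.posPart_negPart_unique hre hab ha hb
  obtain ⟨h3, h4⟩ := CFC.posPart_negPart_unique him hcd hc hd
  rw [dixmierTrace, h1, h2, h3, h4]

end OperatorTheory

namespace Cuntz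

open OperatorTheory Filter Topology

variable {n : ℕ} (τ : TracialState n)

/-- An automorphism `γ_z` fixing `h` carries its orthogonal positive decomposition to another one,
and that decomposition is unique. -/
theorem posPart_mem_fixedAlg_and_negPart_mem {h : Alg n} (hF : h ∈ fixedAlg n)
    (hh : IsSelfAdjoint h) : h⁺ ∈ fixedAlg n ∧ h⁻ ∈ fixedAlg n := by
  have key : ∀ z : Circle, h⁺ = gauge z h⁺ ∧ h⁻ = gauge z h⁻ := fun z => by
    refine CFC.posPart_negPart_unique ?_ ?_ (gauge_nonneg z (CFC.posPart_nonneg h))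
      (gauge_nonneg z (CFC.negPart_nonneg h))
    · rw [← map_sub, CFC.posPart_sub_negPart h hh, hF z]
    · rw [← map_mul, CFC.posPart_mul_negPart, map_zero]
  exact ⟨fun z => (key z).1.symm, fun z => (key z).2.symm⟩

theorem rep_commute_resolventRoot {f : Alg n} (hf : f ∈ fixedAlg n) :
    rep τ f * resolventRoot τ = resolventRoot τ * rep τ f := by
  rw [resolventRoot_eq]
  exact rep_commute_gradedDiag τ exists_norm_invSqrtWeight_le hf

theorem resolventRoot_nonneg : 0 ≤ resolventRoot τ := by
  rw [resolventRoot_eq]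
  exact (isOrthogonalDecomposition_component τ).diag_nonneg ⟨1, invSqrtWeight_le_one⟩
    fun k => (invSqrtWeight_pos k).le

theorem star_resolventRoot : star (resolventRoot τ) = resolventRoot τ :=
  (IsSelfAdjoint.of_nonneg (resolventRoot_nonneg τ)).star_eq

theorem star_rep_mul_resolventRoot {f : Alg n} (hf : f ∈ fixedAlg n) :
    star (rep τ f * resolventRoot τ) = rep τ (star f) * resolventRoot τ := by
  rw [star_mul, star_resolventRoot, ← map_star, rep_commute_resolventRoot τ (star_mem hf)]

/-- `f` commutes with `R`, so `f R = f^{1/2} R f^{1/2}`. -/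
theorem rep_mul_resolventRoot_nonneg {f : Alg n} (hf : f ∈ fixedAlg n) (h0 : 0 ≤ f) :
    0 ≤ rep τ f * resolventRoot τ := by
  have hs := sqrt_mem_fixedAlg hf h0
  have hss : star (CFC.sqrt f) = CFC.sqrt f :=
    (IsSelfAdjoint.of_nonneg (CFC.sqrt_nonneg f)).star_eq
  have h := star_left_conjugate_nonneg (resolventRoot_nonneg τ) (rep τ (CFC.sqrt f))
  rwa [← map_star, hss, mul_assoc, ← rep_commute_resolventRoot τ hs, ← mul_assoc, ← map_mul,
    CFC.sqrt_mul_sqrt_self f h0] at h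

theorem rep_mul_resolventRoot_eq_sub {h : Alg n} (hh : IsSelfAdjoint h) :
    rep τ h * resolventRoot τ = rep τ h⁺ * resolventRoot τ - rep τ h⁻ * resolventRoot τ := by
  rw [← sub_mul, ← map_sub, CFC.posPart_sub_negPart h hh]

theorem rep_posPart_mul_rep_negPart {h : Alg n} (hF : h ∈ fixedAlg n) (hh : IsSelfAdjoint h) :
    rep τ h⁺ * resolventRoot τ * (rep τ h⁻ * resolventRoot τ) = 0 := by
  rw [rep_commute_resolventRoot τ (posPart_mem_fixedAlg_and_negPart_mem hF hh).1, mul_assoc,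
    ← mul_assoc (rep τ h⁺), ← map_mul, CFC.posPart_mul_negPart, map_zero, zero_mul, mul_zero]

theorem realPart_rep_mul_resolventRoot {f : Alg n} (hf : f ∈ fixedAlg n) :
    (realPart (rep τ f * resolventRoot τ) : Hilb τ →L[ℂ] Hilb τ)
      = rep τ (realPart f : Alg n) * resolventRoot τ := by
  have h : ∀ x : Alg n, rep τ ((2 : ℝ)⁻¹ • x) = (2 : ℝ)⁻¹ • rep τ x := fun x => by
    rw [← Complex.coe_smul, map_smul, Complex.coe_smul]
  rw [realPart_apply_coe, realPart_apply_coe, star_rep_mul_resolventRoot τ hf, h, map_add,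
    smul_mul_assoc, add_mul]

theorem imaginaryPart_rep_mul_resolventRoot {f : Alg n} (hf : f ∈ fixedAlg n) :
    (imaginaryPart (rep τ f * resolventRoot τ) : Hilb τ →L[ℂ] Hilb τ)
      = rep τ (imaginaryPart f : Alg n) * resolventRoot τ := by
  have h : ∀ x : Alg n, rep τ ((2 : ℝ)⁻¹ • x) = (2 : ℝ)⁻¹ • rep τ x := fun x => by
    rw [← Complex.coe_smul, map_smul, Complex.coe_smul]
  rw [imaginaryPart_apply_coe, imaginaryPart_apply_coe, star_rep_mul_resolventRoot τ hf,
    map_smul, h, map_sub, smul_mul_assoc, smul_mul_assoc, sub_mul]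

theorem realPart_mem_fixedAlg {f : Alg n} (hf : f ∈ fixedAlg n) :
    (realPart f : Alg n) ∈ fixedAlg n := by
  rw [realPart_apply_coe, ← Complex.coe_smul]
  exact (fixedAlg n).smul_mem (add_mem hf (star_mem hf)) _

theorem imaginaryPart_mem_fixedAlg {f : Alg n} (hf : f ∈ fixedAlg n) :
    (imaginaryPart f : Alg n) ∈ fixedAlg n := by
  rw [imaginaryPart_apply_coe, ← Complex.coe_smul]
  exact (fixedAlg n).smul_mem ((fixedAlg n).smul_mem (sub_mem hf (star_mem hf)) _) _

theorem ofReal_kmsState_re {f : Alg n} (h0 : 0 ≤ f) :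
    (((kmsState τ f).re : ℝ) : ℂ) = kmsState τ f :=
  Complex.ext (Complex.ofReal_re _)
    ((Complex.ofReal_im _).trans (Complex.nonneg_iff.1 (map_nonneg (kmsState τ) h0)).2)

variable {σ : ℝ → ((vN τ).toStarSubalgebra ≃⋆ₐ[ℂ] (vN τ).toStarSubalgebra)}
  (hσ : IsModularGroup (vN τ).toStarSubalgebra (vectorSumWeight (weightVector τ)) σ)
  (hn : n ≠ 0)

include hσ hn

/-- The level `a` in the two counting bounds is adjusted to `s`. The margin `2η` consists of the `η`
in those bounds and of `|φ(f) - φ(g)| ≤ η² ≤ η`. -/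
theorem mul_singularValue_bounds {f : Alg n} (hf : f ∈ fixedAlg n) (h0 : 0 ≤ f) {η : ℝ}
    (hη : 0 < η) (hη1 : η ≤ 1) {s : ℝ} (hs : 1 < s) :
    (1 - η) * (2 * ((kmsState τ f).re - 2 * η)) * (s / (s + 4))
        ≤ s * singularValue (fixedPoints (vN τ).toStarSubalgebra σ)
          (vectorSumWeight (weightVector τ)) (rep τ f * resolventRoot τ) s ∧
      s * singularValue (fixedPoints (vN τ).toStarSubalgebra σ)
          (vectorSumWeight (weightVector τ)) (rep τ f * resolventRoot τ) s
        ≤ (1 + η) * (2 * ((kmsState τ f).re + 2 * η)) * (s / (s - 1)) := by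
  obtain ⟨m, p, l, hp, hl, hd⟩ := exists_projPartition_near τ hf h0 (by positivity : 0 < η ^ 2)
  set A := (kmsState τ f).re
  set B := (kmsState τ (∑ i, (l i : ℂ) • p i)).re with hB
  have hAB : |A - B| ≤ η := by
    have h1 : A - B = (kmsState τ (f - ∑ i, (l i : ℂ) • p i)).re := by
      rw [map_sub, Complex.sub_re]
    rw [h1]
    refine ((Complex.abs_re_le_norm _).trans (norm_kmsState_le τ _)).trans (hd.trans ?_)
    nlinarith
  obtain ⟨hAB1, hAB2⟩ := abs_le.1 hAB
  have hA0 : 0 ≤ A := (Complex.nonneg_iff.1 (map_nonneg (kmsState τ) h0)).1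
  constructor
  · rcases le_or_gt (A - 2 * η) 0 with hneg | hpos
    · refine le_trans ?_ (mul_nonneg (by linarith) (singularValue_nonneg s))
      refine mul_nonpos_of_nonpos_of_nonneg ?_ (by positivity)
      exact mul_nonpos_of_nonneg_of_nonpos (by linarith) (by linarith)
    -- This level makes the count `2 (A - 2η) / a - 3` equal to `s + 1`, strictly above `s` as
    -- required.
    · have ha : 0 < 2 * (A - 2 * η) / (s + 4) := by positivity
      have h := le_singularValue_of_near τ hσ hn hp hl hη ha hd hη1 (s := s) (by linarith) (by
        have h1 : 2 * (A - 2 * η) / (2 * (A - 2 * η) / (s + 4)) = s + 4 := by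
          field_simp
        have h2 : 2 * (A - 2 * η) / (2 * (A - 2 * η) / (s + 4))
            ≤ 2 * (B - η) / (2 * (A - 2 * η) / (s + 4)) := by
          exact div_le_div_of_nonneg_right (by linarith) ha.le
        linarith)
      calc _ = s * ((1 - η) * (2 * (A - 2 * η) / (s + 4))) := by ring
        _ ≤ _ := by gcongr
  · have hs1 : 0 < s - 1 := by linarith
    -- This level makes the count `2 (A + 2η) / a + 1` equal to `s`.
    have ha : 0 < 2 * (A + 2 * η) / (s - 1) := by positivity
    have h := singularValue_le_of_near τ hσ hn hp hl hη ha hd (s := s) (by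
      have h1 : 2 * (A + 2 * η) / (2 * (A + 2 * η) / (s - 1)) = s - 1 := by
        field_simp
      have h2 : 2 * (B + η) / (2 * (A + 2 * η) / (s - 1))
          ≤ 2 * (A + 2 * η) / (2 * (A + 2 * η) / (s - 1)) := by
        exact div_le_div_of_nonneg_right (by linarith) ha.le
      linarith)
    calc _ ≤ s * ((1 + η) * (2 * (A + 2 * η) / (s - 1))) := by gcongr
      _ = _ := by ring

theorem tendsto_mul_singularValue {f : Alg n} (hf : f ∈ fixedAlg n) (h0 : 0 ≤ f) :
    Tendsto (fun s => s * singularValue (fixedPoints (vN τ).toStarSubalgebra σ)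
      (vectorSumWeight (weightVector τ)) (rep τ f * resolventRoot τ) s) atTop
      (𝓝 (2 * (kmsState τ f).re)) := by
  have hquot : ∀ K b : ℝ, Tendsto (fun s : ℝ => K * (s / (s + b))) atTop (𝓝 K) := by
    intro K b
    have h1 : Tendsto (fun s : ℝ => b / (s + b)) atTop (𝓝 0) :=
      tendsto_const_nhds.div_atTop (tendsto_atTop_add_const_right _ _ tendsto_id)
    have h2 : Tendsto (fun s : ℝ => K * (1 - b / (s + b))) atTop (𝓝 (K * (1 - 0))) :=
      (tendsto_const_nhds.sub h1).const_mul K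
    rw [sub_zero, mul_one] at h2
    refine h2.congr' ?_
    filter_upwards [eventually_gt_atTop (-b)] with s hs
    have : s + b ≠ 0 := by linarith
    field_simp
    ring
  have hsmall : ∀ᶠ η : ℝ in 𝓝[>] 0, 0 < η ∧ η ≤ 1 := by
    filter_upwards [Ioc_mem_nhdsGT (zero_lt_one' ℝ)] with η hη using hη
  rw [tendsto_order]
  constructor
  · intro c hc
    have hcont : Tendsto (fun η : ℝ => (1 - η) * (2 * ((kmsState τ f).re - 2 * η))) (𝓝[>] 0)
        (𝓝 (2 * (kmsState τ f).re)) := by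
      refine Tendsto.mono_left ?_ nhdsWithin_le_nhds
      have : Continuous fun η : ℝ => (1 - η) * (2 * ((kmsState τ f).re - 2 * η)) := by fun_prop
      simpa using this.tendsto 0
    -- First `η` is fixed so that the limiting bound exceeds `c`; only then does `s` tend to
    -- infinity.
    obtain ⟨η, hcη, hη, hη1⟩ := ((hcont.eventually (lt_mem_nhds hc)).and hsmall).exists
    filter_upwards [(hquot _ 4).eventually (lt_mem_nhds hcη), eventually_gt_atTop 1] with s h1 hs
    exact h1.trans_le (mul_singularValue_bounds τ hσ hn hf h0 hη hη1 hs).1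
  · intro c hc
    have hcont : Tendsto (fun η : ℝ => (1 + η) * (2 * ((kmsState τ f).re + 2 * η))) (𝓝[>] 0)
        (𝓝 (2 * (kmsState τ f).re)) := by
      refine Tendsto.mono_left ?_ nhdsWithin_le_nhds
      have : Continuous fun η : ℝ => (1 + η) * (2 * ((kmsState τ f).re + 2 * η)) := by fun_prop
      simpa using this.tendsto 0
    obtain ⟨η, hcη, hη, hη1⟩ := ((hcont.eventually (gt_mem_nhds hc)).and hsmall).exists
    filter_upwards [(hquot _ (-1)).eventually (gt_mem_nhds hcη), eventually_gt_atTop 1]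
      with s h1 hs
    exact ((mul_singularValue_bounds τ hσ hn hf h0 hη hη1 hs).2).trans_lt h1

theorem rep_mul_resolventRoot_mem_fixedPoints {f : Alg n} (hf : f ∈ fixedAlg n) :
    rep τ f * resolventRoot τ ∈ fixedPoints (vN τ).toStarSubalgebra σ := by
  rw [resolventRoot_eq]
  exact rep_mul_gradedDiag_mem_fixedPoints τ hσ hn hf exists_norm_invSqrtWeight_le

theorem resolventRoot_mem_L1Infty : resolventRoot τ ∈
    L1Infty (fixedPoints (vN τ).toStarSubalgebra σ) (vectorSumWeight (weightVector τ)) := by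
  have hone := one_mem (fixedAlg n)
  have h1 := rep_mul_resolventRoot_mem_fixedPoints τ hσ hn hone
  have h2 := tendsto_mul_singularValue τ hσ hn hone zero_le_one
  rw [map_one, one_mul] at h1
  simp only [map_one, one_mul] at h2
  obtain ⟨C, hC⟩ := exists_norm_logMean_le (by simp [vectorSumWeight]) h2
  exact ⟨h1, C, fun t ht => (le_abs_self _).trans (hC t ht)⟩

theorem dixmierPos_sub_dixmierPos {h : Alg n} (hF : h ∈ fixedAlg n) (hh : IsSelfAdjoint h)
    (ω : ExtendedLimit) :
    ((dixmierPos ω (fixedPoints (vN τ).toStarSubalgebra σ) (vectorSumWeight (weightVector τ))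
        (rep τ h⁺ * resolventRoot τ)
      - dixmierPos ω (fixedPoints (vN τ).toStarSubalgebra σ) (vectorSumWeight (weightVector τ))
        (rep τ h⁻ * resolventRoot τ) : ℝ) : ℂ) = 2 * kmsState τ h := by
  obtain ⟨h1, h2⟩ := posPart_mem_fixedAlg_and_negPart_mem hF hh
  have hp := CFC.posPart_nonneg h
  have hm := CFC.negPart_nonneg h
  rw [dixmierPos_eq (by simp [vectorSumWeight]) (tendsto_mul_singularValue τ hσ hn h1 hp),
    dixmierPos_eq (by simp [vectorSumWeight]) (tendsto_mul_singularValue τ hσ hn h2 hm)]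
  conv_rhs => rw [← CFC.posPart_sub_negPart h hh, map_sub]
  push_cast
  rw [ofReal_kmsState_re τ hp, ofReal_kmsState_re τ hm]
  ring

/-- Real, imaginary, positive and negative parts of `f R` are those of `f` multiplied by `R`, so the
four limits recombine by linearity of `φ`. -/
theorem dixmierTrace_rep_mul_resolventRoot {f : Alg n} (hf : f ∈ fixedAlg n)
    (ω : ExtendedLimit) :
    dixmierTrace ω (fixedPoints (vN τ).toStarSubalgebra σ) (vectorSumWeight (weightVector τ))
      (rep τ f * resolventRoot τ) = 2 * kmsState τ f := by
  have hr := realPart_mem_fixedAlg hf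
  have hi := imaginaryPart_mem_fixedAlg hf
  have hrs : IsSelfAdjoint (realPart f : Alg n) := (realPart f).2
  have his : IsSelfAdjoint (imaginaryPart f : Alg n) := (imaginaryPart f).2
  have hrp := posPart_mem_fixedAlg_and_negPart_mem hr hrs
  have hip := posPart_mem_fixedAlg_and_negPart_mem hi his
  rw [dixmierTrace_eq
    ((realPart_rep_mul_resolventRoot τ hf).trans (rep_mul_resolventRoot_eq_sub τ hrs))
    (rep_posPart_mul_rep_negPart τ hr hrs)
    (rep_mul_resolventRoot_nonneg τ hrp.1 (CFC.posPart_nonneg _))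
    (rep_mul_resolventRoot_nonneg τ hrp.2 (CFC.negPart_nonneg _))
    ((imaginaryPart_rep_mul_resolventRoot τ hf).trans (rep_mul_resolventRoot_eq_sub τ his))
    (rep_posPart_mul_rep_negPart τ hi his)
    (rep_mul_resolventRoot_nonneg τ hip.1 (CFC.posPart_nonneg _))
    (rep_mul_resolventRoot_nonneg τ hip.2 (CFC.negPart_nonneg _)),
    dixmierPos_sub_dixmierPos τ hσ hn hr hrs, dixmierPos_sub_dixmierPos τ hσ hn hi his]
  conv_rhs => rw [← realPart_add_I_smul_imaginaryPart f, map_add, map_smul, smul_eq_mul]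
  ring

end Cuntz

end

/-! ### The theorem -/

open Cuntz OperatorTheory in
theorem proposition8p6 (n : ℕ) (hn : 2 ≤ n) (τ : TracialState n)
    (σ : ℝ → ((vN τ).toStarSubalgebra ≃⋆ₐ[ℂ] (vN τ).toStarSubalgebra))
    (hσ : IsModularGroup (vN τ).toStarSubalgebra (tauDelta τ) σ) :
    resolventRoot τ ∈ L1Infty (fixedPoints (vN τ).toStarSubalgebra σ) (tauDelta τ) ∧
    ∀ f : fixedAlg n,
      rep τ (f : Alg n) * resolventRoot τ ∈
        L1Infty (fixedPoints (vN τ).toStarSubalgebra σ) (tauDelta τ) ∧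
      ∀ ω : ExtendedLimit,
        dixmierTrace ω (fixedPoints (vN τ).toStarSubalgebra σ) (tauDelta τ)
          (rep τ (f : Alg n) * resolventRoot τ) = 2 * τ.toLinearMap f := by
  have hn0 : n ≠ 0 := by omega
  rw [tauDelta_eq τ hn0] at hσ ⊢
  have hR := resolventRoot_mem_L1Infty τ hσ hn0
  refine ⟨hR, fun f => ⟨?_, fun ω => ?_⟩⟩
  · exact mul_mem_L1Infty (by simp [vectorSumWeight]) hR
      (rep_mul_resolventRoot_mem_fixedPoints τ hσ hn0 f.2)
  · rw [dixmierTrace_rep_mul_resolventRoot τ hσ hn0 f.2, kmsState_coe]
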